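/- Let $\mathcal Q=(\mathcal V,\mathcal E)$ be a natural join: $\mathcal V$ is a finite set of attributes, $\mathcal E$ a set of subsets of $\mathcal V$ (the relations), and every attribute lies in some relation. Suppose that $\mathcal Q$ is acyclic, i.e. there is a tree whose nodes are the relations in $\mathcal E$ such that for every attribute $X$ the nodes containing $X$ are connected in the tree. A database $\mathcal R$ consists of a set $R_e$ of tuples $t\in\prod_{x\in e}\mathrm{dom}(x)$ for each $e\in\mathcal E$; the join results are $$\mathcal Q(\mathcal R)=\Big\{q\in\prod_{x\in\mathcal V}\mathrm{dom}(x)\;\Big|\;\forall e\in\mathcal E,\ \pi_e q\in R_e\Big\},$$ and, for a tuple $t\notin\mathcal R$ of one of the relations, the delta query is $\Delta\mathcal Q(\mathcal R,t)=\mathcal Q(\mathcal R\cup\{t\})\setminus\mathcal Q(\mathcal R)$. An array whose entries are join results (real entries) or dummies is $\phi$-dense if, for every $i$ up to its length, at least $\phi\, i$ of its first $i$ entries are real. Costs are measured on a unit-cost RAM with words of $O(\log N)$ bits, in which a domain value occupies one word (and can only be copied, compared for equality and used in addresses), and whose memory is a dictionary (hash table) addressed by a bounded number of words with $O(1)$-time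 lookup and update; space is the maximal number of memory cells occupied at the same time. We write $\log N$ for $\lfloor\log_2 N\rfloor+1$. Then there are programs for an index $\mathcal L$, a constant $C$ and a constant $0<\phi\le 1$, all depending only on $\mathcal Q$ (not on the domains, the stream or $N$), such that for every stream of $N\ge 0$ tuples inserted one after the other into an initially empty database, with resulting database $\mathcal R$, the index $\mathcal L$ is maintained in space at most $C(N+1)$ and: 1. The $N$ insertions take at most $C\,N\log N$ steps in total, i.e. $O(\log N)$ amortized time per insertion. 2. $\mathcal L$ implicitly defines a $\phi$-dense array $J$ whose real entries are exactly the elements of $\mathcal Q(\mathcal R)$, each occurring once. Without changing $\mathcal L$, the size $|J|$ is returned in at most $C$ steps, and, for any given position $j$ in $J$, the entry $J[j]$ (the join result, or the information that the entry is a dummy) is returned in at most $C\log N$ steps. 3. The same holds for every delta query: for every tuple $t\notin\mathcal R$ of a relation of $\mathcal Q$, given $t$ as input, $\mathcal L$ implicitly defines a $\phi$-dense array $\Delta J$ whose real entries are exactly the elements of $\Delta\mathcal Q(\mathcal R,t)$, each occurring once; $|\Delta J|$ is returned in at most $C$ steps and any given entry of $\Delta J$ in at most $C\log N$ steps, without changing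 $\mathcal L$. -/

import Mathlib

/-! ## The machine model

A random access machine with unit-cost instructions.  It has a fixed finite set of named registers
(those that occur in the program) and a memory that is a dictionary (hash table): a memory cell is
addressed by a list of words, whose length is fixed by the instruction.  A word is a natural number
or an atom; atoms are the values of the database, and they can only be copied, compared for
equality, and used in addresses.  The word length and the number of occupied cells are limited. -/

namespace JoinIndex

universe u v

/-- A machine word: a natural number or an uninterpreted value. -/
inductive Word (A : Type u) where
  | num (n : ℕ)
  | atom (a : A)

/-- A number fits in a word of `b` bits iff it is less than `2 ^ b`; an atom occupies one word. -/
def Word.Fits {A : Type u} (b : ℕ) : Word A → Prop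
  | .num n => n < 2 ^ b
  | .atom _ => True

/-- An operand is a register (names in `ρ`) or a numerical constant. -/
inductive Operand (ρ : Type u) where
  | reg (r : ρ)
  | const (n : ℕ)

/-- The arithmetic instructions on natural numbers (truncated subtraction, integer division). -/
inductive Arith where
  | plus
  | minus
  | times
  | quotient

def Arith.eval : Arith → ℕ → ℕ → ℕ
  | .plus, m, n => m + n
  | .minus, m, n => m - n
  | .times, m, n => m * n
  | .quotient, m, n => m / n

/-- Tests: equality of words, and order of numbers. -/
inductive Test (ρ : Type u) where
  | eq (x y : Operand ρ)
  | lt (x y : Operand ρ)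

/-- Programs. -/
inductive Prog (ρ : Type u) where
  | skip
  | move (r : ρ) (x : Operand ρ)
  | arith (r : ρ) (o : Arith) (x y : Operand ρ)
  | load (r : ρ) (addr : List (Operand ρ))
  | store (addr : List (Operand ρ)) (x : Operand ρ)
  | seq (c d : Prog ρ)
  | cond (b : Test ρ) (c d : Prog ρ)
  | loop (b : Test ρ) (c : Prog ρ)

/-- Register contents. -/
abbrev Regs (ρ : Type u) (A : Type v) := ρ → Word A

/-- Memory contents.  A cell that holds the number `0` is unoccupied. -/
abbrev Mem (A : Type v) := List (Word A) → Word A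

/-- The empty memory. -/
def Mem.empty {A : Type v} : Mem A := fun _ => .num 0

/-- The number of occupied memory cells. -/
noncomputable def Mem.space {A : Type v} (M : Mem A) : ℕ∞ := {a | M a ≠ .num 0}.encard

structure State (ρ : Type u) (A : Type v) where
  regs : Regs ρ A
  mem : Mem A

def Operand.eval {ρ : Type u} {A : Type v} (s : Regs ρ A) : Operand ρ → Word A
  | .reg r => s r
  | .const n => .num n

/-- The truth value of a test; `none` if atoms are compared by order. -/
noncomputable def Test.eval {ρ : Type u} {A : Type v} (s : Regs ρ A) : Test ρ → Option Bool
  | .eq x y => open Classical in some (decide (x.eval s = y.eval s))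
  | .lt x y =>
    match x.eval s, y.eval s with
    | .num m, .num n => some (decide (m < n))
    | _, _ => none

open Classical in
noncomputable def State.setReg {ρ : Type u} {A : Type v} (s : State ρ A) (r : ρ) (w : Word A) :
    State ρ A :=
  ⟨Function.update s.regs r w, s.mem⟩

open Classical in
noncomputable def State.setMem {ρ : Type u} {A : Type v} (s : State ρ A) (a : List (Word A))
    (w : Word A) : State ρ A :=
  ⟨s.regs, Function.update s.mem a w⟩

/-- The resources of the machine: the word length and the number of memory cells that may be
occupied at the same time. -/
structure Limits where
  bits : ℕ
  cells : ℕ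

/-- `Exec L c s k s'`: on a machine with limits `L`, the program `c` started in the state `s` halts
in the state `s'` after `k` steps.  Every instruction and every evaluation of a test is one step.
A program that computes a number too long for a word, occupies too many cells, or applies
arithmetic or order to an atom, is stuck. -/
inductive Exec {ρ : Type u} {A : Type v} (L : Limits) :
    Prog ρ → State ρ A → ℕ → State ρ A → Prop
  | skip (s : State ρ A) : Exec L .skip s 1 s
  | move (s : State ρ A) (r : ρ) (x : Operand ρ) (h : (x.eval s.regs).Fits L.bits) :
      Exec L (.move r x) s 1 (s.setReg r (x.eval s.regs))
  | arith (s : State ρ A) (r : ρ) (o : Arith) (x y : Operand ρ) (m n : ℕ)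
      (hx : x.eval s.regs = .num m) (hy : y.eval s.regs = .num n)
      (h : o.eval m n < 2 ^ L.bits) :
      Exec L (.arith r o x y) s 1 (s.setReg r (.num (o.eval m n)))
  | load (s : State ρ A) (r : ρ) (a : List (Operand ρ)) :
      Exec L (.load r a) s 1 (s.setReg r (s.mem (a.map (Operand.eval s.regs))))
  | store (s : State ρ A) (a : List (Operand ρ)) (x : Operand ρ)
      (h : (x.eval s.regs).Fits L.bits)
      (hc : (s.setMem (a.map (Operand.eval s.regs)) (x.eval s.regs)).mem.space ≤ L.cells) :
      Exec L (.store a x) s 1 (s.setMem (a.map (Operand.eval s.regs)) (x.eval s.regs))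
  | seq (c d : Prog ρ) (s s' s'' : State ρ A) (k l : ℕ) (hc : Exec L c s k s')
      (hd : Exec L d s' l s'') : Exec L (.seq c d) s (k + l) s''
  | cond_true (b : Test ρ) (c d : Prog ρ) (s s' : State ρ A) (k : ℕ)
      (hb : b.eval s.regs = some true) (hc : Exec L c s k s') :
      Exec L (.cond b c d) s (k + 1) s'
  | cond_false (b : Test ρ) (c d : Prog ρ) (s s' : State ρ A) (k : ℕ)
      (hb : b.eval s.regs = some false) (hd : Exec L d s k s') :
      Exec L (.cond b c d) s (k + 1) s'
  | loop_true (b : Test ρ) (c : Prog ρ) (s s' s'' : State ρ A) (k l : ℕ)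
      (hb : b.eval s.regs = some true) (hc : Exec L c s k s')
      (hl : Exec L (.loop b c) s' l s'') : Exec L (.loop b c) s (k + l + 1) s''
  | loop_false (b : Test ρ) (c : Prog ρ) (s : State ρ A)
      (hb : b.eval s.regs = some false) : Exec L (.loop b c) s 1 s

/-! ## Join queries -/

/-- A natural join: a hypergraph whose vertices are the attributes and whose hyperedges are the
relations.  Every attribute occurs in some relation. -/
structure JoinQuery (V : Type u) where
  rels : Finset (Finset V)
  covers : ∀ x : V, ∃ e ∈ rels, x ∈ e

variable {V : Type u}

/-- The join is acyclic: there is a tree on its relations (a join tree) in which, for every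
attribute, the relations containing it are connected. -/
def JoinQuery.Acyclic (Q : JoinQuery V) : Prop :=
  ∃ T : SimpleGraph {e // e ∈ Q.rels}, T.IsTree ∧
    ∀ x : V, (T.induce {e | x ∈ e.1}).Preconnected

/-- Tuples over the set `e` of attributes, where `dom x` is the domain of the attribute `x`. -/
abbrev Tuple (dom : V → Type v) (e : Finset V) := ∀ x : {x // x ∈ e}, dom x

/-- A tuple together with the relation to which it belongs. -/
abbrev JoinQuery.Fact (Q : JoinQuery V) (dom : V → Type v) :=
  Σ e : {e // e ∈ Q.rels}, Tuple dom e.1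

/-- A database instance; the relation instance `R_e` is the set of all `t` with `⟨e, t⟩ ∈ R`. -/
abbrev JoinQuery.Database (Q : JoinQuery V) (dom : V → Type v) := Set (Q.Fact dom)

/-- The projection of `q` to the set `e` of attributes. -/
def project {dom : V → Type v} (e : Finset V) (q : ∀ x, dom x) : Tuple dom e := fun x => q x

/-- The join results `Q(R)`. -/
def JoinQuery.results (Q : JoinQuery V) {dom : V → Type v} (R : Q.Database dom) :
    Set (∀ x, dom x) :=
  {q | ∀ e : {e // e ∈ Q.rels}, ∃ t : Tuple dom e.1, (⟨e, t⟩ : Q.Fact dom) ∈ R ∧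
    project e.1 q = t}

/-- The delta query `ΔQ(R, t) = Q(R ∪ {t}) \ Q(R)`. -/
def JoinQuery.delta (Q : JoinQuery V) {dom : V → Type v} (R : Q.Database dom) (t : Q.Fact dom) :
    Set (∀ x, dom x) :=
  Q.results (insert t R) \ Q.results R

/-- The database formed by the tuples of a stream. -/
def JoinQuery.ofStream (Q : JoinQuery V) {dom : V → Type v} (D : List (Q.Fact dom)) :
    Q.Database dom :=
  {t | t ∈ D}

/-- An array is `φ`-dense if among its first `i` entries at least `φ * i` are real, for all `i`.
Dummy entries are `none`. -/
def Dense {X : Type*} (φ : ℝ) (J : List (Option X)) : Prop :=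
  ∀ i ≤ J.length, φ * i ≤ ((J.take i).countP Option.isSome : ℕ)

/-! ## Indexes -/

/-- The registers: one for every attribute, and registers for numbers.  Number register `0` is used
for numerical input and output. -/
abbrev Reg (V : Type u) := V ⊕ ℕ

/-- The atoms are the values of the attributes. -/
abbrev Value (dom : V → Type v) := Σ x, dom x

/-- The programs of an index for the join `Q`: insertion of a tuple into the relation `e`; size and
access for the full query; size and access for the delta query of a tuple of the relation `e`. -/
structure Index (Q : JoinQuery V) where
  ins : {e // e ∈ Q.rels} → Prog (Reg V)
  size : Prog (Reg V)
  access : Prog (Reg V)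
  deltaSize : {e // e ∈ Q.rels} → Prog (Reg V)
  deltaAccess : {e // e ∈ Q.rels} → Prog (Reg V)

/-- All registers hold `0`. -/
def noInput (dom : V → Type v) : Regs (Reg V) (Value dom) := fun _ => .num 0

open Classical in
/-- The values of the tuple `t` are in the registers of its attributes, all others hold `0`. -/
noncomputable def tupleInput {dom : V → Type v} {e : Finset V} (t : Tuple dom e) :
    Regs (Reg V) (Value dom)
  | .inl x => if h : x ∈ e then .atom ⟨x, t ⟨x, h⟩⟩ else .num 0
  | .inr _ => .num 0

open Classical in
/-- The position `j` is in addition given in number register `0`. -/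
noncomputable def withPosition {dom : V → Type v} (s : Regs (Reg V) (Value dom)) (j : ℕ) :
    Regs (Reg V) (Value dom) :=
  Function.update s (.inr 0) (.num j)

/-- The registers output an array entry: number register `0` is `0` for a dummy entry; for a real
entry it is `1`, and the attribute registers contain the values of the entry. -/
def Outputs {dom : V → Type v} (s : Regs (Reg V) (Value dom)) : Option (∀ x, dom x) → Prop
  | none => s (.inr 0) = .num 0
  | some q => s (.inr 0) = .num 1 ∧ ∀ x, s (.inl x) = .atom ⟨x, q x⟩

/-- `I.Builds L D M T`: on a machine with limits `L`, started with empty memory, the successive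
insertion of the tuples of the stream `D` takes `T` steps altogether and leaves the memory `M`.
Each insertion starts with fresh registers; only the memory persists. -/
inductive Index.Builds {Q : JoinQuery V} (I : Index Q) {dom : V → Type v} (L : Limits) :
    List (Q.Fact dom) → Mem (Value dom) → ℕ → Prop
  | nil : I.Builds L [] Mem.empty 0
  | snoc (D : List (Q.Fact dom)) (t : Q.Fact dom) (M : Mem (Value dom)) (T k : ℕ)
      (s : State (Reg V) (Value dom)) (hD : I.Builds L D M T)
      (ht : Exec L (I.ins t.1) ⟨tupleInput t.2, M⟩ k s) :
      I.Builds L (D ++ [t]) s.mem (T + k)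

/-- On input `s`, the programs `size` and `access` represent, from the index stored in the memory
`M` and without changing it, a `φ`-dense array `J` whose real entries are the elements of `S`, each
exactly once: `size` returns `|J|` within `a` steps, and `access` returns any given entry of `J`
within `b` steps. -/
def Represents {dom : V → Type v} (L : Limits) (M : Mem (Value dom)) (size access : Prog (Reg V))
    (s : Regs (Reg V) (Value dom)) (S : Set (∀ x, dom x)) (φ : ℝ) (a b : ℕ) : Prop :=
  ∃ J : List (Option (∀ x, dom x)),
    (∀ q, q ∈ J.reduceOption ↔ q ∈ S) ∧ J.reduceOption.Nodup ∧ Dense φ J ∧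
    (∃ k ≤ a, ∃ s', Exec L size ⟨s, M⟩ k ⟨s', M⟩ ∧ s' (.inr 0) = .num J.length) ∧
    ∀ (j : ℕ) (hj : j < J.length),
      ∃ k ≤ b, ∃ s', Exec L access ⟨withPosition s j, M⟩ k ⟨s', M⟩ ∧ Outputs s' J[j]

end JoinIndex

/-! For every relation take a join tree rooted at it, and hang all of these below one additional
root without attributes; the result is a single tree `S` whose edges have distinct tags. For an edge
with parent `p` and child `c`, the tuples of `c` are grouped by their key, that is, by their values
on the attributes common to `p` and `c`. The weight of a tuple at the root of a subtree is the
product, over the edges to its children, of the capacities of the matching groups, and the capacity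
of a group is its total weight rounded up to a power of two. So weights are `0` or powers of two,
they are polynomial in the number of tuples (`weight_bound`), and each group splits into `O(log N)`
buckets of equal weight.

The weight is the length of an array (`length_arr`): the lexicographic product, over the children,
of the concatenated arrays of the members of the matching group, padded with dummies to the
capacity. Padding less than doubles a length and a product loses one more factor of two, so the
density is bounded below by a constant that depends only on the tree (`dense_arr`). For access,
quotient and remainder by the capacity give the positions in the two factors; a scan over the
buckets, followed by a division inside one bucket, finds the member of the group
(`runs_accessProg`). This takes `O(log N)` steps per node. Because the nodes containing an attribute
are connected, tuples that match along the edges agree globally (`Accessed.join`,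
`Sel.exists_accessed`). The delta query of `t` is the array of the tree rooted at the relation of
`t`, with `t`, which need not be stored, at the root; the full query is the array of an
attribute-free root above any one of the rooted trees.

Insertions only raise weights, so capacities only grow. A changed weight moves a tuple to another
bucket, and parents are revisited only if the capacity of the group has changed. The potential adds
up the bit lengths of the capacities of the matching groups over all edges and over the tuples at
both ends. If a capacity doubles `e` times, the potential rises by at least `e` for the child tuple
and by `e` for each matching parent, which pays for the doubling loop and for the recursive updates
(`Step.potential_le`, `runs_proc_cons`). The potential is `O(N log N)` (`potential_le`), hence so is
the total time. For the space, every occupied cell except the counter is charged to a tuple, and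
each tuple is charged a constant number of cells (`Inv.mem_cells`). -/

namespace JoinIndex

universe u v

/-! ## Symbolic execution of programs -/

section Wp

variable {V : Type u} {A : Type v}

/-- The value of an operand, where attribute and number registers are given separately. -/
def ev (f : V → Word A) (g : ℕ → Word A) : Operand (Reg V) → Word A
  | .reg (.inl x) => f x
  | .reg (.inr n) => g n
  | .const n => .num n

theorem eval_eq_ev (f : V → Word A) (g : ℕ → Word A) :
    Operand.eval (Sum.elim f g) = ev f g := by
  funext x
  rcases x with (x | n) | n <;> rfl

open Classical in
/-- Weakest preconditions of loop-free programs, without the limit on the memory cells. -/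
def wp (b : ℕ) : Prog (Reg V) → ((V → Word A) → (ℕ → Word A) → Mem A → Prop) →
    (V → Word A) → (ℕ → Word A) → Mem A → Prop
  | .skip, Q, f, g, M => Q f g M
  | .move (.inl x) o, Q, f, g, M =>
      (ev f g o).Fits b ∧ Q (Function.update f x (ev f g o)) g M
  | .move (.inr n) o, Q, f, g, M =>
      (ev f g o).Fits b ∧ Q f (Function.update g n (ev f g o)) M
  | .arith (.inl y) o x z, Q, f, g, M => ∃ m n, ev f g x = .num m ∧ ev f g z = .num n ∧
      o.eval m n < 2 ^ b ∧ Q (Function.update f y (.num (o.eval m n))) g M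
  | .arith (.inr y) o x z, Q, f, g, M => ∃ m n, ev f g x = .num m ∧ ev f g z = .num n ∧
      o.eval m n < 2 ^ b ∧ Q f (Function.update g y (.num (o.eval m n))) M
  | .load (.inl x) a, Q, f, g, M => Q (Function.update f x (M (a.map (ev f g)))) g M
  | .load (.inr n) a, Q, f, g, M => Q f (Function.update g n (M (a.map (ev f g)))) M
  | .store a x, Q, f, g, M =>
      (ev f g x).Fits b ∧ Q f g (Function.update M (a.map (ev f g)) (ev f g x))
  | .seq c d, Q, f, g, M => wp b c (wp b d Q) f g M
  | .cond (.eq x y) c d, Q, f, g, M =>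
      (ev f g x = ev f g y → wp b c Q f g M) ∧ (ev f g x ≠ ev f g y → wp b d Q f g M)
  | .cond (.lt x y) c d, Q, f, g, M => ∃ m n, ev f g x = .num m ∧ ev f g y = .num n ∧
      (m < n → wp b c Q f g M) ∧ (¬ m < n → wp b d Q f g M)
  | .loop _ _, _, _, _, _ => False

/-- An upper bound for the number of steps of a loop-free program. -/
def Prog.cost {ρ : Type u} : Prog ρ → ℕ
  | .skip | .move _ _ | .arith _ _ _ _ | .load _ _ | .store _ _ => 1
  | .seq c d => c.cost + d.cost
  | .cond _ c d => c.cost + d.cost + 1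
  | .loop _ _ => 0

/-- `Runs L c f g M Q`: started in the given state, `c` halts after some number of steps in some
final state, and these satisfy `Q`. -/
def Runs (L : Limits) (c : Prog (Reg V)) (f : V → Word A) (g : ℕ → Word A) (M : Mem A)
    (Q : ℕ → (V → Word A) → (ℕ → Word A) → Mem A → Prop) : Prop :=
  ∃ k f' g' M', Exec L c ⟨Sum.elim f g, M⟩ k ⟨Sum.elim f' g', M'⟩ ∧ Q k f' g' M'

theorem setReg_inl (f : V → Word A) (g : ℕ → Word A) (M : Mem A) (x : V) (w : Word A) :
    State.setReg ⟨Sum.elim f g, M⟩ (.inl x) w =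
      ⟨Sum.elim (open Classical in Function.update f x w) g, M⟩ := by
  classical
  simp only [State.setReg, State.mk.injEq, and_true]
  funext r
  rcases r with y | n
  · by_cases h : y = x <;> simp [h]
  · simp

theorem setReg_inr (f : V → Word A) (g : ℕ → Word A) (M : Mem A) (n : ℕ) (w : Word A) :
    State.setReg ⟨Sum.elim f g, M⟩ (.inr n) w = ⟨Sum.elim f (Function.update g n w), M⟩ := by
  classical
  simp only [State.setReg, State.mk.injEq, and_true]
  funext r
  rcases r with y | m
  · simp
  · by_cases h : m = n <;> simp [h]

theorem space_update_le (M : Mem A) (a : List (Word A)) (w : Word A) :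
    Mem.space (open Classical in Function.update M a w) ≤ M.space + 1 := by
  classical
  unfold Mem.space
  refine le_trans (Set.encard_le_encard (t := insert a {a | M a ≠ .num 0}) ?_)
    (Set.encard_insert_le _ _)
  intro b hb
  by_cases h : b = a
  · simp [h]
  · right
    simpa [Function.update_apply, h] using hb

theorem Runs.mono {L : Limits} {c : Prog (Reg V)} {f : V → Word A} {g : ℕ → Word A} {M : Mem A}
    {Q Q' : ℕ → (V → Word A) → (ℕ → Word A) → Mem A → Prop} (h : Runs L c f g M Q)
    (hQ : ∀ k f' g' M', Q k f' g' M' → Q' k f' g' M') : Runs L c f g M Q' := by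
  obtain ⟨k, f', g', M', he, hq⟩ := h
  exact ⟨k, f', g', M', he, hQ _ _ _ _ hq⟩

theorem Runs.seq {L : Limits} {c d : Prog (Reg V)} {f : V → Word A} {g : ℕ → Word A} {M : Mem A}
    {Q : ℕ → (V → Word A) → (ℕ → Word A) → Mem A → Prop}
    (h : Runs L c f g M fun k f' g' M' => Runs L d f' g' M' fun l => Q (k + l)) :
    Runs L (.seq c d) f g M Q := by
  obtain ⟨k, f', g', M', he, l, f'', g'', M'', he', hq⟩ := h
  exact ⟨_, _, _, _, .seq _ _ _ _ _ _ _ he he', hq⟩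

theorem Runs.cond_lt {L : Limits} {x y : Operand (Reg V)} {c d : Prog (Reg V)} {f : V → Word A}
    {g : ℕ → Word A} {M : Mem A} {Q : ℕ → (V → Word A) → (ℕ → Word A) → Mem A → Prop} (m n : ℕ)
    (hx : ev f g x = .num m) (hy : ev f g y = .num n)
    (h1 : m < n → Runs L c f g M fun k => Q (k + 1))
    (h2 : ¬ m < n → Runs L d f g M fun k => Q (k + 1)) :
    Runs L (.cond (.lt x y) c d) f g M Q := by
  have hb : (Test.lt x y).eval (Sum.elim f g) = some (decide (m < n)) := by
    simp [Test.eval, eval_eq_ev, hx, hy]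
  by_cases h : m < n
  · obtain ⟨k, f', g', M', he, hq⟩ := h1 h
    exact ⟨_, _, _, _, .cond_true _ _ _ _ _ _ (by simp [hb, h]) he, hq⟩
  · obtain ⟨k, f', g', M', he, hq⟩ := h2 h
    exact ⟨_, _, _, _, .cond_false _ _ _ _ _ _ (by simp [hb, h]) he, hq⟩

theorem Runs.cond_eq {L : Limits} {x y : Operand (Reg V)} {c d : Prog (Reg V)} {f : V → Word A}
    {g : ℕ → Word A} {M : Mem A} {Q : ℕ → (V → Word A) → (ℕ → Word A) → Mem A → Prop}
    (h1 : ev f g x = ev f g y → Runs L c f g M fun k => Q (k + 1))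
    (h2 : ev f g x ≠ ev f g y → Runs L d f g M fun k => Q (k + 1)) :
    Runs L (.cond (.eq x y) c d) f g M Q := by
  by_cases h : ev f g x = ev f g y
  · obtain ⟨k, f', g', M', he, hq⟩ := h1 h
    exact ⟨_, _, _, _, .cond_true _ _ _ _ _ _ (by simp [Test.eval, eval_eq_ev, h]) he, hq⟩
  · obtain ⟨k, f', g', M', he, hq⟩ := h2 h
    exact ⟨_, _, _, _, .cond_false _ _ _ _ _ _ (by simp [Test.eval, eval_eq_ev, h]) he, hq⟩

theorem Runs.loop_true {L : Limits} {x y : Operand (Reg V)} {c : Prog (Reg V)} {f : V → Word A}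
    {g : ℕ → Word A} {M : Mem A} {Q : ℕ → (V → Word A) → (ℕ → Word A) → Mem A → Prop} {m n : ℕ}
    (hx : ev f g x = .num m) (hy : ev f g y = .num n) (hmn : m < n)
    (h : Runs L c f g M fun k f' g' M' =>
      Runs L (.loop (.lt x y) c) f' g' M' fun l => Q (k + l + 1)) :
    Runs L (.loop (.lt x y) c) f g M Q := by
  obtain ⟨k, f', g', M', he, l, f'', g'', M'', he', hq⟩ := h
  exact ⟨_, _, _, _, .loop_true _ _ _ _ _ _ _ (by simp [Test.eval, eval_eq_ev, hx, hy, hmn])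
    he he', hq⟩

theorem Runs.loop_false {L : Limits} {x y : Operand (Reg V)} {c : Prog (Reg V)} {f : V → Word A}
    {g : ℕ → Word A} {M : Mem A} {Q : ℕ → (V → Word A) → (ℕ → Word A) → Mem A → Prop} {m n : ℕ}
    (hx : ev f g x = .num m) (hy : ev f g y = .num n) (hmn : ¬ m < n) (h : Q 1 f g M) :
    Runs L (.loop (.lt x y) c) f g M Q :=
  ⟨_, _, _, _, .loop_false _ _ _ (by simp [Test.eval, eval_eq_ev, hx, hy, hmn]), h⟩

/-- A store occupies at most one new cell, so `c.cost` bounds the growth of the space as well as the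
time. This discharges the cell limit, which `wp` ignores, once for the whole program. -/
theorem wp.runs {L : Limits} {c : Prog (Reg V)}
    {Q : (V → Word A) → (ℕ → Word A) → Mem A → Prop} {f : V → Word A} {g : ℕ → Word A}
    {M : Mem A} (h : wp L.bits c Q f g M) {S : ℕ} (hM : M.space ≤ S) (hS : S + c.cost ≤ L.cells) :
    Runs L c f g M fun k f' g' M' =>
      k ≤ c.cost ∧ M'.space ≤ (S + c.cost : ℕ) ∧ Q f' g' M' := by
  have key : ∀ {a b c : ℕ}, a ≤ c → (a : ℕ∞) ≤ (c + b : ℕ) := fun h => by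
    exact_mod_cast Nat.le_add_right_of_le h
  have mono : ∀ {M : Mem A} {a b : ℕ}, M.space ≤ a → M.space ≤ (a + b : ℕ) := fun h => by
    refine h.trans ?_
    exact_mod_cast Nat.le_add_right _ _
  induction c generalizing Q f g M S with
  | skip => exact ⟨_, _, _, _, .skip _, le_rfl, mono hM, h⟩
  | move r o =>
    rcases r with r | r
    · refine ⟨1, _, _, _, ?_, le_rfl, mono hM, h.2⟩
      rw [← setReg_inl, ← eval_eq_ev]
      exact .move _ _ _ (by simpa [eval_eq_ev] using h.1)
    · refine ⟨1, _, _, _, ?_, le_rfl, mono hM, h.2⟩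
      rw [← setReg_inr, ← eval_eq_ev]
      exact .move _ _ _ (by simpa [eval_eq_ev] using h.1)
  | arith r o x y =>
    rcases r with r | r <;> obtain ⟨m, n, h1, h2, h3, h4⟩ := h
    · refine ⟨1, _, _, _, ?_, le_rfl, mono hM, h4⟩
      rw [← setReg_inl]
      exact .arith _ _ _ _ _ _ _ (by simpa [eval_eq_ev] using h1)
        (by simpa [eval_eq_ev] using h2) h3
    · refine ⟨1, _, _, _, ?_, le_rfl, mono hM, h4⟩
      rw [← setReg_inr]
      exact .arith _ _ _ _ _ _ _ (by simpa [eval_eq_ev] using h1)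
        (by simpa [eval_eq_ev] using h2) h3
  | load r a =>
    rcases r with r | r
    · refine ⟨1, _, _, _, ?_, le_rfl, mono hM, h⟩
      rw [← setReg_inl, ← eval_eq_ev]
      exact .load _ _ _
    · refine ⟨1, _, _, _, ?_, le_rfl, mono hM, h⟩
      rw [← setReg_inr, ← eval_eq_ev]
      exact .load _ _ _
  | store a x =>
    have hsp := (space_update_le M (a.map (ev f g)) (ev f g x)).trans (add_le_add_left hM 1)
    refine ⟨1, f, g, _, ?_, le_rfl, hsp.trans (by norm_cast), h.2⟩
    have := Exec.store (L := L) ⟨Sum.elim f g, M⟩ a x (by simpa [eval_eq_ev] using h.1) (by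
      simp only [State.setMem, eval_eq_ev]
      exact hsp.trans (by exact_mod_cast hS))
    simpa only [State.setMem, eval_eq_ev] using this
  | seq c d ihc ihd =>
    simp only [Prog.cost] at hS ⊢
    refine Runs.seq ((ihc h hM (by omega)).mono ?_)
    rintro k f' g' M' ⟨hk, hM', hQ⟩
    refine (ihd hQ hM' (by omega)).mono ?_
    rintro l f'' g'' M'' ⟨hl, hM'', hQ⟩
    exact ⟨by omega, by rwa [← Nat.add_assoc], hQ⟩
  | cond t c d ihc ihd =>
    simp only [Prog.cost] at hS ⊢
    have fin1 : ∀ {k f' g' M'}, (k ≤ c.cost ∧ Mem.space M' ≤ (S + c.cost : ℕ) ∧ Q f' g' M') →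
        (k + 1 ≤ c.cost + d.cost + 1 ∧ Mem.space M' ≤ (S + (c.cost + d.cost + 1) : ℕ) ∧
          Q f' g' M') := by
      rintro k f' g' M' ⟨hk, hM', hQ⟩
      refine ⟨by omega, ?_, hQ⟩
      rw [show S + (c.cost + d.cost + 1) = (S + c.cost) + (d.cost + 1) by ring]
      exact mono hM'
    have fin2 : ∀ {k f' g' M'}, (k ≤ d.cost ∧ Mem.space M' ≤ (S + d.cost : ℕ) ∧ Q f' g' M') →
        (k + 1 ≤ c.cost + d.cost + 1 ∧ Mem.space M' ≤ (S + (c.cost + d.cost + 1) : ℕ) ∧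
          Q f' g' M') := by
      rintro k f' g' M' ⟨hk, hM', hQ⟩
      refine ⟨by omega, ?_, hQ⟩
      rw [show S + (c.cost + d.cost + 1) = (S + d.cost) + (c.cost + 1) by ring]
      exact mono hM'
    rcases t with ⟨x, y⟩ | ⟨x, y⟩
    · exact Runs.cond_eq
        (fun e => (ihc (h.1 e) hM (by omega)).mono fun _ _ _ _ => fin1)
        (fun e => (ihd (h.2 e) hM (by omega)).mono fun _ _ _ _ => fin2)
    · obtain ⟨m, n, h1, h2, h3, h4⟩ := h
      exact Runs.cond_lt m n h1 h2
        (fun e => (ihc (h3 e) hM (by omega)).mono fun _ _ _ _ => fin1)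
        (fun e => (ihd (h4 e) hM (by omega)).mono fun _ _ _ _ => fin2)
  | loop t c ih => exact h.elim

end Wp

/-! ## Dense arrays -/

section DenseArrays

variable {X : Type*} {Y : Type*} {Z : Type*}

/-- The number of real entries of an array. -/
abbrev reals (J : List (Option X)) : ℕ := J.countP Option.isSome

theorem Dense.mono {φ ψ : ℝ} {J : List (Option X)} (h : Dense φ J) (hψ : ψ ≤ φ) : Dense ψ J :=
  fun i hi => (mul_le_mul_of_nonneg_right hψ (Nat.cast_nonneg i)).trans (h i hi)

theorem Dense.nil (φ : ℝ) : Dense φ ([] : List (Option X)) := by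
  intro i hi
  obtain rfl : i = 0 := by simpa using hi
  simp

theorem Dense.append {φ : ℝ} {a b : List (Option X)} (ha : Dense φ a) (hb : Dense φ b) :
    Dense φ (a ++ b) := by
  intro i hi
  rw [List.take_append, List.countP_append]
  have h1 := ha (min i a.length) (min_le_right _ _)
  have h2 := hb (i - a.length) (by simp at hi; omega)
  have e : List.take (min i a.length) a = List.take i a := by
    rcases le_total i a.length with h | h
    · rw [min_eq_left h]
    · rw [min_eq_right h, List.take_of_length_le h, List.take_length]
  rw [e] at h1
  have h3 : (i : ℝ) = (min i a.length : ℕ) + (i - a.length : ℕ) := by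
    rw [← Nat.cast_add]
    congr 1
    omega
  rw [h3, mul_add]
  push_cast at *
  linarith

theorem Dense.flatMap {φ : ℝ} {l : List Y} {F : Y → List (Option X)}
    (h : ∀ y ∈ l, Dense φ (F y)) : Dense φ (l.flatMap F) := by
  induction l with
  | nil => exact Dense.nil φ
  | cons y l ih =>
    rw [List.flatMap_cons]
    exact (h y (by simp)).append (ih fun z hz => h z (by simp [hz]))

theorem Dense.map {φ : ℝ} {J : List (Option X)} (h : Dense φ J) {g : Option X → Option Y}
    (hg : ∀ o ∈ J, (g o).isSome = o.isSome) : Dense φ (J.map g) := by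
  intro i hi
  refine (h i (by simpa using hi)).trans_eq ?_
  rw [← List.map_take, List.countP_map]
  congr 1
  refine List.countP_congr fun o ho => ?_
  simp [hg o (List.mem_of_mem_take ho)]

/-- Extension of an array by dummies to length `n`. -/
def pad (n : ℕ) (J : List (Option X)) : List (Option X) := J ++ List.replicate (n - J.length) none

theorem length_pad {n : ℕ} {J : List (Option X)} (h : J.length ≤ n) : (pad n J).length = n := by
  simp [pad]
  omega

/-- Only prefixes that contain all of `J` lose density, and these are at most twice as long as `J`.
-/
theorem Dense.pad {φ : ℝ} (hφ : 0 ≤ φ) {n : ℕ} {J : List (Option X)} (h : Dense φ J)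
    (hn : n ≤ 2 * J.length) : Dense (φ / 2) (pad n J) := by
  intro i hi
  rw [JoinIndex.pad, List.take_append, List.countP_append]
  rcases le_total i J.length with hl | hl
  · have := h i hl
    have h0 : (0 : ℝ) ≤ φ * i := by positivity
    push_cast
    have h1 : (0 : ℝ) ≤ ((List.take (i - J.length)
      (List.replicate (n - J.length) (none : Option X))).countP Option.isSome : ℕ) :=
      Nat.cast_nonneg _
    linarith
  · have h1 := h J.length le_rfl
    rw [List.take_length] at h1
    rw [List.take_of_length_le hl]
    have h2 : (i : ℝ) ≤ 2 * J.length := by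
      simp [JoinIndex.pad] at hi
      exact_mod_cast (by omega : i ≤ 2 * J.length)
    push_cast
    have h3 : (0 : ℝ) ≤ ((List.take (i - J.length)
      (List.replicate (n - J.length) (none : Option X))).countP Option.isSome : ℕ) :=
      Nat.cast_nonneg _
    nlinarith

theorem reduceOption_pad (n : ℕ) (J : List (Option X)) :
    (pad n J).reduceOption = J.reduceOption := by
  rw [pad, List.reduceOption_append, List.reduceOption_replicate_none, List.append_nil]

/-- The lexicographic product of two arrays. -/
def prod (m : X → Y → Z) (a : List (Option X)) (b : List (Option Y)) : List (Option Z) :=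
  a.flatMap fun o => b.map fun o' => o.bind fun x => o'.map (m x)

theorem length_prod (m : X → Y → Z) (a : List (Option X)) (b : List (Option Y)) :
    (prod m a b).length = a.length * b.length := by
  simp [prod, List.length_flatMap]

/-- The product consists of blocks of length `b.length`, one for each entry of `a`. Among the blocks
that lie completely in the prefix, those of real entries of `a` are copies of `b`. -/
theorem reals_take_prod (m : X → Y → Z) (a : List (Option X)) (b : List (Option Y)) (i : ℕ)
    (hb : 0 < b.length) :
    reals (a.take (i / b.length)) * reals b ≤ reals ((prod m a b).take i) := by
  induction a generalizing i with
  | nil => simp [reals]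
  | cons x a ih =>
    rcases lt_or_ge i b.length with hi | hi
    · simp [Nat.div_eq_of_lt hi, reals]
    · have := ih (i - b.length)
      rw [Nat.div_eq_sub_div hb hi, List.take_succ_cons]
      simp only [prod, List.flatMap_cons]
      rw [List.take_append,
        List.take_of_length_le (l := List.map (fun o' => x.bind fun x => o'.map (m x)) b)
          (by simpa using hi)]
      simp only [reals, JoinIndex.prod, List.length_map, List.countP_append, List.countP_cons] at *
      rw [add_mul, Nat.add_comm]
      refine Nat.add_le_add ?_ this
      rcases x with - | x
      · simp
      · simp only [Option.isSome_some, if_true, one_mul, List.countP_map]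
        refine le_of_eq (List.countP_congr fun o _ => ?_)
        simp

/-- A prefix of at least one block is at most twice as long as its part made of complete blocks;
this is the factor `1 / 2`. A shorter prefix lies in the first block, which is a copy of `b`. -/
theorem Dense.prod {φ ψ : ℝ} (hφ : 0 < φ) (hφ1 : φ ≤ 1) (hψ : 0 < ψ) {a : List (Option X)}
    {b : List (Option Y)} (ha : Dense φ a) (hb : Dense ψ b) (m : X → Y → Z) :
    Dense (φ * ψ / 2) (prod m a b) := by
  intro i hi
  rw [length_prod] at hi
  rcases Nat.eq_zero_or_pos b.length with h0 | h0
  · obtain rfl : i = 0 := by simpa [h0] using hi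
    simp
  rcases lt_or_ge i b.length with hl | hl
  · rcases a with - | ⟨x, a⟩
    · obtain rfl : i = 0 := by simpa using hi
      simp
    -- Positive density of the prefix of length `1` forces the first entry of `a` to be real.
    · have hx := ha 1 (by simp)
      rcases x with - | x
      · simp at hx
        linarith
      · have := hb i hl.le
        simp only [JoinIndex.prod, List.flatMap_cons]
        rw [List.take_append_of_le_length (by simpa using hl.le), ← List.map_take,
          List.countP_map]
        have e : (List.take i b).countP (Option.isSome ∘ fun o' =>
            (some x).bind fun x => o'.map (m x)) = (List.take i b).countP Option.isSome :=
          List.countP_congr fun o _ => by simp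
        rw [e]
        refine le_trans ?_ this
        refine mul_le_mul_of_nonneg_right ?_ (Nat.cast_nonneg _)
        nlinarith
  · have h1 := reals_take_prod m a b i h0
    have h2 := ha (i / b.length) (by
      rw [Nat.div_le_iff_le_mul_add_pred h0, Nat.mul_comm]; omega)
    have h3 := hb b.length le_rfl
    rw [List.take_length] at h3
    have h4 : (i : ℝ) ≤ 2 * ((i / b.length : ℕ) * b.length) := by
      have e := Nat.div_add_mod i b.length
      have l := Nat.mod_lt i h0
      have p : 1 ≤ i / b.length := (Nat.one_le_div_iff h0).2 hl
      have : i ≤ 2 * ((i / b.length) * b.length) := by nlinarith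
      exact_mod_cast this
    have h5 : ((reals (a.take (i / b.length)) * reals b : ℕ) : ℝ) ≤
        (reals ((JoinIndex.prod m a b).take i) : ℕ) := by exact_mod_cast h1
    refine le_trans ?_ h5
    push_cast
    calc φ * ψ / 2 * i ≤ φ * ψ / 2 * (2 * ((i / b.length : ℕ) * b.length)) :=
          mul_le_mul_of_nonneg_left h4 (by positivity)
      _ = (φ * (i / b.length : ℕ)) * (ψ * b.length) := by ring
      _ ≤ _ := mul_le_mul h2 h3 (by positivity) (Nat.cast_nonneg _)

theorem mem_reduceOption_prod {m : X → Y → Z} {a : List (Option X)} {b : List (Option Y)} {z : Z} :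
    z ∈ (prod m a b).reduceOption ↔ ∃ x ∈ a.reduceOption, ∃ y ∈ b.reduceOption, m x y = z := by
  simp only [List.reduceOption_mem_iff, prod, List.mem_flatMap, List.mem_map]
  constructor
  · rintro ⟨o, ho, o', ho', h⟩
    rcases o with - | x <;> rcases o' with - | y <;> simp at h
    exact ⟨x, ho, y, ho', h⟩
  · rintro ⟨x, hx, y, hy, rfl⟩
    exact ⟨some x, hx, some y, hy, by simp⟩

/-- Injectivity of `m` is required only for first arguments that occur in `a`: concatenation of
lists is injective only when the lengths of the first parts are known to be equal. -/
theorem nodup_reduceOption_prod {m : X → Y → Z} {a : List (Option X)} {b : List (Option Y)}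
    (hm : ∀ x ∈ a.reduceOption, ∀ x' ∈ a.reduceOption, ∀ y y', m x y = m x' y' → x = x' ∧ y = y')
    (ha : a.reduceOption.Nodup) (hb : b.reduceOption.Nodup) : (prod m a b).reduceOption.Nodup := by
  induction a with
  | nil => simp [prod]
  | cons o a ih =>
    rcases o with - | x
    · have : (prod m (none :: a) b).reduceOption = (prod m a b).reduceOption := by
        simp only [prod, List.flatMap_cons, List.reduceOption_append]
        simp
      rw [this]
      exact ih (by simpa using hm) (by simpa using ha)
    · have e : (prod m (some x :: a) b).reduceOption =
          b.reduceOption.map (m x) ++ (prod m a b).reduceOption := by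
        simp only [prod, List.flatMap_cons, List.reduceOption_append]
        congr 1
        simp [List.reduceOption_map]
      rw [List.reduceOption_cons_of_some] at ha hm
      rw [List.nodup_cons] at ha
      rw [e, List.nodup_append]
      refine ⟨hb.map_on fun y _ y' _ h => (hm x (by simp) x (by simp) y y' h).2,
        ih (fun y hy y' hy' => hm y (by simp [hy]) y' (by simp [hy'])) ha.2, ?_⟩
      rintro z hz _ hz' rfl
      obtain ⟨y, hy, rfl⟩ := List.mem_map.1 hz
      obtain ⟨x', hx', y', hy', h⟩ := mem_reduceOption_prod.1 hz'
      exact ha.1 ((hm x' (by simp [hx']) x (by simp) _ _ h).1 ▸ hx')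

theorem getElem?_flatMap_uniform {l : List Y} {F : Y → List X} {w : ℕ} (hw : 0 < w)
    (h : ∀ y ∈ l, (F y).length = w) (j : ℕ) :
    (l.flatMap F)[j]? = l[j / w]?.bind fun y => (F y)[j % w]? := by
  induction l generalizing j with
  | nil => simp
  | cons y l ih =>
    have hy := h y (by simp)
    rw [List.flatMap_cons]
    rcases lt_or_ge j w with hj | hj
    · rw [List.getElem?_append_left (by omega), Nat.div_eq_of_lt hj, Nat.mod_eq_of_lt hj]
      simp
    · rw [List.getElem?_append_right (by omega), hy, ih (fun z hz => h z (by simp [hz])),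
        Nat.div_eq_sub_div hw hj, List.getElem?_cons_succ, Nat.mod_eq_sub_mod hj]

theorem getElem?_prod {m : X → Y → Z} {a : List (Option X)} {b : List (Option Y)}
    (hb : 0 < b.length) (j : ℕ) :
    (prod m a b)[j]? = a[j / b.length]?.bind fun o => b[j % b.length]?.map fun o' =>
      o.bind fun x => o'.map (m x) := by
  rw [prod, getElem?_flatMap_uniform hb (by simp)]
  simp

end DenseArrays

/-! ## Buckets -/

section Buckets

variable {K : Type*}

/-- Arrays `bk w · k` of length `bl w k` that contain the indices `i` with weight `wt i = w ≠ 0` and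
key `ky i = k`; the position of `i` is `pos i`. -/
structure Buckets (ky : ℕ → K) (wt pos : ℕ → ℕ) (bl : ℕ → K → ℕ) (bk : ℕ → ℕ → K → ℕ) : Prop where
  mem : ∀ w j k, j < bl w k → wt (bk w j k) = w ∧ pos (bk w j k) = j ∧ ky (bk w j k) = k ∧ w ≠ 0
  pos_lt : ∀ i, wt i ≠ 0 → pos i < bl (wt i) (ky i) ∧ bk (wt i) (pos i) (ky i) = i
  out : ∀ w j k, bl w k ≤ j → bk w j k = 0

variable {ky : ℕ → K} {wt pos wt' pos' : ℕ → ℕ} {bl bl' : ℕ → K → ℕ} {bk bk' : ℕ → ℕ → K → ℕ}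

open Classical in
-- Deletion in constant time: the last entry moves into the gap. The vacated cell is set to `0`,
-- which preserves `out` and so keeps cells beyond the end unoccupied. If `i` is itself the last
-- entry, then `p = n` and the zero takes precedence.
theorem Buckets.remove (h : Buckets ky wt pos bl bk) {i w n p last : ℕ} {k : K} (hw : wt i = w)
    (hw0 : w ≠ 0) (hk : ky i = k) (hn : n = bl w k - 1) (hp : p = pos i) (hl : last = bk w n k)
    (hwt : ∀ j, wt' j = if j = i then 0 else wt j)
    (hpos : ∀ j, pos' j = if j = last then p else pos j)
    (hbl : ∀ v k', bl' v k' = if v = w ∧ k' = k then n else bl v k')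
    (hbk : ∀ v j k', bk' v j k' = if v = w ∧ j = n ∧ k' = k then 0 else
      if v = w ∧ j = p ∧ k' = k then last else bk v j k') : Buckets ky wt' pos' bl' bk' := by
  obtain ⟨h1, h2, h3⟩ := h
  have hi := h2 i (by rw [hw]; exact hw0)
  rw [hw, hk, ← hp] at hi
  have hlast := h1 w n k (by omega)
  rw [← hl] at hlast
  refine ⟨?_, ?_, ?_⟩
  · intro v j k' hj
    rw [hbl] at hj
    by_cases hv : v = w ∧ k' = k
    · obtain ⟨rfl, rfl⟩ := hv
      simp only [if_true, and_self] at hj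
      have hjn : j ≠ n := by omega
      by_cases hjp : j = p
      · subst hjp
        have e : bk' v j k' = last := by rw [hbk]; simp [hjn]
        rw [e, hwt, hpos]
        have : last ≠ i := by
          intro hh
          rw [hh] at hlast
          omega
        simp [this, hlast]
      · have e : bk' v j k' = bk v j k' := by rw [hbk]; simp [hjn, hjp]
        have hb := h1 v j k' (by omega)
        rw [e, hwt, hpos]
        have h4 : bk v j k' ≠ i := by
          intro hh
          rw [hh] at hb
          omega
        have h5 : bk v j k' ≠ last := by
          intro hh
          rw [hh] at hb
          omega
        simp [h4, h5, hb]
    · rw [if_neg hv] at hj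
      have e : bk' v j k' = bk v j k' := by
        rw [hbk, if_neg (by tauto), if_neg (by tauto)]
      have hb := h1 v j k' hj
      rw [e, hwt, hpos]
      have h4 : bk v j k' ≠ i := by
        intro hh
        rw [hh] at hb
        exact hv ⟨by omega, by rw [← hb.2.2.1, hk]⟩
      have h5 : bk v j k' ≠ last := by
        intro hh
        rw [hh] at hb
        exact hv ⟨by omega, by rw [← hb.2.2.1, hlast.2.2.1]⟩
      simp [h4, h5, hb]
  · intro j hj
    have hji : j ≠ i := by
      rintro rfl
      simp [hwt] at hj
    have ew : wt' j = wt j := by rw [hwt, if_neg hji]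
    rw [ew] at hj ⊢
    have hb := h2 j hj
    rw [hpos, hbl, hbk]
    by_cases hjl : j = last
    · subst hjl
      have hpn : p ≠ n := by
        rintro rfl
        exact hji (by rw [hl, hi.2])
      simp only [if_true, hlast, true_and, hpn, if_false, and_true]
      exact lt_of_le_of_ne (by omega) hpn
    · rw [if_neg hjl]
      by_cases hv : wt j = w ∧ ky j = k
      · have hpn : pos j ≠ n := by
          intro hh
          rw [hv.1, hv.2, hh, ← hl] at hb
          exact hjl hb.2.symm
        have hpp : pos j ≠ p := by
          intro hh
          rw [hv.1, hv.2, hh, hi.2] at hb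
          exact hji hb.2.symm
        rw [if_pos hv, if_neg (by tauto), if_neg (by tauto)]
        rw [hv.1, hv.2] at hb ⊢
        exact ⟨by omega, hb.2⟩
      · rw [if_neg hv, if_neg (by tauto), if_neg (by tauto)]
        exact hb
  · intro v j k' hj
    rw [hbl] at hj
    rw [hbk]
    by_cases hv : v = w ∧ k' = k
    · rw [if_pos hv] at hj
      by_cases hjn : j = n
      · rw [if_pos ⟨hv.1, hjn, hv.2⟩]
      · rw [if_neg (by tauto), if_neg (by rintro ⟨_, h, _⟩; omega)]
        exact h3 _ _ _ (by rw [hv.1, hv.2]; omega)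
    · rw [if_neg hv] at hj
      rw [if_neg (by tauto), if_neg (by tauto)]
      exact h3 _ _ _ hj

open Classical in
theorem Buckets.add (h : Buckets ky wt pos bl bk) {i w n : ℕ} {k : K} (hi : wt i = 0)
    (hw0 : w ≠ 0) (hk : ky i = k) (hn : n = bl w k)
    (hwt : ∀ j, wt' j = if j = i then w else wt j)
    (hpos : ∀ j, pos' j = if j = i then n else pos j)
    (hbl : ∀ v k', bl' v k' = if v = w ∧ k' = k then n + 1 else bl v k')
    (hbk : ∀ v j k', bk' v j k' = if v = w ∧ j = n ∧ k' = k then i else bk v j k') :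
    Buckets ky wt' pos' bl' bk' := by
  obtain ⟨h1, h2, h3⟩ := h
  refine ⟨?_, ?_, ?_⟩
  · intro v j k' hj
    rw [hbl] at hj
    rw [hbk]
    by_cases hv : v = w ∧ j = n ∧ k' = k
    · rw [if_pos hv, hwt, hpos]
      simp [hk, hv, hw0]
    · have hj' : j < bl v k' := by
        split_ifs at hj with hc
        · have : j ≠ n := by tauto
          rw [hc.1, hc.2]
          omega
        · exact hj
      have hb := h1 v j k' hj'
      have : bk v j k' ≠ i := by
        intro hh
        rw [hh] at hb
        omega
      rw [if_neg hv, hwt, hpos, if_neg this, if_neg this]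
      exact hb
  · intro j hj
    rw [hwt, hpos, hbl, hbk]
    by_cases hji : j = i
    · subst hji
      simp [hk]
    · rw [hwt, if_neg hji] at hj
      have hb := h2 j hj
      rw [if_neg hji, if_neg hji]
      by_cases hv : wt j = w ∧ ky j = k
      · rw [if_pos hv, if_neg (by rintro ⟨_, h, _⟩; rw [hv.1, hv.2] at hb; omega)]
        exact ⟨by rw [hv.1, hv.2] at hb; omega, hb.2⟩
      · rw [if_neg hv, if_neg (by tauto)]
        exact hb
  · intro v j k' hj
    rw [hbl] at hj
    rw [hbk]
    split_ifs at hj with hv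
    · rw [if_neg (by rintro ⟨_, h, _⟩; omega)]
      exact h3 _ _ _ (by rw [hv.1, hv.2]; omega)
    · rw [if_neg (by rintro ⟨h, h', h''⟩; exact hv ⟨h, h''⟩)]
      exact h3 _ _ _ hj

/-- `Linked nx h l`: following the pointers `nx` from `h` to `0` yields the list `l`. -/
inductive Linked (nx : ℕ → ℕ) : ℕ → List ℕ → Prop
  | nil : Linked nx 0 []
  | cons (i : ℕ) (l : List ℕ) (hi : i ≠ 0) (h : Linked nx (nx i) l) : Linked nx i (i :: l)

theorem Linked.congr {nx nx' : ℕ → ℕ} {h : ℕ} {l : List ℕ} (hl : Linked nx h l)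
    (he : ∀ i ∈ l, nx' i = nx i) : Linked nx' h l := by
  induction hl with
  | nil => exact .nil
  | cons i l hi _ ih =>
    refine .cons i l hi ?_
    rw [he i (by simp)]
    exact ih fun j hj => he j (by simp [hj])

end Buckets

/-! ## Join trees and their flat representation -/

/-- Labels of the nodes of join trees: a relation, or none for an additional root. -/
abbrev Lab (V : Type u) := Option (Finset V)

/-- The attributes of a label. -/
def att {V : Type u} (a : Lab V) : Finset V := a.getD ∅

/-- Rooted join trees, where `join τ p c` attaches the tree `c` to the root of `p`; the tag of the
new edge is `τ`. -/
inductive JT (V : Type u) where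
  | leaf (a : Lab V)
  | join (τ : ℕ) (p c : JT V)

section Trees

variable {V : Type u}

def JT.root : JT V → Lab V
  | .leaf a => a
  | .join _ p _ => p.root

open Classical in
/-- The common attributes of the roots of `p` and `c`. -/
noncomputable def sep (p c : JT V) : Finset V := att p.root ∩ att c.root

/-- The number of nodes. -/
def JT.size : JT V → ℕ
  | .leaf _ => 1
  | .join _ p c => p.size + c.size

/-- The tags of the edges. -/
def JT.tags : JT V → List ℕ
  | .leaf _ => []
  | .join τ p c => τ :: (p.tags ++ c.tags)

/-- The tags and keys of the edges to the children of the root. -/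
noncomputable def JT.kids : JT V → List (ℕ × Finset V)
  | .leaf _ => []
  | .join τ p c => (τ, sep p c) :: p.kids

/-- An edge of a join tree: its tag, the label of the parent, the key, and the subtree below it. -/
structure Edge (V : Type u) where
  tag : ℕ
  par : Lab V
  K : Finset V
  c : JT V

/-- All edges of a join tree, each with the list of the edges from it to the root, to which `us` is
appended. -/
noncomputable def JT.paths : JT V → List (Edge V) → List (Edge V × List (Edge V))
  | .leaf _, _ => []
  | .join τ p c, us =>
      (⟨τ, p.root, sep p c, c⟩, us) :: (p.paths us ++ c.paths (⟨τ, p.root, sep p c, c⟩ :: us))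

theorem JT.size_pos (T : JT V) : 0 < T.size := by
  induction T with
  | leaf => simp [size]
  | join τ p c ihp _ => simp [size, ihp]

theorem JT.tags_paths (T : JT V) (us : List (Edge V)) :
    ∀ e ∈ T.paths us, e.1.tag ∈ T.tags ∧ ∀ t ∈ e.1.c.tags, t ∈ T.tags := by
  induction T generalizing us with
  | leaf => simp [paths]
  | join τ p c ihp ihc =>
    intro e he
    simp only [paths, List.mem_cons, List.mem_append] at he
    simp only [tags, List.mem_cons, List.mem_append]
    rcases he with rfl | he | he
    · exact ⟨.inl rfl, fun t ht => .inr (.inr ht)⟩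
    · exact ⟨.inr (.inl (ihp _ _ he).1), fun t ht => .inr (.inl ((ihp _ _ he).2 t ht))⟩
    · exact ⟨.inr (.inr (ihc _ _ he).1), fun t ht => .inr (.inr ((ihc _ _ he).2 t ht))⟩

theorem JT.map_tag_paths (T : JT V) (us : List (Edge V)) :
    (T.paths us).map (fun e => e.1.tag) = T.tags := by
  induction T generalizing us with
  | leaf => rfl
  | join τ p c ihp ihc => simp [paths, tags, ihp, ihc]

theorem JT.kids_tags (T : JT V) : ∀ e ∈ T.kids, e.1 ∈ T.tags := by
  induction T with
  | leaf => simp [kids]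
  | join τ p c ihp _ =>
    intro e he
    simp only [kids, List.mem_cons] at he
    simp only [tags, List.mem_cons, List.mem_append]
    rcases he with rfl | he
    · exact .inl rfl
    · exact .inr (.inl (ihp e he))

theorem JT.paths_root {T : JT V} (hT : T.tags.Nodup) (us : List (Edge V)) :
    ∀ e ∈ T.paths us, ∀ d ∈ T.kids, d.1 = e.1.tag → e.2 = us ∧ d.2 = e.1.K ∧ e.1.par = T.root := by
  induction T generalizing us with
  | leaf => simp [paths]
  | join τ p c ihp ihc =>
    simp only [tags, List.nodup_cons, List.mem_append, List.nodup_append, not_or] at hT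
    obtain ⟨⟨h1, h2⟩, h3, h4, h5⟩ := hT
    intro e he d hd hde
    simp only [paths, List.mem_cons, List.mem_append] at he
    simp only [kids, List.mem_cons] at hd
    rcases he with rfl | he | he
    · rcases hd with rfl | hd
      · exact ⟨rfl, rfl, rfl⟩
      · exact (h1 ((show d.1 = τ from hde) ▸ kids_tags p d hd)).elim
    · rcases hd with rfl | hd
      · exact (h1 ((show e.1.tag = τ from hde.symm) ▸ (tags_paths p us e he).1)).elim
      · exact ihp h3 us e he d hd hde
    · rcases hd with rfl | hd
      · exact (h2 ((show e.1.tag = τ from hde.symm) ▸ (tags_paths c _ e he).1)).elim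
      · exact (h5 _ (kids_tags p d hd) _ (tags_paths c _ e he).1 hde).elim

/-- The edge above a given edge is determined by the tag. -/
theorem JT.paths_up {T : JT V} (hT : T.tags.Nodup) (us : List (Edge V)) :
    ∀ e ∈ T.paths us, ∀ d ∈ T.paths us, ∀ t ∈ d.1.c.kids, t.1 = e.1.tag →
      e.2 = d.1 :: d.2 ∧ t.2 = e.1.K ∧ e.1.par = d.1.c.root := by
  induction T generalizing us with
  | leaf => simp [paths]
  | join τ p c ihp ihc =>
    simp only [tags, List.nodup_cons, List.mem_append, List.nodup_append, not_or] at hT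
    obtain ⟨⟨h1, h2⟩, h3, h4, h5⟩ := hT
    intro e he d hd t ht hte
    have htd := kids_tags _ t ht
    simp only [paths, List.mem_cons, List.mem_append] at he hd
    rcases hd with rfl | hd | hd
    · rcases he with rfl | he | he
      · exact (h2 ((show t.1 = τ from hte) ▸ htd)).elim
      · exact (h5 _ (tags_paths p us e he).1 _ htd hte.symm).elim
      · exact paths_root h4 _ e he t ht hte
    · have hp := (tags_paths p us d hd).2 _ htd
      rcases he with rfl | he | he
      · exact (h1 ((show t.1 = τ from hte) ▸ hp)).elim
      · exact ihp h3 us e he d hd t ht hte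
      · exact (h5 _ hp _ (tags_paths c _ e he).1 hte).elim
    · have hp := (tags_paths c _ d hd).2 _ htd
      rcases he with rfl | he | he
      · exact (h2 ((show t.1 = τ from hte) ▸ hp)).elim
      · exact (h5 _ (tags_paths p us e he).1 _ hp hte.symm).elim
      · exact ihc h4 _ e he d hd t ht hte

/-- The shape of the upward paths. -/
theorem JT.paths_snd (T : JT V) (us : List (Edge V)) :
    ∀ e ∈ T.paths us, (e.2 = us ∧ e.1.par = T.root) ∨
      ∃ d ∈ T.paths us, e.2 = d.1 :: d.2 ∧ e.1.par = d.1.c.root := by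
  induction T generalizing us with
  | leaf => simp [paths]
  | join τ p c ihp ihc =>
    intro e he
    simp only [paths, List.mem_cons, List.mem_append] at he
    rcases he with rfl | he | he
    · exact .inl ⟨rfl, rfl⟩
    · rcases ihp us e he with h | ⟨d, hd, h⟩
      · exact .inl h
      · exact .inr ⟨d, by simp [paths, hd], h⟩
    · rcases ihc _ e he with h | ⟨d, hd, h⟩
      · exact .inr ⟨_, List.mem_cons_self, h⟩
      · exact .inr ⟨d, by simp [paths, hd], h⟩

end Trees

/-! ## The layout of the memory -/

/-- Addresses of memory cells. -/
abbrev Key (A : Type v) := List (Word A)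

/-- The values of the attributes in `K`. -/
noncomputable def key {V : Type u} {A : Type v} (K : Finset V) (f : V → Word A) : Key A :=
  K.toList.map f

theorem key_eq_iff {V : Type u} {A : Type v} {K : Finset V} {f g : V → Word A} : key K f = key K g ↔ ∀ x ∈ K, f x = g x := by
  simp [key]

section Layout

variable {V : Type u} [Encodable V] {A : Type v}

/-- The number of tuples. -/
abbrev aN : Key A := [.num 0]
/-- The value of the attribute `x` of tuple number `i`. -/
abbrev aRow (i : ℕ) (x : V) : Key A := [.num 1, .num i, .num (Encodable.encode x)]
/-- The number of the tuple with the values `k` in relation `a`. -/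
abbrev aId (a : Lab V) (k : Key A) : Key A := .num 2 :: .num (Encodable.encode a) :: k
/-- The stored weight of tuple number `i`. -/
abbrev aWt (τ i : ℕ) : Key A := [.num (τ + 3), .num 0, .num i]
/-- The position of tuple number `i` in its bucket. -/
abbrev aPos (τ i : ℕ) : Key A := [.num (τ + 3), .num 1, .num i]
/-- The successor of tuple number `i` in the list of parents. -/
abbrev aNxt (τ i : ℕ) : Key A := [.num (τ + 3), .num 2, .num i]
/-- The total weight of the group with key `k`. -/
abbrev aCnt (τ : ℕ) (k : Key A) : Key A := .num (τ + 3) :: .num 3 :: k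
/-- The total weight of the group with key `k`, rounded up. -/
abbrev aCap (τ : ℕ) (k : Key A) : Key A := .num (τ + 3) :: .num 4 :: k
/-- The first entry in the list of parents with key `k`. -/
abbrev aHead (τ : ℕ) (k : Key A) : Key A := .num (τ + 3) :: .num 5 :: k
/-- The length of the bucket for weight `w`. -/
abbrev aBl (τ w : ℕ) (k : Key A) : Key A := .num (τ + 3) :: .num 6 :: .num w :: k
/-- The entry at position `j` of the bucket for weight `w`. -/
abbrev aBk (τ w j : ℕ) (k : Key A) : Key A := .num (τ + 3) :: .num 7 :: .num w :: .num j :: k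

/-- The addresses that belong to the edge with tag `τ`. -/
inductive IsEAddr (τ : ℕ) : Key A → Prop
  | wt (i : ℕ) : IsEAddr τ (aWt τ i)
  | pos (i : ℕ) : IsEAddr τ (aPos τ i)
  | nxt (i : ℕ) : IsEAddr τ (aNxt τ i)
  | cnt (k : Key A) : IsEAddr τ (aCnt τ k)
  | cap (k : Key A) : IsEAddr τ (aCap τ k)
  | head (k : Key A) : IsEAddr τ (aHead τ k)
  | bl (w : ℕ) (k : Key A) : IsEAddr τ (aBl τ w k)
  | bk (w j : ℕ) (k : Key A) : IsEAddr τ (aBk τ w j k)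

/-- The part of the memory that holds the values of the tuples. -/
def rowCell (row : ℕ → V → Word A) : Key A → Word A
  | [.num i, .num y] => ((Encodable.decode₂ V y).map (row i)).getD (.num 0)
  | _ => .num 0

open Classical in
/-- The memory contents with the numbers `σ` and the tuples `row`. -/
noncomputable def enc (σ : Key A → ℕ) (row : ℕ → V → Word A) : Mem A := fun a =>
  if a.head? = some (.num 1) then rowCell row a.tail else .num (σ a)

theorem enc_num (σ : Key A → ℕ) (row : ℕ → V → Word A) {f : ℕ} (hf : f ≠ 1) (a : Key A) :
    enc σ row (.num f :: a) = .num (σ (.num f :: a)) := by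
  simp [enc, hf]

theorem enc_row (σ : Key A → ℕ) (row : ℕ → V → Word A) (i : ℕ) (x : V) :
    enc σ row (aRow i x) = row i x := by
  simp [enc, rowCell]

open Classical in
theorem update_enc_num (σ : Key A → ℕ) (row : ℕ → V → Word A) {f : ℕ} (hf : f ≠ 1) (a : Key A)
    (v : ℕ) : Function.update (enc σ row) (.num f :: a) (.num v) =
      enc (Function.update σ (.num f :: a) v) row := by
  funext b
  by_cases hb : b = .num f :: a
  · subst hb
    simp [enc, hf]
  · simp [enc, hb]

open Classical in
theorem update_enc_row (σ : Key A → ℕ) (row : ℕ → V → Word A) (i : ℕ) (x : V) (w : Word A) :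
    Function.update (enc σ row) (aRow i x) w =
      enc σ (Function.update row i (Function.update (row i) x w)) := by
  funext b
  by_cases hb : b = aRow i x
  · subst hb
    simp [enc, rowCell]
  · rw [Function.update_of_ne hb]
    unfold enc
    split_ifs with h
    · rcases b with - | ⟨b0, b⟩
      · simp at h
      simp only [List.head?_cons, Option.some.injEq] at h
      subst h
      simp only [List.tail_cons]
      unfold rowCell
      split
      · rename_i j y
        rcases hd : Encodable.decode₂ V y with - | z
        · simp
        · simp only [Option.map_some, Option.getD_some]
          by_cases hj : j = i
          · subst hj
            by_cases hz : z = x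
            · subst hz
              -- `decode₂` succeeds only on genuine codes, so an address that decodes to `x` is
              -- `aRow i x` itself.
              have := Encodable.mem_decode₂.1 (Option.mem_def.2 hd)
              simp [this] at hb
            · simp [hz]
          · simp [hj]
      · rfl
    · rfl

end Layout

/-! ## The invariants -/

section Invariants

variable {V : Type u} {A : Type v}

/-- The weight of a tuple `f` at the root of `T`: the product of the rounded total weights of the
matching groups of its children. -/
noncomputable def W (σ : Key A → ℕ) : JT V → (V → Word A) → ℕ
  | .leaf _, _ => 1
  | .join τ p c, f => W σ p f * σ (aCap τ (key (sep p c) f))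

theorem W_congr {σ σ' : Key A → ℕ} {T : JT V} {f : V → Word A}
    (h : ∀ t ∈ T.kids, σ' (aCap t.1 (key t.2 f)) = σ (aCap t.1 (key t.2 f))) :
    W σ' T f = W σ T f := by
  induction T with
  | leaf => rfl
  | join τ p c ihp _ =>
    simp only [JT.kids, List.mem_cons, forall_eq_or_imp] at h
    rw [W, W, h.1, ihp h.2]

theorem W_mono {σ σ' : Key A → ℕ} (h : ∀ τ k, σ (aCap τ k) ≤ σ' (aCap τ k)) (T : JT V)
    (f : V → Word A) : W σ T f ≤ W σ' T f := by
  induction T with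
  | leaf => exact le_rfl
  | join τ p c ihp _ => exact Nat.mul_le_mul ihp (h _ _)

/-- The tuples of the database: their number, and the relations and values of the tuples with the
numbers `1, …, n`. -/
structure Ghost (V : Type u) (A : Type v) where
  n : ℕ
  rel : ℕ → Lab V
  row : ℕ → V → Word A

/-- The number `i` belongs to a tuple of the relation `a`. -/
def Ghost.Is (G : Ghost V A) (i : ℕ) (a : Lab V) : Prop := 1 ≤ i ∧ i ≤ G.n ∧ G.rel i = a

/-- `c` is `0` if `m` is, and otherwise a power of two, at least `m` and less than `2 * m`. -/
structure Rounds (m c : ℕ) : Prop where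
  le : m ≤ c
  pow : c = 0 ∨ (∃ e, c = 2 ^ e) ∧ c < 2 * m

open Classical in
/-- The invariants of the data structure for the edge `ε`, where the weights of the tuples in `D`
may be out of date. -/
structure EInv (G : Ghost V A) (σ : Key A → ℕ) (ε : Edge V) (D : Set ℕ) : Prop where
  wt_is : ∀ i, σ (aWt ε.tag i) ≠ 0 → G.Is i ε.c.root
  pos_is : ∀ i, σ (aPos ε.tag i) ≠ 0 → G.Is i ε.c.root
  nxt_is : ∀ i, σ (aNxt ε.tag i) ≠ 0 → G.Is i ε.par
  wt_pow : ∀ i, σ (aWt ε.tag i) = 0 ∨ ∃ e, σ (aWt ε.tag i) = 2 ^ e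
  buckets : Buckets (fun i => key ε.K (G.row i)) (fun i => σ (aWt ε.tag i))
    (fun i => σ (aPos ε.tag i)) (fun w k => σ (aBl ε.tag w k)) (fun w j k => σ (aBk ε.tag w j k))
  cnt : ∀ k, σ (aCnt ε.tag k) =
    ∑ i ∈ Finset.Icc 1 G.n, if key ε.K (G.row i) = k then σ (aWt ε.tag i) else 0
  cap : ∀ k, Rounds (σ (aCnt ε.tag k)) (σ (aCap ε.tag k))
  wt_le : ∀ i, G.Is i ε.c.root → σ (aWt ε.tag i) ≤ W σ ε.c (G.row i)
  wt_eq : ∀ i, G.Is i ε.c.root → i ∉ D → σ (aWt ε.tag i) = W σ ε.c (G.row i)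
  par : ∀ k, ∃ l : List ℕ, l.Nodup ∧ Linked (fun i => σ (aNxt ε.tag i)) (σ (aHead ε.tag k)) l ∧
    ∀ i, i ∈ l ↔ G.Is i ε.par ∧ key ε.K (G.row i) = k

/-- For edges whose own cells are untouched: a change elsewhere affects them only through the
weights that their tuples should have. -/
theorem EInv.frame {G : Ghost V A} {σ σ' : Key A → ℕ} {ε : Edge V} {D D' : Set ℕ}
    (h : EInv G σ ε D) (hσ : ∀ f a, σ' (.num (ε.tag + 3) :: .num f :: a) =
      σ (.num (ε.tag + 3) :: .num f :: a))
    (hle : ∀ i, G.Is i ε.c.root → W σ ε.c (G.row i) ≤ W σ' ε.c (G.row i))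
    (heq : ∀ i, G.Is i ε.c.root → i ∉ D' → i ∉ D ∧ W σ' ε.c (G.row i) = W σ ε.c (G.row i)) :
    EInv G σ' ε D' := by
  obtain ⟨h1, h2, h3, h4, h5, h6, h7, h8, h9, h10⟩ := h
  constructor
  · simpa only [hσ] using h1
  · simpa only [hσ] using h2
  · simpa only [hσ] using h3
  · simpa only [hσ] using h4
  · simpa only [hσ] using h5
  · simpa only [hσ] using h6
  · simpa only [hσ] using h7
  · intro i hi
    rw [hσ]
    exact (h8 i hi).trans (hle i hi)
  · intro i hi hD
    rw [hσ, (heq i hi hD).2]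
    exact h9 i hi (heq i hi hD).1
  · simpa only [hσ] using h10

variable [Encodable V]

/-- The invariants of the whole data structure for the tree `S`, where `D τ` is the set of the
tuples whose weights at the edge with tag `τ` may be out of date. -/
structure Inv (S : JT V) (G : Ghost V A) (σ : Key A → ℕ) (D : ℕ → Set ℕ) : Prop where
  edges : ∀ e ∈ S.paths [], EInv G σ e.1 (D e.1.tag)
  num : σ aN = G.n
  lab : ∀ i a, G.Is i a → a ≠ none
  row_out : ∀ i x, ¬(1 ≤ i ∧ i ≤ G.n ∧ x ∈ att (G.rel i)) → G.row i x = .num 0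
  id_is : ∀ a k, σ (aId a k) ≠ 0 → G.Is (σ (aId a k)) a ∧ key (att a) (G.row (σ (aId a k))) = k
  is_id : ∀ i a, G.Is i a → σ (aId a (key (att a) (G.row i))) = i
  supp : ∀ ad, σ ad ≠ 0 → ad = aN ∨ (∃ (a : Lab V) (k : Key A), ad = aId a k) ∨
    ∃ e ∈ S.paths [], IsEAddr e.1.tag ad

/-! ### Bounds -/

omit [Encodable V] in
-- A weight in a tree of `s` nodes is at most `X ^ (s - 1)`, written multiplied by `X` to avoid the
-- subtraction. A group has at most `G.n` members and rounding less than doubles, so a capacity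
-- costs a factor `2 * G.n ≤ X`, which restores the power for the subtree below the edge. Outdated
-- stored weights do no harm, as by `wt_le` they are underestimates; the bound is thus available in
-- the middle of an update.
theorem weight_bound {G : Ghost V A} {σ : Key A → ℕ} {X : ℕ} (hX : 2 * G.n + 2 ≤ X) (T : JT V)
    (us : List (Edge V)) (h : ∀ e ∈ T.paths us, ∃ D, EInv G σ e.1 D) :
    (∀ f, W σ T f * X ≤ X ^ T.size) ∧
      ∀ e ∈ T.paths us, (∀ i, σ (aWt e.1.tag i) ≤ X ^ T.size) ∧
        (∀ k, σ (aCap e.1.tag k) ≤ X ^ T.size) ∧ ∀ i, W σ e.1.c (G.row i) ≤ X ^ T.size := by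
  induction T generalizing us with
  | leaf => simp [JT.paths, W, JT.size]
  | join τ p c ihp ihc =>
    have hp := ihp us fun e he => h e (by simp [JT.paths, he])
    have hc := ihc (⟨τ, p.root, sep p c, c⟩ :: us) fun e he =>
      h e (List.mem_cons_of_mem _ (List.mem_append_right _ he))
    have hX0 : 0 < X := by omega
    have hps : X ^ p.size ≤ X ^ (JT.join τ p c).size :=
      Nat.pow_le_pow_right hX0 (by simp [JT.size])
    have hcs : X ^ c.size ≤ X ^ (JT.join τ p c).size :=
      Nat.pow_le_pow_right hX0 (by simp [JT.size])
    obtain ⟨D, he⟩ := h (⟨τ, p.root, sep p c, c⟩, us) (by simp [JT.paths])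
    have hw : ∀ i, σ (aWt τ i) * X ≤ X ^ c.size := by
      intro i
      by_cases hi : σ (aWt τ i) = 0
      · simp [hi]
      · exact (Nat.mul_le_mul_right _ (he.wt_le i (he.wt_is i hi))).trans (hc.1 _)
    have hcnt : ∀ k, 2 * σ (aCnt τ k) ≤ X ^ c.size := by
      intro k
      have e := he.cnt k
      simp only at e
      have h1 : σ (aCnt τ k) * X ≤ G.n * X ^ c.size := by
        rw [e, Finset.sum_mul]
        refine (Finset.sum_le_card_nsmul _ _ (X ^ c.size) fun i _ => ?_).trans (by simp)
        split_ifs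
        · exact hw i
        · simp
      have h2 : 2 * σ (aCnt τ k) * X ≤ X ^ c.size * X := by
        calc 2 * σ (aCnt τ k) * X = 2 * (σ (aCnt τ k) * X) := by ring
          _ ≤ 2 * (G.n * X ^ c.size) := Nat.mul_le_mul_left _ h1
          _ = X ^ c.size * (2 * G.n) := by ring
          _ ≤ _ := Nat.mul_le_mul_left _ (by omega)
      exact Nat.le_of_mul_le_mul_right h2 hX0
    have hcap : ∀ k, σ (aCap τ k) ≤ X ^ c.size := by
      intro k
      rcases (he.cap k).pow with h0 | ⟨_, h0⟩
      · exact h0.le.trans (Nat.zero_le _)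
      · exact h0.le.trans (hcnt k)
    constructor
    · intro f
      rw [W, JT.size, pow_add]
      calc W σ p f * σ (aCap τ (key (sep p c) f)) * X
          = (W σ p f * X) * σ (aCap τ (key (sep p c) f)) := by ring
        _ ≤ _ := Nat.mul_le_mul (hp.1 f) (hcap _)
    · intro e he'
      simp only [JT.paths, List.mem_cons, List.mem_append] at he'
      rcases he' with rfl | he' | he'
      · refine ⟨fun i => ?_, fun k => (hcap k).trans hcs, fun i => ?_⟩
        · exact ((Nat.le_mul_of_pos_right _ hX0).trans (hw i)).trans hcs
        · exact ((Nat.le_mul_of_pos_right _ hX0).trans (hc.1 _)).trans hcs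
      · obtain ⟨h1, h2, h3⟩ := hp.2 e he'
        exact ⟨fun i => (h1 i).trans hps, fun i => (h2 i).trans hps, fun i => (h3 i).trans hps⟩
      · obtain ⟨h1, h2, h3⟩ := hc.2 e he'
        exact ⟨fun i => (h1 i).trans hcs, fun i => (h2 i).trans hcs, fun i => (h3 i).trans hcs⟩

/-- The addresses of the occupied cells that are due to the tuple number `i`. -/
noncomputable def cells (S : JT V) (G : Ghost V A) (σ : Key A → ℕ) (i : ℕ) : List (Key A) :=
  (att (G.rel i)).toList.map (aRow i) ++ [aId (G.rel i) (key (att (G.rel i)) (G.row i))] ++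
    (S.paths []).flatMap fun e =>
      let τ := e.1.tag
      let k := key e.1.K (G.row i)
      [aWt τ i, aPos τ i, aNxt τ i, aCnt τ k, aCap τ k, aHead τ k, aBl τ (σ (aWt τ i)) k,
        aBk τ (σ (aWt τ i)) (σ (aPos τ i)) k]

theorem length_cells [Fintype V] (S : JT V) (G : Ghost V A) (σ : Key A → ℕ) (i : ℕ) :
    (cells S G σ i).length ≤ Fintype.card V + 1 + 8 * (S.paths []).length := by
  simp only [cells, List.length_append, List.length_map, Finset.length_toList, List.length_flatMap,
    List.length_cons, List.length_nil, List.map_const', List.sum_replicate]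
  have := (att (G.rel i)).card_le_univ
  simp only [smul_eq_mul]
  omega

/-- A nonzero cell always has a witness tuple that determines its address: a tuple with the key in
question, a member of the bucket, or the first entry of a list of parents. -/
theorem Inv.mem_cells {S : JT V} {G : Ghost V A} {σ : Key A → ℕ} {D : ℕ → Set ℕ}
    (h : Inv S G σ D) {ad : Key A} (had : enc σ G.row ad ≠ .num 0) :
    ad = aN ∨ ∃ i ∈ Finset.Icc 1 G.n, ad ∈ cells S G σ i := by
  by_cases hh : ad.head? = some (.num 1)
  · right
    rcases ad with - | ⟨b, t⟩
    · simp at hh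
    simp only [List.head?_cons, Option.some.injEq] at hh
    subst hh
    simp only [enc, List.head?_cons, if_true, List.tail_cons, rowCell] at had
    split at had
    · rename_i i y
      rcases hd : Encodable.decode₂ V y with - | x
      · simp [hd] at had
      · simp only [hd, Option.map_some, Option.getD_some] at had
        have hy := Encodable.mem_decode₂.1 (Option.mem_def.2 hd)
        have := not_not.1 (mt (h.row_out i x) had)
        refine ⟨i, Finset.mem_Icc.2 ⟨this.1, this.2.1⟩, ?_⟩
        simp only [cells, List.mem_append]
        refine .inl (.inl (List.mem_map.2 ⟨x, by simp [this.2.2], by rw [aRow, hy]⟩))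
    · exact (had rfl).elim
  · simp only [enc, hh, if_false, ne_eq, Word.num.injEq] at had
    rcases h.supp ad had with rfl | ⟨a, k, rfl⟩ | ⟨e, he, hea⟩
    · exact .inl rfl
    · right
      have := h.id_is a k had
      refine ⟨_, Finset.mem_Icc.2 ⟨this.1.1, this.1.2.1⟩, ?_⟩
      simp only [cells, List.mem_append]
      refine .inl (.inr ?_)
      rw [this.1.2.2, this.2]
      simp
    · right
      have hE := h.edges e he
      have key : ∀ i a, G.Is i a → ad ∈ [aWt e.1.tag i, aPos e.1.tag i, aNxt e.1.tag i,
          aCnt e.1.tag (key e.1.K (G.row i)), aCap e.1.tag (key e.1.K (G.row i)),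
          aHead e.1.tag (key e.1.K (G.row i)),
          aBl e.1.tag (σ (aWt e.1.tag i)) (key e.1.K (G.row i)),
          aBk e.1.tag (σ (aWt e.1.tag i)) (σ (aPos e.1.tag i)) (key e.1.K (G.row i))] →
          ∃ i ∈ Finset.Icc 1 G.n, ad ∈ cells S G σ i := by
        intro i a hi hm
        refine ⟨i, Finset.mem_Icc.2 ⟨hi.1, hi.2.1⟩, ?_⟩
        simp only [cells, List.mem_append]
        exact .inr (List.mem_flatMap.2 ⟨e, he, hm⟩)
      have hcnt : ∀ k, σ (aCnt e.1.tag k) ≠ 0 → ∃ i, 1 ≤ i ∧ i ≤ G.n ∧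
          JoinIndex.key e.1.K (G.row i) = k := by
        intro k hk
        rw [hE.cnt k] at hk
        obtain ⟨i, hi, hne⟩ := Finset.exists_ne_zero_of_sum_ne_zero hk
        have := Finset.mem_Icc.1 hi
        exact ⟨i, this.1, this.2, by by_contra hc; simp [hc] at hne⟩
      rcases hea with i | i | i | k | k | k | ⟨w, k⟩ | ⟨w, j, k⟩
      · exact key i _ (hE.wt_is i had) (by simp)
      · exact key i _ (hE.pos_is i had) (by simp)
      · exact key i _ (hE.nxt_is i had) (by simp)
      · obtain ⟨i, h1, h2, rfl⟩ := hcnt k had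
        exact key i _ ⟨h1, h2, rfl⟩ (by simp)
      -- By `Rounds`, a nonzero capacity comes with a nonzero total weight, hence with a tuple in
      -- the group.
      · have : σ (aCnt e.1.tag k) ≠ 0 := by
          rcases (hE.cap k).pow with h0 | ⟨_, h0⟩
          · exact (had h0).elim
          · intro hc
            simp [hc] at h0
        obtain ⟨i, h1, h2, rfl⟩ := hcnt k this
        exact key i _ ⟨h1, h2, rfl⟩ (by simp)
      · obtain ⟨l, _, hl, hm⟩ := hE.par k
        rcases hl' : σ (aHead e.1.tag k) with - | i
        · exact (had hl').elim
        · rw [hl'] at hl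
          cases hl with
          | cons _ l' h0 h1 =>
            obtain ⟨h2, rfl⟩ := (hm (i + 1)).1 (by simp)
            exact key (i + 1) _ h2 (by simp)
      -- The length cell of a nonempty bucket is charged to each of its members; the member at
      -- position `0` is the witness.
      · obtain ⟨h1, _, h3, h4⟩ := hE.buckets.mem w 0 k (Nat.pos_of_ne_zero had)
        refine key (σ (aBk e.1.tag w 0 k)) _ (hE.wt_is _ (by rwa [h1])) ?_
        rw [h1, h3]
        simp
      · have hj : j < σ (aBl e.1.tag w k) := by
          by_contra hc
          exact had (hE.buckets.out w j k (not_lt.1 hc))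
        obtain ⟨h1, h2, h3, h4⟩ := hE.buckets.mem w j k hj
        refine key (σ (aBk e.1.tag w j k)) _ (hE.wt_is _ (by rwa [h1])) ?_
        rw [h1, h2, h3]
        simp

theorem Inv.space_le [Fintype V] {S : JT V} {G : Ghost V A} {σ : Key A → ℕ} {D : ℕ → Set ℕ}
    (h : Inv S G σ D) : (enc σ G.row).space ≤
      (1 + G.n * (Fintype.card V + 1 + 8 * (S.paths []).length) : ℕ) := by
  classical
  let F : Finset (Key A) := insert aN ((Finset.Icc 1 G.n).biUnion fun i => (cells S G σ i).toFinset)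
  have h1 : {a | enc σ G.row a ≠ .num 0} ⊆ (F : Set (Key A)) := by
    intro ad had
    rcases h.mem_cells had with rfl | ⟨i, hi, hm⟩
    · simp [F]
    · simp only [F, Finset.coe_insert, Set.mem_insert_iff, Finset.mem_coe, Finset.mem_biUnion,
        List.mem_toFinset]
      exact .inr ⟨i, hi, hm⟩
  refine (Set.encard_le_encard h1).trans ?_
  rw [Set.encard_coe_eq_coe_finsetCard]
  refine Nat.cast_le.2 ((Finset.card_insert_le _ _).trans ?_)
  rw [Nat.add_comm]
  refine Nat.add_le_add_left (Finset.card_biUnion_le.trans ?_) 1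
  refine (Finset.sum_le_card_nsmul _ _ _ fun i _ =>
    (List.toFinset_card_le _).trans (length_cells S G σ i)).trans ?_
  simp

end Invariants

/-! ## The effect of one update on the invariants -/

section Update

variable {V : Type u} {A : Type v}

open Classical in
/-- The part of the potential that belongs to the edge `ε`. -/
noncomputable def pot (G : Ghost V A) (σ : Key A → ℕ) (ε : Edge V) : ℕ :=
  ∑ i ∈ Finset.Icc 1 G.n,
    ((if G.rel i = ε.c.root then (σ (aCap ε.tag (key ε.K (G.row i)))).size else 0) +
      if G.rel i = ε.par then (σ (aCap ε.tag (key ε.K (G.row i)))).size else 0)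

/-- The potential of the data structure. -/
noncomputable def potential (S : JT V) (G : Ghost V A) (σ : Key A → ℕ) : ℕ :=
  ((S.paths []).map fun e => pot G σ e.1).sum

open Classical in
/-- The data for the edge `ε` is changed from `σ` to `σ'`: the weight of the tuple `i` with key `k`
becomes `w`, and the rounded total weight for the key `k` becomes `c`. -/
structure Step (G : Ghost V A) (σ σ' : Key A → ℕ) (ε : Edge V) (i w c : ℕ) (k : Key A) : Prop where
  off : ∀ ad, ad.head? ≠ some (.num (ε.tag + 3)) → σ' ad = σ ad
  buckets : Buckets (fun i => key ε.K (G.row i)) (fun i => σ' (aWt ε.tag i))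
    (fun i => σ' (aPos ε.tag i)) (fun w k => σ' (aBl ε.tag w k)) (fun w j k => σ' (aBk ε.tag w j k))
  wt : ∀ j, σ' (aWt ε.tag j) = if j = i then w else σ (aWt ε.tag j)
  pos_is : ∀ j, σ' (aPos ε.tag j) ≠ 0 → G.Is j ε.c.root
  nxt : ∀ j, σ' (aNxt ε.tag j) = σ (aNxt ε.tag j)
  head : ∀ k', σ' (aHead ε.tag k') = σ (aHead ε.tag k')
  cnt : ∀ k', σ' (aCnt ε.tag k') =
    if k' = k then σ (aCnt ε.tag k) + w - σ (aWt ε.tag i) else σ (aCnt ε.tag k')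
  cap : ∀ k', σ' (aCap ε.tag k') = if k' = k then c else σ (aCap ε.tag k')
  cap_le : σ (aCap ε.tag k) ≤ c
  rounds : Rounds (σ' (aCnt ε.tag k)) c
  supp : ∀ ad, σ' ad ≠ 0 → σ ad ≠ 0 ∨ IsEAddr ε.tag ad

variable {G : Ghost V A} {σ σ' : Key A → ℕ} {ε : Edge V} {i w c : ℕ} {k : Key A}

theorem Step.cap_mono (h : Step G σ σ' ε i w c k) (τ : ℕ) (k' : Key A) :
    σ (aCap τ k') ≤ σ' (aCap τ k') := by
  by_cases hτ : τ = ε.tag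
  · subst hτ
    rw [h.cap]
    split_ifs with hk
    · subst hk
      exact h.cap_le
    · exact le_rfl
  · rw [h.off _ (by simpa using hτ)]

theorem Step.cap_eq (h : Step G σ σ' ε i w c k) {τ : ℕ} {k' : Key A}
    (hne : τ = ε.tag → k' = k → c = σ (aCap ε.tag k)) : σ' (aCap τ k') = σ (aCap τ k') := by
  by_cases hτ : τ = ε.tag
  · subst hτ
    rw [h.cap]
    split_ifs with hk
    · subst hk
      exact hne rfl rfl
    · rfl
  · exact h.off _ (by simpa using hτ)

variable [Encodable V]

/-- The step makes the weight of `i` at `ε` current. The only weights that depend on the changed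
capacity are those of the parents with key `k`, at the edge directly above `ε`; `hup` demands that
these be marked as outdated. -/
theorem Step.inv {S : JT V} (hS : S.tags.Nodup) {us : List (Edge V)} {D D' : ℕ → Set ℕ}
    (hI : Inv S G σ D) (he : (ε, us) ∈ S.paths []) (hi : G.Is i ε.c.root)
    (hk : key ε.K (G.row i) = k) (hw : w = W σ ε.c (G.row i)) (h : Step G σ σ' ε i w c k)
    (hD : ∀ τ, D τ \ (if τ = ε.tag then {i} else ∅) ⊆ D' τ)
    (hup : c ≠ σ (aCap ε.tag k) → ∀ ε' us', us = ε' :: us' →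
      ∀ j, G.Is j ε.par → key ε.K (G.row j) = k → j ∈ D' ε'.tag) : Inv S G σ' D' := by
  -- An edge is not below itself: otherwise `JT.paths_up` would give `us = ε :: us`. So the weights
  -- at `ε` do not depend on its own capacities.
  have hτ : ∀ t ∈ ε.c.kids, t.1 ≠ ε.tag := by
    intro t ht hte
    have := (JT.paths_up hS [] _ he _ he t ht hte).1
    have := congrArg List.length this
    simp at this
  have hWε : ∀ f, W σ' ε.c f = W σ ε.c f := fun f =>
    W_congr fun t ht => h.cap_eq fun h1 => (hτ t ht h1).elim
  refine ⟨?_, ?_, hI.lab, hI.row_out, ?_, ?_, ?_⟩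
  · intro e he'
    have hE := hI.edges e he'
    by_cases ht : e.1.tag = ε.tag
    · have hee : e = (ε, us) := by
        have hn : ((S.paths []).map fun e => e.1.tag).Nodup := by rwa [JT.map_tag_paths]
        exact List.inj_on_of_nodup_map hn he' he ht
      subst hee
      simp only at ht hE ⊢
      obtain ⟨h1, h2, h3, h4, h5, h6, h7, h8, h9, h10⟩ := hE
      refine ⟨?_, h.pos_is, ?_, ?_, h.buckets, ?_, ?_, ?_, ?_, ?_⟩
      · intro j hj
        rw [h.wt] at hj
        split_ifs at hj with hji
        · exact hji ▸ hi
        · exact h1 j hj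
      · intro j hj
        rw [h.nxt] at hj
        exact h3 j hj
      · intro j
        rw [h.wt]
        split_ifs with hji
        · by_cases hw0 : w = 0
          · exact .inl hw0
          · right
            -- A nonzero weight is a product of nonzero capacities, which are powers of two.
            have hall : ∀ T : JT V, W σ T (G.row i) ≠ 0 → (∀ t ∈ T.kids, ∃ e ∈ S.paths [],
                e.1.tag = t.1) → ∃ e, W σ T (G.row i) = 2 ^ e := by
              intro T
              induction T with
              | leaf => exact fun _ _ => ⟨0, rfl⟩
              | join τ p q ihp _ =>
                intro hne hkids
                simp only [JT.kids, List.mem_cons, forall_eq_or_imp] at hkids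
                rw [W] at hne ⊢
                obtain ⟨e1, h1⟩ := ihp (left_ne_zero_of_mul hne) hkids.2
                obtain ⟨⟨d, hd, hdt⟩, -⟩ := hkids
                have hr := ((hI.edges d hd).cap (key (sep p q) (G.row i))).pow
                rw [hdt] at hr
                obtain ⟨⟨e2, h2⟩, -⟩ := hr.resolve_left (right_ne_zero_of_mul hne)
                exact ⟨e1 + e2, by rw [h1, h2, pow_add]⟩
            rw [hw] at hw0 ⊢
            refine hall ε.c hw0 fun t ht => ?_
            have := (JT.tags_paths S [] _ he).2 _ (JT.kids_tags _ t ht)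
            rw [← JT.map_tag_paths S []] at this
            obtain ⟨d, hd, hdt⟩ := List.mem_map.1 this
            exact ⟨d, hd, hdt⟩
        · exact h4 j
      · intro k'
        rw [h.cnt]
        split_ifs with hkk
        · classical
          subst hkk
          have hmem : i ∈ Finset.Icc 1 G.n := Finset.mem_Icc.2 ⟨hi.1, hi.2.1⟩
          rw [h6, ← Finset.add_sum_erase _ _ hmem, ← Finset.add_sum_erase _ _ hmem, if_pos hk,
            if_pos hk, h.wt, if_pos rfl]
          have : ∑ x ∈ (Finset.Icc 1 G.n).erase i,
              (if key ε.K (G.row x) = k' then σ' (aWt ε.tag x) else 0) =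
              ∑ x ∈ (Finset.Icc 1 G.n).erase i,
              (if key ε.K (G.row x) = k' then σ (aWt ε.tag x) else 0) := by
            refine Finset.sum_congr rfl fun x hx => ?_
            rw [h.wt, if_neg (Finset.ne_of_mem_erase hx)]
          rw [this]
          omega
        · rw [h6]
          refine Finset.sum_congr rfl fun x _ => ?_
          by_cases hx : x = i
          · subst hx
            rw [if_neg (by rw [hk]; exact Ne.symm hkk), if_neg (by rw [hk]; exact Ne.symm hkk)]
          · rw [h.wt, if_neg hx]
      · intro k'
        by_cases hkk : k' = k
        · rw [h.cap, if_pos hkk, hkk]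
          exact h.rounds
        · rw [h.cap, if_neg hkk, h.cnt, if_neg hkk]
          exact h7 k'
      · intro j hj
        rw [h.wt, hWε]
        split_ifs with hji
        · rw [hw, hji]
        · exact h8 j hj
      · intro j hj hjD
        rw [h.wt, hWε]
        split_ifs with hji
        · rw [hw, hji]
        · refine h9 j hj fun hc => hjD (hD _ ⟨hc, ?_⟩)
          simpa using hji
      · intro k'
        simp only [h.nxt, h.head]
        exact h10 k'
    · refine hE.frame (fun f a => h.off _ (by simpa using ht))
        (fun j _ => W_mono h.cap_mono _ _) fun j hj hjD => ⟨fun hc => hjD (hD _ ⟨hc, ?_⟩), ?_⟩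
      · simp [ht]
      · refine W_congr fun t ht' => h.cap_eq fun h1 h2 => ?_
        -- A weight at `e` can change only if `ε` is an edge to a child of the lower end of `e`.
        -- Then `e` is the edge directly above `ε`, and the tuple was marked by `hup`.
        by_contra hne
        obtain ⟨h3, h4, h5⟩ := JT.paths_up hS [] _ he _ he' t ht' h1
        refine hjD (hup hne _ _ h3 j ?_ ?_)
        · simp only at h5
          rw [h5]
          exact hj
        · simp only at h4
          rw [← h4, h2]
  · rw [h.off _ (by simp)]
    exact hI.num
  · intro a k'
    rw [h.off _ (by simp)]
    exact hI.id_is a k'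
  · intro j a hj
    rw [h.off _ (by simp)]
    exact hI.is_id j a hj
  · intro ad had
    rcases h.supp ad had with h1 | h1
    · exact hI.supp ad h1
    · exact .inr (.inr ⟨_, he, h1⟩)

omit [Encodable V] in
theorem pot_mono (h : ∀ τ k', σ (aCap τ k') ≤ σ' (aCap τ k')) (ε' : Edge V) :
    pot G σ ε' ≤ pot G σ' ε' := by
  refine Finset.sum_le_sum fun j _ => Nat.add_le_add ?_ ?_
  · split_ifs
    · exact Nat.size_le_size (h _ _)
    · exact le_rfl
  · split_ifs
    · exact Nat.size_le_size (h _ _)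
    · exact le_rfl

omit [Encodable V] in
-- The bit length of the capacity for `k` enters once for every tuple with key `k` at either end of
-- the edge. The gain is counted for `i` in the summands of the child and for the tuples in `l` in
-- those of the parent; all other summands can only grow.
theorem Step.pot_le (hi : G.Is i ε.c.root) (hk : key ε.K (G.row i) = k)
    (h : Step G σ σ' ε i w c k) {l : List ℕ} (hl : l.Nodup)
    (hm : ∀ j ∈ l, G.Is j ε.par ∧ key ε.K (G.row j) = k) :
    pot G σ ε + (c.size - (σ (aCap ε.tag k)).size) * (1 + l.length) ≤ pot G σ' ε := by
  classical
  set δ := c.size - (σ (aCap ε.tag k)).size with hδ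
  have hsub : ∀ j, (σ (aCap ε.tag (key ε.K (G.row j)))).size +
      (if key ε.K (G.row j) = k then δ else 0) ≤
      (σ' (aCap ε.tag (key ε.K (G.row j)))).size := by
    intro j
    have hs := Nat.size_le_size h.cap_le
    split_ifs with hj
    · rw [hj, h.cap, if_pos rfl]
      omega
    · exact Nat.size_le_size (h.cap_mono _ _)
  have h1 : ∑ j ∈ Finset.Icc 1 G.n, (if j = i then δ else 0) = δ := by
    rw [Finset.sum_ite_eq', if_pos (Finset.mem_Icc.2 ⟨hi.1, hi.2.1⟩)]
  have h2 : ∑ j ∈ Finset.Icc 1 G.n, (if j ∈ l then δ else 0) = δ * l.length := by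
    rw [← Finset.sum_filter, Finset.sum_const, smul_eq_mul, mul_comm]
    congr 1
    rw [← List.toFinset_card_of_nodup hl]
    congr 1
    ext j
    simp only [Finset.mem_filter, Finset.mem_Icc, List.mem_toFinset]
    exact ⟨fun h => h.2, fun h => ⟨⟨(hm j h).1.1, (hm j h).1.2.1⟩, h⟩⟩
  calc pot G σ ε + δ * (1 + l.length)
      = pot G σ ε + (δ + δ * l.length) := by ring
    _ = ∑ j ∈ Finset.Icc 1 G.n,
          (((if G.rel j = ε.c.root then (σ (aCap ε.tag (key ε.K (G.row j)))).size else 0) +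
            if G.rel j = ε.par then (σ (aCap ε.tag (key ε.K (G.row j)))).size else 0) +
          ((if j = i then δ else 0) + if j ∈ l then δ else 0)) := by
        rw [Finset.sum_add_distrib, Finset.sum_add_distrib (f := fun j => if j = i then δ else 0),
          h1, h2, pot]
    _ ≤ _ := by
        refine Finset.sum_le_sum fun j _ => ?_
        have hj := hsub j
        have a1 : (if G.rel j = ε.c.root then (σ (aCap ε.tag (key ε.K (G.row j)))).size else 0) +
            (if j = i then δ else 0) ≤
            if G.rel j = ε.c.root then (σ' (aCap ε.tag (key ε.K (G.row j)))).size else 0 := by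
          by_cases hji : j = i
          · subst hji
            rw [if_pos hi.2.2, if_pos hi.2.2, if_pos rfl]
            rw [if_pos hk] at hj
            exact hj
          · rw [if_neg hji]
            split_ifs
            · omega
            · exact le_rfl
        have a2 : (if G.rel j = ε.par then (σ (aCap ε.tag (key ε.K (G.row j)))).size else 0) +
            (if j ∈ l then δ else 0) ≤
            if G.rel j = ε.par then (σ' (aCap ε.tag (key ε.K (G.row j)))).size else 0 := by
          by_cases hji : j ∈ l
          · obtain ⟨hj1, hj2⟩ := hm j hji
            rw [if_pos hj1.2.2, if_pos hj1.2.2, if_pos hji]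
            rw [if_pos hj2] at hj
            exact hj
          · rw [if_neg hji]
            split_ifs
            · omega
            · exact le_rfl
        omega

omit [Encodable V] in
theorem Step.potential_le {S : JT V} {us : List (Edge V)} (he : (ε, us) ∈ S.paths [])
    (hi : G.Is i ε.c.root) (hk : key ε.K (G.row i) = k)
    (h : Step G σ σ' ε i w c k) {l : List ℕ} (hl : l.Nodup)
    (hm : ∀ j ∈ l, G.Is j ε.par ∧ key ε.K (G.row j) = k) :
    potential S G σ + (c.size - (σ (aCap ε.tag k)).size) * (1 + l.length) ≤
      potential S G σ' := by
  obtain ⟨s, t, hst⟩ := List.append_of_mem he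
  have h1 := h.pot_le hi hk hl hm
  have h2 : (s.map fun e => pot G σ e.1).sum ≤ (s.map fun e => pot G σ' e.1).sum :=
    List.sum_le_sum fun e _ => pot_mono h.cap_mono e.1
  have h3 : (t.map fun e => pot G σ e.1).sum ≤ (t.map fun e => pot G σ' e.1).sum :=
    List.sum_le_sum fun e _ => pot_mono h.cap_mono e.1
  simp only [potential, hst, List.map_append, List.map_cons, List.sum_append, List.sum_cons]
  omega

end Update

/-! ## The programs for updates -/

section Programs

variable {V : Type u}

/-- Number register `n` as an operand. -/
abbrev rg (n : ℕ) : Operand (Reg V) := .reg (.inr n)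
/-- The values of the attributes in `K` as operands. -/
noncomputable abbrev oKey (K : Finset V) : List (Operand (Reg V)) :=
  K.toList.map fun x => .reg (.inl x)

theorem map_oKey {A : Type v} (K : Finset V) (f : V → Word A) (g : ℕ → Word A) :
    (oKey K).map (ev f g) = key K f := by
  simp [key, ev]

/-- The address of a cell of the edge with tag `τ`. -/
abbrev oEdge (τ f : ℕ) (a : List (Operand (Reg V))) : List (Operand (Reg V)) :=
  .const (τ + 3) :: .const f :: a

/-- Removes the tuple with the number in register `r` from the bucket for the weight in
register `2`. -/
noncomputable def removeProg (τ : ℕ) (K : Finset V) (r : ℕ) : Prog (Reg V) :=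
  .seq (.load (.inr 3) (oEdge τ 6 (rg 2 :: oKey K))) <|
  .seq (.arith (.inr 3) .minus (rg 3) (.const 1)) <|
  .seq (.load (.inr 4) (oEdge τ 1 [rg r])) <|
  .seq (.load (.inr 5) (oEdge τ 7 (rg 2 :: rg 3 :: oKey K))) <|
  .seq (.store (oEdge τ 7 (rg 2 :: rg 4 :: oKey K)) (rg 5)) <|
  .seq (.store (oEdge τ 1 [rg 5]) (rg 4)) <|
  .seq (.store (oEdge τ 7 (rg 2 :: rg 3 :: oKey K)) (.const 0)) <|
  .store (oEdge τ 6 (rg 2 :: oKey K)) (rg 3)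

/-- Adds the tuple with the number in register `r` to the bucket for the weight in register `1`,
and adjusts the total weight. -/
noncomputable def addProg (τ : ℕ) (K : Finset V) (r : ℕ) : Prog (Reg V) :=
  .seq (.load (.inr 3) (oEdge τ 6 (rg 1 :: oKey K))) <|
  .seq (.store (oEdge τ 7 (rg 1 :: rg 3 :: oKey K)) (rg r)) <|
  .seq (.store (oEdge τ 1 [rg r]) (rg 3)) <|
  .seq (.arith (.inr 3) .plus (rg 3) (.const 1)) <|
  .seq (.store (oEdge τ 6 (rg 1 :: oKey K)) (rg 3)) <|
  .seq (.store (oEdge τ 0 [rg r]) (rg 1)) <|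
  .seq (.load (.inr 4) (oEdge τ 3 (oKey K))) <|
  .seq (.arith (.inr 4) .plus (rg 4) (rg 1)) <|
  .seq (.arith (.inr 4) .minus (rg 4) (rg 2)) <|
  .store (oEdge τ 3 (oKey K)) (rg 4)

variable [Encodable V]

/-- Loads the values of the tuple with the number in register `r`. -/
noncomputable def loadRow (r : ℕ) : List V → Prog (Reg V)
  | [] => .skip
  | x :: xs => .seq (.load (.inl x) [.const 1, rg r, .const (Encodable.encode x)]) (loadRow r xs)

/-- Computes the weight of the tuple in the attribute registers at the root of `T`. -/
noncomputable def weightProg : JT V → Prog (Reg V)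
  | .leaf _ => .move (.inr 1) (.const 1)
  | .join τ p c => .seq (weightProg p) <|
      .seq (.load (.inr 3) (oEdge τ 4 (oKey (sep p c))))
        (.arith (.inr 1) .times (rg 1) (rg 3))

variable {A : Type v}

open Classical in
/-- The numbers in the memory after the execution of `removeProg`. -/
noncomputable def removed (τ : ℕ) (k : Key A) (i w : ℕ) (σ : Key A → ℕ) : Key A → ℕ :=
  Function.update (Function.update (Function.update (Function.update σ
    (aBk τ w (σ (aPos τ i)) k) (σ (aBk τ w (σ (aBl τ w k) - 1) k)))
    (aPos τ (σ (aBk τ w (σ (aBl τ w k) - 1) k))) (σ (aPos τ i)))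
    (aBk τ w (σ (aBl τ w k) - 1) k) 0) (aBl τ w k) (σ (aBl τ w k) - 1)

open Classical in
/-- The numbers in the memory after the execution of `addProg`. -/
noncomputable def added (τ : ℕ) (k : Key A) (i w w' : ℕ) (σ : Key A → ℕ) : Key A → ℕ :=
  Function.update (Function.update (Function.update (Function.update (Function.update σ
    (aBk τ w (σ (aBl τ w k)) k) i) (aPos τ i) (σ (aBl τ w k)))
    (aBl τ w k) (σ (aBl τ w k) + 1)) (aWt τ i) w) (aCnt τ k) (σ (aCnt τ k) + w - w')

theorem wp_loadRow {b r i : ℕ} {σ : Key A → ℕ} {row : ℕ → V → Word A} (xs : List V)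
    {Q : (V → Word A) → (ℕ → Word A) → Mem A → Prop} {f : V → Word A} {g : ℕ → Word A}
    (hr : g r = .num i)
    (hQ : ∀ f', (∀ x ∈ xs, f' x = row i x) → (∀ x, x ∉ xs → f' x = f x) → Q f' g (enc σ row)) :
    wp b (loadRow r xs) Q f g (enc σ row) := by
  classical
  induction xs generalizing f with
  | nil => exact hQ f (by simp) (by simp)
  | cons x xs ih =>
    simp only [loadRow, wp, List.map_cons, List.map_nil, ev, hr, enc_row]
    refine ih fun f' h1 h2 => hQ f' ?_ ?_
    · intro y hy
      by_cases hys : y ∈ xs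
      · exact h1 y hys
      · obtain rfl : y = x := by simpa [hys] using hy
        simp [h2 _ hys]
    · intro y hy
      simp only [List.mem_cons, not_or] at hy
      simp [h2 y hy.2, Function.update_of_ne hy.1]

theorem wp_weightProg {b X : ℕ} {G : Ghost V A} {σ : Key A → ℕ} (hX : 2 * G.n + 2 ≤ X) (T : JT V)
    (us : List (Edge V)) (h : ∀ e ∈ T.paths us, ∃ D, EInv G σ e.1 D) (hb : X ^ T.size < 2 ^ b)
    (hb0 : 1 ≤ b)
    {Q : (V → Word A) → (ℕ → Word A) → Mem A → Prop} {f : V → Word A} {g : ℕ → Word A}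
    (hQ : ∀ g', (∀ n, n ≠ 1 → n ≠ 3 → g' n = g n) → g' 1 = .num (W σ T f) →
      Q f g' (enc σ G.row)) :
    wp b (weightProg T) Q f g (enc σ G.row) := by
  induction T generalizing us Q g with
  | leaf =>
    simp only [weightProg, wp, ev, Word.Fits]
    refine ⟨Nat.one_lt_two_pow (by omega), hQ _ (fun n h1 _ => ?_) ?_⟩
    · simp [h1]
    · simp [W]
  | join τ p c ihp ihc =>
    have hp : X ^ p.size < 2 ^ b :=
      (Nat.pow_le_pow_right (by omega) (by simp [JT.size])).trans_lt hb
    rw [weightProg, wp]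
    refine ihp us (fun e he => h e (by simp [JT.paths, he])) hp fun g' h1 h2 => ?_
    have hw := (weight_bound hX (JT.join τ p c) us h).1 f
    have hw' := (Nat.le_mul_of_pos_right _ (by omega : 0 < X)).trans hw
    have e3 : ((oEdge τ 4 (oKey (sep p c))).map (ev f g')) = aCap τ (key (sep p c) f) := by
      simp only [oEdge, List.map_cons, ev, map_oKey]
    rw [wp, wp, e3, enc_num _ _ (by omega), wp]
    refine ⟨W σ p f, σ (aCap τ (key (sep p c) f)), by simp [ev, h2], by simp [ev], ?_, ?_⟩
    · exact hw'.trans_lt hb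
    · refine hQ _ (fun n h3 h4 => ?_) ?_
      · simp [h3, h4, h1]
      · simp [Arith.eval, W]

end Programs

/-! ### Symbolic execution of removal from and addition to a bucket -/

section Wp2

variable {V : Type u} [Encodable V] {A : Type v} {b τ l i w w' : ℕ} {K : Finset V}
  {σ : Key A → ℕ} {row : ℕ → V → Word A} {Q : (V → Word A) → (ℕ → Word A) → Mem A → Prop}
  {f : V → Word A} {g : ℕ → Word A}

/-- The tuple number of recursion depth `l` is kept in register `l + 100`, away from the scratch
registers with small numbers, so nested updates do not disturb it. -/
theorem wp_removeProg (hi : g (l + 100) = .num i) (hw : g 2 = .num w)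
    (h1 : σ (aBl τ w (key K f)) < 2 ^ b) (h2 : σ (aPos τ i) < 2 ^ b)
    (h3 : ∀ j, σ (aBk τ w j (key K f)) < 2 ^ b)
    (hQ : ∀ g', (∀ n, n ≠ 3 → n ≠ 4 → n ≠ 5 → g' n = g n) →
      Q f g' (enc (removed τ (key K f) i w σ) row)) :
    wp b (removeProg τ K (l + 100)) Q f g (enc σ row) := by
  simp only [removeProg, wp, List.map_cons, map_oKey, ev, List.map_nil]
  simp only [removed] at hQ
  simp [hi, hw, enc_num, update_enc_num, Arith.eval, Word.Fits]
  refine ⟨(Nat.sub_le _ _).trans_lt h1, h3 _, h2, (Nat.sub_le _ _).trans_lt h1,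
    hQ _ fun n h3 h4 h5 => ?_⟩
  simp [h3, h4, h5]

theorem wp_addProg (hi : g (l + 100) = .num i) (hw : g 1 = .num w) (hw' : g 2 = .num w')
    (h1 : σ (aBl τ w (key K f)) + 1 < 2 ^ b) (h2 : i < 2 ^ b) (h3 : w < 2 ^ b)
    (h4 : σ (aCnt τ (key K f)) + w < 2 ^ b)
    (hQ : ∀ g', (∀ n, n ≠ 3 → n ≠ 4 → g' n = g n) →
      Q f g' (enc (added τ (key K f) i w w' σ) row)) :
    wp b (addProg τ K (l + 100)) Q f g (enc σ row) := by
  simp only [addProg, wp, List.map_cons, map_oKey, ev, List.map_nil]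
  simp only [added] at hQ
  simp [hi, hw, hw', enc_num, update_enc_num, Arith.eval, Word.Fits]
  refine ⟨h2, (Nat.lt_succ_self _).trans h1, h1, h3, h4, (Nat.sub_le _ _).trans_lt h4,
    hQ _ fun n h3 h4 => ?_⟩
  simp [h3, h4]

open Classical in
/-- The numbers in the memory after the tuple `i` has been moved from weight `w'` to `w`. -/
noncomputable def moved (τ : ℕ) (k : Key A) (i w w' : ℕ) (σ : Key A → ℕ) : Key A → ℕ :=
  if w = w' then σ else added τ k i w w' (if w' = 0 then σ else removed τ k i w' σ)

end Wp2

/-! ### Moving a tuple between buckets preserves the invariants of its edge -/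

section Step

variable {V : Type u} {A : Type v} {G : Ghost V A} {σ : Key A → ℕ} {ε : Edge V} {D : Set ℕ}
  {i w w' c : ℕ} {k : Key A}

open Classical in
-- Connects the memory left by the programs with `Step`: the move is a removal (unless the old
-- weight is `0`) followed by an addition, and the new capacity is written afterwards.
theorem EInv.step (h : EInv G σ ε D) (hi : G.Is i ε.c.root) (hk : key ε.K (G.row i) = k)
    (hw' : w' = σ (aWt ε.tag i)) (hle : w' ≤ w) (hc : σ (aCap ε.tag k) ≤ c)
    (hr : Rounds (σ (aCnt ε.tag k) + w - w') c) :
    Step G σ (Function.update (moved ε.tag k i w w' σ) (aCap ε.tag k) c) ε i w c k := by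
  by_cases hww : w = w'
  · subst hww
    simp only [moved, if_true]
    constructor
    · intro ad had
      rw [Function.update_of_ne]
      rintro rfl
      simp at had
    · simpa using h.buckets
    · intro j
      by_cases hj : j = i <;> simp [hj, hw']
    · simpa using h.pos_is
    · simp
    · simp
    · intro k'
      by_cases hkk : k' = k <;> simp [hkk, ← hw']
    · intro k'
      by_cases hkk : k' = k <;> simp [hkk]
    · exact hc
    · simpa using hr
    · intro ad had
      by_cases hx : ad = aCap ε.tag k
      · exact .inr (hx ▸ .cap k)
      · rw [Function.update_of_ne hx] at had
        exact .inl had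
  set σ0 := if w' = 0 then σ else removed ε.tag k i w' σ with hσ0
  have off0 : ∀ ad : Key A, ad.head? ≠ some (.num (ε.tag + 3)) → σ0 ad = σ ad := by
    intro ad had
    rw [hσ0]
    split_ifs
    · rfl
    · unfold removed
      rw [Function.update_of_ne, Function.update_of_ne, Function.update_of_ne,
        Function.update_of_ne] <;>
      · rintro rfl
        simp at had
  have wt0 : ∀ j, σ0 (aWt ε.tag j) = σ (aWt ε.tag j) := by
    intro j; rw [hσ0]; split_ifs <;> simp [removed]
  have nxt0 : ∀ j, σ0 (aNxt ε.tag j) = σ (aNxt ε.tag j) := by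
    intro j; rw [hσ0]; split_ifs <;> simp [removed]
  have head0 : ∀ j, σ0 (aHead ε.tag j) = σ (aHead ε.tag j) := by
    intro j; rw [hσ0]; split_ifs <;> simp [removed]
  have cnt0 : ∀ j, σ0 (aCnt ε.tag j) = σ (aCnt ε.tag j) := by
    intro j; rw [hσ0]; split_ifs <;> simp [removed]
  have cap0 : ∀ j, σ0 (aCap ε.tag j) = σ (aCap ε.tag j) := by
    intro j; rw [hσ0]; split_ifs <;> simp [removed]
  have supp0 : ∀ ad, σ0 ad ≠ 0 → σ ad ≠ 0 ∨ IsEAddr ε.tag ad := by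
    intro ad had
    rw [hσ0] at had
    split_ifs at had
    · exact .inl had
    · simp only [removed, Function.update_apply] at had
      split_ifs at had
      all_goals first
        | exact .inl had
        | subst ad
          exact .inr (by constructor)
  -- The removal does not touch the weight cell of `i`, so between removal and addition the buckets
  -- are valid for a weight function that is `0` at `i`, not for the stored weights.
  have bk0 : Buckets (fun i => key ε.K (G.row i)) (fun j => if j = i then 0 else σ (aWt ε.tag j))
      (fun i => σ0 (aPos ε.tag i)) (fun w k => σ0 (aBl ε.tag w k))
      (fun w j k => σ0 (aBk ε.tag w j k)) := by
    by_cases h0 : w' = 0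
    · rw [hσ0, if_pos h0]
      convert h.buckets using 2 with j
      split_ifs with hj
      · rw [hj, ← hw', h0]
      · rfl
    · rw [hσ0, if_neg h0]
      refine h.buckets.remove (i := i) (w := w') (k := k) hw'.symm h0 hk rfl rfl rfl
        (fun j => rfl) ?_ ?_ ?_
      · intro j
        simp [removed, Function.update_apply]
      · intro v k'
        simp [removed, Function.update_apply]
      · intro v j k'
        simp only [removed, Function.update_apply, List.cons.injEq, Word.num.injEq, true_and,
          reduceCtorEq, false_and, if_false, Nat.reduceEqDiff]
        congr
  have pos0 : ∀ j, σ0 (aPos ε.tag j) ≠ 0 → G.Is j ε.c.root := by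
    intro j hj
    rw [hσ0] at hj
    split_ifs at hj with h0
    · exact h.pos_is j hj
    · simp only [removed, Function.update_apply] at hj
      simp only [List.cons.injEq, Word.num.injEq, true_and, and_true, reduceCtorEq, false_and,
        and_false, if_false, Nat.reduceEqDiff] at hj
      split_ifs at hj with h1
      · have hp := h.buckets.pos_lt i (by rw [← hw']; exact h0)
        simp only [hk, ← hw'] at hp
        have := h.buckets.mem w' (σ (aBl ε.tag w' k) - 1) k (by omega)
        simp only [← h1] at this
        exact h.wt_is j (by rw [this.1]; exact h0)
      · exact h.pos_is j hj
  simp only [moved, if_neg hww, ← hσ0]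
  -- Weights never decrease, so a new weight different from the old one is positive.
  have hw0 : w ≠ 0 := by omega
  constructor
  · intro ad had
    rw [← off0 ad had]
    unfold added
    rw [Function.update_of_ne, Function.update_of_ne, Function.update_of_ne,
      Function.update_of_ne, Function.update_of_ne, Function.update_of_ne] <;>
    · rintro rfl
      simp at had
  · refine bk0.add (i := i) (w := w) (k := k) (by simp) hw0 hk rfl ?_ ?_ ?_ ?_
    · intro j
      by_cases hj : j = i <;> simp [added, hj, wt0]
    · intro j
      simp [added, Function.update_apply]
    · intro v k'
      simp [added, Function.update_apply]
    · intro v j k'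
      simp [added, Function.update_apply]
  · intro j
    by_cases hj : j = i <;> simp [added, hj, wt0]
  · intro j hj
    by_cases hji : j = i
    · exact hji ▸ hi
    · refine pos0 j ?_
      simpa [added, Function.update_apply, hji] using hj
  · intro j
    simp [added, nxt0]
  · intro j
    simp [added, head0]
  · intro k'
    by_cases hkk : k' = k <;> simp [added, hkk, cnt0, hw']
  · intro k'
    by_cases hkk : k' = k <;> simp [added, Function.update_apply, hkk, cap0]
  · exact hc
  · simpa [added, cnt0] using hr
  · intro ad had
    simp only [added, Function.update_apply] at had
    split_ifs at had
    all_goals first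
      | exact supp0 ad had
      | subst ad
        exact .inr (by constructor)

/-- Each member records its own position, so positions map injectively to tuple numbers. -/
theorem EInv.bl_le (h : EInv G σ ε D) (w : ℕ) (k : Key A) : σ (aBl ε.tag w k) ≤ G.n := by
  have h1 : ∀ j ∈ Finset.range (σ (aBl ε.tag w k)),
      σ (aBk ε.tag w j k) ∈ Finset.Icc 1 G.n := by
    intro j hj
    obtain ⟨h2, _, _, h3⟩ := h.buckets.mem w j k (Finset.mem_range.1 hj)
    have := h.wt_is _ (by rw [h2]; exact h3)
    exact Finset.mem_Icc.2 ⟨this.1, this.2.1⟩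
  have := Finset.card_le_card_of_injOn _ h1 (by
    intro j hj j' hj' hjj
    have h2 := h.buckets.mem w j k (by simpa using hj)
    have h3 := h.buckets.mem w j' k (by simpa using hj')
    have hjj : σ (aBk ε.tag w j k) = σ (aBk ε.tag w j' k) := hjj
    rw [hjj] at h2
    rw [← h2.2.1, h3.2.1])
  simpa using this

theorem EInv.bk_le (h : EInv G σ ε D) (w j : ℕ) (k : Key A) : σ (aBk ε.tag w j k) ≤ G.n := by
  by_cases hj : j < σ (aBl ε.tag w k)
  · obtain ⟨h2, _, _, h3⟩ := h.buckets.mem w j k hj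
    exact (h.wt_is _ (by rw [h2]; exact h3)).2.1
  · have := h.buckets.out w j k (not_lt.1 hj)
    omega

theorem EInv.pos_le (h : EInv G σ ε D) (j : ℕ) (hj : σ (aWt ε.tag j) ≠ 0) :
    σ (aPos ε.tag j) ≤ G.n :=
  (h.buckets.pos_lt j hj).1.le.trans (h.bl_le _ _)

end Step

/-! ### The recursive update procedure and its loop-free pieces -/

section Proc

variable {V : Type u} [Encodable V]

/-- Moves the tuple with the number in register `r` to the bucket for its current weight. Then the
new total weight is in register `4`, and a starting value for its rounding in register `5`. -/
noncomputable def updateProg (ε : Edge V) (r : ℕ) : Prog (Reg V) :=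
  .seq (loadRow r (att ε.c.root).toList) <|
  .seq (weightProg ε.c) <|
  .seq (.load (.inr 2) (oEdge ε.tag 0 [rg r])) <|
  .seq (.cond (.eq (rg 1) (rg 2)) .skip
    (.seq (.cond (.eq (rg 2) (.const 0)) .skip (removeProg ε.tag ε.K r)) (addProg ε.tag ε.K r))) <|
  .seq (.load (.inr 4) (oEdge ε.tag 3 (oKey ε.K))) <|
  .seq (.load (.inr 5) (oEdge ε.tag 4 (oKey ε.K))) <|
  .cond (.lt (rg 5) (rg 4)) (.cond (.eq (rg 5) (.const 0)) (.move (.inr 5) (.const 1)) .skip) .skip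

/-- Doubles register `5` until it is at least register `4`. -/
def doubleProg : Prog (Reg V) :=
  .loop (.lt (rg 5) (rg 4)) (.arith (.inr 5) .plus (rg 5) (rg 5))

/-- Stores the rounded total weight; if it has changed, the first parent is loaded to
register `r`. -/
noncomputable def finishProg (ε : Edge V) (r : ℕ) : Prog (Reg V) :=
  .seq (.load (.inr 6) (oEdge ε.tag 4 (oKey ε.K))) <|
  .seq (.store (oEdge ε.tag 4 (oKey ε.K)) (rg 5)) <|
  .cond (.lt (rg 6) (rg 5)) (.load (.inr r) (oEdge ε.tag 5 (oKey ε.K))) (.move (.inr r) (.const 0))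

/-- Updates the weight of the tuple with the number in register `l + 100` at the first edge of a
path to the root, and then the weights that depend on it. -/
noncomputable def proc : List (Edge V) → ℕ → Prog (Reg V)
  | [], _ => .skip
  | ε :: us, l =>
    .seq (updateProg ε (l + 100)) <| .seq doubleProg <| .seq (finishProg ε (l + 1 + 100)) <|
    .loop (.lt (.const 0) (rg (l + 1 + 100)))
      (.seq (proc us (l + 1)) (.load (.inr (l + 1 + 100)) (oEdge ε.tag 2 [rg (l + 1 + 100)])))

theorem cost_loadRow (r : ℕ) (xs : List V) : (loadRow r xs).cost = xs.length + 1 := by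
  induction xs with
  | nil => rfl
  | cons x xs ih => simp [loadRow, Prog.cost, ih]; omega

theorem cost_updateProg (ε : Edge V) (r : ℕ) :
    (updateProg ε r).cost = (updateProg ε 0).cost := by
  simp [updateProg, Prog.cost, cost_loadRow, removeProg, addProg]

omit [Encodable V] in
theorem cost_finishProg (ε : Edge V) (r : ℕ) : (finishProg ε r).cost = 5 := rfl

variable {A : Type v}

omit [Encodable V] in
theorem mem_sep {p c : JT V} {x : V} : x ∈ sep p c ↔ x ∈ att p.root ∧ x ∈ att c.root := by
  simp [sep]

omit [Encodable V] in
theorem wp_seq {b : ℕ} {c d : Prog (Reg V)} {Q : (V → Word A) → (ℕ → Word A) → Mem A → Prop}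
    {f : V → Word A} {g : ℕ → Word A} {M : Mem A} :
    wp b (.seq c d) Q f g M = wp b c (wp b d Q) f g M := rfl

omit [Encodable V] in
theorem W_agree {σ : Key A → ℕ} {T : JT V} {f f' : V → Word A}
    (h : ∀ x ∈ att T.root, f x = f' x) : W σ T f = W σ T f' := by
  induction T with
  | leaf => rfl
  | join τ p c ihp _ =>
    have : key (sep p c) f = key (sep p c) f' :=
      key_eq_iff.2 fun x hx => h x (mem_sep.1 hx).1
    rw [W, W, ihp h, this]

theorem moved_cnt {σ : Key A → ℕ} {τ i w w' : ℕ} {k : Key A} :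
    moved τ k i w w' σ (aCnt τ k) = σ (aCnt τ k) + w - w' := by
  unfold moved
  split_ifs with h h'
  · simp [h]
  · simp [added]
  · simp [added, removed]

theorem moved_cap {σ : Key A → ℕ} {τ i w w' : ℕ} {k : Key A} :
    moved τ k i w w' σ (aCap τ k) = σ (aCap τ k) := by
  unfold moved
  split_ifs with h h'
  · rfl
  · simp [added]
  · simp [added, removed]

theorem moved_head {σ : Key A → ℕ} {τ i w w' : ℕ} {k : Key A} :
    moved τ k i w w' σ (aHead τ k) = σ (aHead τ k) := by
  unfold moved
  split_ifs with h h'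
  · rfl
  · simp [added]
  · simp [added, removed]

omit [Encodable V] in
theorem JT.paths_sub (T : JT V) (us : List (Edge V)) : ∀ e ∈ T.paths us,
    (∃ us', ∀ d ∈ e.1.c.paths us', d ∈ T.paths us) ∧ e.1.c.size ≤ T.size ∧
    e.1.K = (open Classical in att e.1.par ∩ att e.1.c.root) := by
  induction T generalizing us with
  | leaf => simp [JT.paths]
  | join τ p c ihp ihc =>
    intro e he
    simp only [JT.paths, List.mem_cons, List.mem_append] at he ⊢
    simp only [JT.size]
    rcases he with rfl | he | he
    · exact ⟨⟨_, fun d hd => .inr (.inr hd)⟩, by simp, rfl⟩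
    · obtain ⟨⟨us', h⟩, h1, h2⟩ := ihp _ e he
      exact ⟨⟨us', fun d hd => .inr (.inl (h d hd))⟩, by omega, h2⟩
    · obtain ⟨⟨us', h⟩, h1, h2⟩ := ihc _ e he
      exact ⟨⟨us', fun d hd => .inr (.inr (h d hd))⟩, by omega, h2⟩

/-- The old total and the new weight are each at most `X ^ S.size`, so their sum, formed before the
old weight is subtracted, is at most twice that. The second factor of two in `hb` leaves room for
the doubling loop. -/
theorem wp_updateProg {S : JT V} {G : Ghost V A} {σ : Key A → ℕ} {D : ℕ → Set ℕ} {ε : Edge V}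
    {us : List (Edge V)} {b X i l : ℕ} (hI : Inv S G σ D) (he : (ε, us) ∈ S.paths [])
    (hX : 2 * G.n + 2 ≤ X) (hb : 4 * X ^ S.size < 2 ^ b) (hi : G.Is i ε.c.root)
    {Q : (V → Word A) → (ℕ → Word A) → Mem A → Prop} {f : V → Word A} {g : ℕ → Word A}
    (hg : g (l + 100) = .num i)
    (hQ : ∀ f' g', key ε.K f' = key ε.K (G.row i) → (∀ n, 6 ≤ n → g' n = g n) →
      g' 4 = .num (σ (aCnt ε.tag (key ε.K (G.row i))) + W σ ε.c (G.row i) - σ (aWt ε.tag i)) →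
      g' 5 = .num (if σ (aCap ε.tag (key ε.K (G.row i))) = 0 ∧
        0 < σ (aCnt ε.tag (key ε.K (G.row i))) + W σ ε.c (G.row i) - σ (aWt ε.tag i) then 1 else
        σ (aCap ε.tag (key ε.K (G.row i)))) →
      Q f' g' (enc (moved ε.tag (key ε.K (G.row i)) i (W σ ε.c (G.row i)) (σ (aWt ε.tag i)) σ)
        G.row)) :
    wp b (updateProg ε (l + 100)) Q f g (enc σ G.row) := by
  have hE := hI.edges _ he
  simp only at hE
  have hall : ∀ e ∈ S.paths [], ∃ D, EInv G σ e.1 D := fun e he => ⟨_, hI.edges e he⟩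
  obtain ⟨⟨us', hsub⟩, hsz, hK⟩ := JT.paths_sub S [] _ he
  simp only at hsub hsz hK
  obtain ⟨-, hbd⟩ := weight_bound hX S [] hall
  obtain ⟨hbw, hbc, hbW⟩ := hbd _ he
  simp only at hbw hbc hbW
  have hb1 : 1 ≤ b := by
    by_contra hc
    obtain rfl : b = 0 := by omega
    have := Nat.pow_pos (n := S.size) (by omega : 0 < X)
    omega
  have hXS : X ≤ X ^ S.size := Nat.le_self_pow (JT.size_pos S).ne' X
  set w := W σ ε.c (G.row i) with hw
  set w' := σ (aWt ε.tag i) with hw'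
  set k := key ε.K (G.row i) with hk
  have hle : w' ≤ w := hE.wt_le i hi
  have hcnt : σ (aCnt ε.tag k) ≤ X ^ S.size := (hE.cap k).le.trans (hbc k)
  have hwX := hbW i
  rw [← hw] at hwX
  rw [updateProg, wp_seq]
  refine wp_loadRow _ hg fun f' hf1 hf2 => ?_
  have hf : ∀ x ∈ att ε.c.root, f' x = G.row i x := fun x hx => hf1 x (Finset.mem_toList.2 hx)
  have hkf : key ε.K f' = k := key_eq_iff.2 fun x hx => hf x (by
    classical
    rw [hK] at hx
    exact (Finset.mem_inter.1 hx).2)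
  rw [wp_seq]
  refine wp_weightProg hX ε.c us' (fun e he => hall e (hsub e he))
    ((Nat.pow_le_pow_right (by omega) hsz).trans_lt (by omega)) hb1 fun g1 hg1 hg1' => ?_
  rw [W_agree hf, ← hw] at hg1'
  have hgl : g1 (l + 100) = .num i := by rw [hg1 _ (by omega) (by omega), hg]
  rw [wp_seq, wp]
  simp only [oEdge, List.map_cons, List.map_nil, ev, hgl]
  rw [enc_num _ _ (by omega), ← hw']
  -- The common continuation of the three branches: weight unchanged, old weight zero, old weight
  -- positive.
  have tail : ∀ g2 : ℕ → Word A, (∀ n, 6 ≤ n → g2 n = g n) →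
      wp b (.seq (.load (.inr 4) (oEdge ε.tag 3 (oKey ε.K))) <|
        .seq (.load (.inr 5) (oEdge ε.tag 4 (oKey ε.K))) <|
        .cond (.lt (rg 5) (rg 4)) (.cond (.eq (rg 5) (.const 0)) (.move (.inr 5) (.const 1)) .skip)
          .skip) Q f' g2 (enc (moved ε.tag k i w w' σ) G.row) := by
    intro g2 hg2
    simp only [wp, oEdge, List.map_cons, map_oKey, ev, hkf]
    rw [enc_num _ _ (by omega), enc_num _ _ (by omega), moved_cnt, moved_cap]
    refine ⟨σ (aCap ε.tag k), σ (aCnt ε.tag k) + w - w', by simp, by simp, fun hlt =>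
      ⟨fun h0 => ⟨Nat.one_lt_two_pow (by omega), ?_⟩, fun h0 => ?_⟩, fun hlt => ?_⟩
    · have h0' : σ (aCap ε.tag k) = 0 := by simpa using h0
      refine hQ _ _ hkf (fun n hn => ?_) ?_ ?_
      · rw [Function.update_of_ne (by omega), Function.update_of_ne (by omega),
          Function.update_of_ne (by omega), hg2 n hn]
      · simp
      · rw [if_pos ⟨h0', by omega⟩]
        simp
    · have h0' : σ (aCap ε.tag k) ≠ 0 := by simpa using h0
      refine hQ _ _ hkf (fun n hn => ?_) ?_ ?_
      · rw [Function.update_of_ne (by omega), Function.update_of_ne (by omega), hg2 n hn]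
      · simp
      · rw [if_neg (by tauto)]
        simp
    · refine hQ _ _ hkf (fun n hn => ?_) ?_ ?_
      · rw [Function.update_of_ne (by omega), Function.update_of_ne (by omega), hg2 n hn]
      · simp
      · rw [if_neg (by omega)]
        simp
  rw [wp_seq, wp]
  set g2 := Function.update g1 2 (.num w') with hg2
  have hg22 : g2 2 = .num w' := by simp [hg2]
  have hg21 : g2 1 = .num w := by simp [hg2, hg1']
  have hg2n : ∀ n, 6 ≤ n → g2 n = g n := fun n hn => by
    rw [hg2, Function.update_of_ne (by omega), hg1 n (by omega) (by omega)]
  have hg2l : g2 (l + 100) = .num i := by rw [hg2n _ (by omega), hg]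
  simp only [ev, hg22, hg21]
  refine ⟨fun h => ?_, fun h => ?_⟩
  · have h : w = w' := by simpa using h
    have := tail g2 hg2n
    rw [moved, if_pos h] at this
    exact this
  · have h : w ≠ w' := by simpa using h
    have tail' := tail
    simp only [moved, if_neg h] at tail'
    have hn : G.n < 2 ^ b := by omega
    have hin : i ≤ G.n := hi.2.1
    rw [wp_seq, wp]
    simp only [ev, hg22]
    refine ⟨fun h0 => ?_, fun h0 => ?_⟩
    · have h0 : w' = 0 := by simpa using h0
      rw [if_pos h0, ← hkf] at tail'
      refine wp_addProg hg2l hg21 hg22 ((Nat.succ_le_succ (hE.bl_le _ _)).trans_lt (by omega))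
        (by omega) (by omega) (by rw [hkf]; omega) fun g3 hg3 => tail' g3 fun n hn => ?_
      rw [hg3 n (by omega) (by omega), hg2n n hn]
    · have h0 : w' ≠ 0 := by simpa using h0
      rw [if_neg h0, ← hkf] at tail'
      refine wp_removeProg hg2l hg22 ((hE.bl_le _ _).trans_lt hn) ((hE.pos_le i h0).trans_lt hn)
        (fun j => (hE.bk_le _ _ _).trans_lt hn) fun g3 hg3 => ?_
      have hg3l : g3 (l + 100) = .num i := by
        rw [hg3 _ (by omega) (by omega) (by omega), hg2l]
      have hc : removed ε.tag (key ε.K f') i w' σ (aCnt ε.tag (key ε.K f')) =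
          σ (aCnt ε.tag (key ε.K f')) := by simp [removed]
      have hbl : removed ε.tag (key ε.K f') i w' σ (aBl ε.tag w (key ε.K f')) =
          σ (aBl ε.tag w (key ε.K f')) := by simp [removed, h]
      refine wp_addProg hg3l (by rw [hg3 _ (by omega) (by omega) (by omega), hg21])
        (by rw [hg3 _ (by omega) (by omega) (by omega), hg22]) ?_
        (by omega) (by omega) (by rw [hc, hkf]; omega) fun g4 hg4 => tail' g4 fun n hn => ?_
      · rw [hbl]
        exact (Nat.succ_le_succ (hE.bl_le _ _)).trans_lt (by omega)
      · rw [hg4 n (by omega) (by omega), hg3 n (by omega) (by omega) (by omega), hg2n n hn]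

omit [Encodable V] in
theorem Runs.load {L : Limits} {n : ℕ} {a : List (Operand (Reg V))} {f : V → Word A}
    {g : ℕ → Word A} {M : Mem A} {Q : ℕ → (V → Word A) → (ℕ → Word A) → Mem A → Prop}
    (h : Q 1 f (Function.update g n (M (a.map (ev f g)))) M) :
    Runs L (.load (.inr n) a) f g M Q := by
  refine ⟨1, f, _, M, ?_, h⟩
  rw [← setReg_inr, ← eval_eq_ev]
  exact .load _ _ _

omit [Encodable V] in
-- The last doubling starts below `m`, so the result is less than `2 * m` unless no doubling takes
-- place. `hc` excludes the start at `0`, from which doubling makes no progress; `d` only serves as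
-- a measure for the induction.
theorem runs_doubleProg {L : Limits} {f : V → Word A} {M : Mem A}
    {Q : ℕ → (V → Word A) → (ℕ → Word A) → Mem A → Prop} {m c : ℕ} (hm : 2 * m < 2 ^ L.bits)
    (hc : 0 < c ∨ m = 0) (d : ℕ) (hd : m ≤ c + d) (g : ℕ → Word A) (h4 : g 4 = .num m)
    (h5 : g 5 = .num c)
    (hQ : ∀ e g', (∀ n, n ≠ 5 → g' n = g n) → g' 5 = .num (2 ^ e * c) → m ≤ 2 ^ e * c →
      (e = 0 ∨ 2 ^ e * c < 2 * m) → Q (2 * e + 1) f g' M) :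
    Runs L doubleProg f g M Q := by
  induction d using Nat.strong_induction_on generalizing c g Q with
  | _ d ih =>
    rcases lt_or_ge c m with hcm | hcm
    · refine Runs.loop_true (m := c) (n := m) (by simp [ev, h5]) (by simp [ev, h4]) hcm ?_
      have hx : Arith.eval .plus c c < 2 ^ L.bits := by simp only [Arith.eval]; omega
      refine ⟨1, f, Function.update g 5 (.num (c + c)), M, ?_, ?_⟩
      · rw [← setReg_inr]
        exact .arith _ _ _ _ _ c c (by simp [eval_eq_ev, ev, h5]) (by simp [eval_eq_ev, ev, h5]) hx
      · refine ih (d - c) (by omega) (c := c + c) (by omega) (by omega) _ (by simp [h4])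
          (by simp) fun e g' h1 h2 h3 h6 => ?_
        have e2 : 2 ^ (e + 1) * c = 2 ^ e * (c + c) := by ring
        have := hQ (e + 1) g' (fun n hn => by rw [h1 n hn, Function.update_of_ne hn])
          (by rw [e2, h2]) (by rw [e2]; exact h3) (.inr (by
            rw [e2]
            rcases h6 with rfl | h6
            · omega
            · exact h6))
        rwa [show 1 + (2 * e + 1) + 1 = 2 * (e + 1) + 1 by ring]
    · exact Runs.loop_false (m := c) (n := m) (by simp [ev, h5]) (by simp [ev, h4]) (by omega)
        (by simpa using hQ 0 g (fun _ _ => rfl) (by simpa using h5) (by simpa using hcm) (.inl rfl))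

end Proc

/-! ### Amortized analysis of the update procedure -/

section ProcSpec

variable {V : Type u} [Encodable V] {A : Type v}

theorem Inv.mono {S : JT V} {G : Ghost V A} {σ : Key A → ℕ} {D D' : ℕ → Set ℕ} (h : Inv S G σ D)
    (hD : ∀ e ∈ S.paths [], ∀ i, G.Is i e.1.c.root → i ∈ D e.1.tag → i ∈ D' e.1.tag) :
    Inv S G σ D' :=
  { h with
    edges := fun e he => (h.edges e he).frame (fun _ _ => rfl) (fun _ _ => le_rfl)
      fun i hi hiD => ⟨fun hc => hiD (hD e he i hi hc), rfl⟩ }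

/-- The limits suffice for databases of at most `N` tuples. -/
structure Enough [Fintype V] (S : JT V) (L : Limits) (N : ℕ) : Prop where
  bits : 4 * (2 * N + 2) ^ S.size < 2 ^ L.bits
  cells : ∀ e ∈ S.paths [], 1 + N * (Fintype.card V + 1 + 8 * (S.paths []).length) +
    (updateProg e.1 0).cost + 5 ≤ L.cells

/-- The result of an update in the state `σ` after `k` steps. -/
def Updated (S : JT V) (G : Ghost V A) (σ : Key A → ℕ) (D : ℕ → Set ℕ) (l a b : ℕ)
    (g : ℕ → Word A) (k : ℕ) (g' : ℕ → Word A) (M' : Mem A) : Prop :=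
  ∃ σ', M' = enc σ' G.row ∧ Inv S G σ' D ∧ (∀ n ≤ l, g' (n + 100) = g (n + 100)) ∧
    (∀ τ j, σ' (aNxt τ j) = σ (aNxt τ j)) ∧ potential S G σ ≤ potential S G σ' ∧
    k + a * potential S G σ ≤ b + a * potential S G σ'

/-- The body preserves the successor pointers and the register of the current entry, so the list can
be followed while the structure changes. Each entry costs `a` amortized for `P`, plus one step for
the test and one for loading the successor; the last `1` is the final test. -/
theorem runs_walk {S : JT V} {G : Ghost V A} {L : Limits} {P : Prog (Reg V)} {l a τ τ' : ℕ}
    {all : Set ℕ}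
    (hP : ∀ σ D f g j, Inv S G σ D → j ∈ all → g (l + 1 + 100) = .num j →
      Runs L P f g (enc σ G.row) fun k _ g' M' =>
        Updated S G σ (fun t => D t \ if t = τ' then {j} else ∅) (l + 1) a a g k g' M')
    (ll : List ℕ) (σ : Key A → ℕ) (D : ℕ → Set ℕ) (f : V → Word A) (g : ℕ → Word A) (cur : ℕ)
    (hI : Inv S G σ D) (hll : ∀ j ∈ ll, j ∈ all)
    (hl : Linked (fun i => σ (aNxt τ i)) cur ll) (hg : g (l + 1 + 100) = .num cur) :
    Runs L (.loop (.lt (.const 0) (rg (l + 1 + 100)))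
      (.seq P (.load (.inr (l + 1 + 100)) (oEdge τ 2 [rg (l + 1 + 100)])))) f g (enc σ G.row)
      fun k _ g' M' => Updated S G σ (fun t => D t \ if t = τ' then {j | j ∈ ll} else ∅) l a
        ((a + 2) * ll.length + 1) g k g' M' := by
  induction ll generalizing σ D f g cur with
  | nil =>
    cases hl
    refine Runs.loop_false (m := 0) (n := 0) rfl (by simp [ev, hg]) (by omega) ?_
    exact ⟨σ, rfl, hI.mono (by simp), fun _ _ => rfl, fun _ _ => rfl, le_rfl, by simp⟩
  | cons j ll ih =>
    cases hl with
    | cons _ _ h0 hl =>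
    refine Runs.loop_true (m := 0) (n := j) rfl (by simp [ev, hg]) (by omega) ?_
    refine Runs.seq ((hP σ D f g j hI (hll _ (by simp)) hg).mono ?_)
    rintro k f1 g1 M1 ⟨σ1, rfl, hI1, hg1, hn1, hp1, hk1⟩
    refine Runs.load ?_
    have hcur : g1 (l + 1 + 100) = .num j := by rw [hg1 _ le_rfl, hg]
    simp only [oEdge, List.map_cons, List.map_nil, ev, hcur]
    rw [enc_num _ _ (by omega)]
    refine (ih σ1 _ f1 _ (σ1 (aNxt τ j)) hI1 (fun j hj => hll j (by simp [hj])) ?_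
      (by simp)).mono ?_
    · rw [hn1]
      exact hl.congr fun i _ => hn1 _ _
    · rintro k2 f2 g2 M2 ⟨σ2, rfl, hI2, hg2, hn2, hp2, hk2⟩
      refine ⟨σ2, rfl, hI2.mono ?_, fun n hn => ?_, fun t i => (hn2 t i).trans (hn1 t i),
        hp1.trans hp2, ?_⟩
      · rintro e - i -
        by_cases ht : e.1.tag = τ'
        · simp [ht]
          tauto
        · simp [ht]
      · rw [hg2 n hn, Function.update_of_ne (by omega), hg1 n (by omega)]
      · rw [List.length_cons]
        nlinarith

/-- The factor for the number of steps of `proc`. -/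
noncomputable def procCost : List (Edge V) → ℕ
  | [] => 0
  | ε :: us => procCost us + (updateProg ε 0).cost + 9

theorem size_two_pow_mul {c : ℕ} (hc : 0 < c) (e : ℕ) : (2 ^ e * c).size = e + c.size := by
  have := Nat.size_shiftLeft (m := c) hc.ne' e
  rw [Nat.shiftLeft_eq, Nat.mul_comm] at this
  omega

theorem moved_nxt {σ : Key A → ℕ} {τ i w w' j : ℕ} {k : Key A} {τ' : ℕ} :
    moved τ k i w w' σ (aNxt τ' j) = σ (aNxt τ' j) := by
  unfold moved
  split_ifs with h h'
  · rfl
  · simp [added]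
  · simp [added, removed]

theorem add_le_mul_one_add {d p : ℕ} (hd : 1 ≤ d) : d + p ≤ d * (1 + p) := by
  nlinarith

/-- The gain `e + n` of potential, multiplied by `a + u + 9`, covers two steps for each of the `e`
doublings and `a + 2` steps for each of the `n` parents; the remaining steps are bounded by a
constant. -/
theorem time_bound {a u k1 e k3 k4 p p2 p4 n : ℕ} (h1 : k1 ≤ u) (h3 : k3 ≤ 5)
    (h4 : k4 + a * p2 ≤ (a + 2) * n + 1 + a * p4) (h5 : p + (e + n) ≤ p2) (h6 : p2 ≤ p4) :
    k1 + (2 * e + 1 + (k3 + k4)) + (a + u + 9) * p ≤ (a + u + 9) + (a + u + 9) * p4 := by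
  obtain ⟨x, rfl⟩ := Nat.exists_eq_add_of_le h5
  obtain ⟨y, rfl⟩ := Nat.exists_eq_add_of_le h6
  nlinarith [Nat.zero_le (a * x), Nat.zero_le (a * y), Nat.zero_le (u * e), Nat.zero_le (u * n),
    Nat.zero_le (u * x), Nat.zero_le (u * y), Nat.zero_le (a * e)]

/-- One level of the recursion: after the update at `ε` exactly the parents in the matching list may
be newly outdated, and `hP` repairs them one after the other at the next edge towards the root. -/
theorem runs_proc_cons [Fintype V] {S : JT V} (hS : S.tags.Nodup) {L : Limits}
    {N : ℕ} (hL : Enough S L N) {G : Ghost V A} (hN : G.n ≤ N) (us : List (Edge V)) (ε : Edge V)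
    (he : (ε, us) ∈ S.paths []) (l : ℕ) (σ : Key A → ℕ) (D : ℕ → Set ℕ) (f : V → Word A)
    (g : ℕ → Word A) (i : ℕ) (hI : Inv S G σ D) (hi : G.Is i ε.c.root)
    (hg : g (l + 100) = .num i) {τ' : ℕ} (hτ' : ∀ ε' us', us = ε' :: us' → ε'.tag = τ')
    (hP : ∀ σ D f g j, Inv S G σ D → j ∈ {j | G.Is j ε.par} → g (l + 1 + 100) = .num j →
      Runs L (proc us (l + 1)) f g (enc σ G.row) fun k _ g' M' =>
        Updated S G σ (fun t => D t \ if t = τ' then {j} else ∅) (l + 1) (procCost us)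
          (procCost us) g k g' M') :
    Runs L (proc (ε :: us) l) f g (enc σ G.row) fun k _ g' M' =>
      Updated S G σ (fun t => D t \ if t = ε.tag then {i} else ∅) l (procCost (ε :: us))
        (procCost (ε :: us)) g k g' M' := by
  classical
  have hE := hI.edges _ he
  simp only at hE
  have hall : ∀ e ∈ S.paths [], ∃ D, EInv G σ e.1 D := fun e he => ⟨_, hI.edges e he⟩
  have hX : 2 * G.n + 2 ≤ 2 * N + 2 := by omega
  obtain ⟨hbw, hbc, hbW⟩ := (weight_bound hX S [] hall).2 _ he
  simp only at hbw hbc hbW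
  set X := (2 * N + 2) ^ S.size with hXdef
  have hbits := hL.bits
  rw [← hXdef] at hbits
  have hX1 : 1 ≤ X := Nat.one_le_pow _ _ (by omega)
  set w := W σ ε.c (G.row i) with hw
  set w' := σ (aWt ε.tag i) with hw'
  set k := key ε.K (G.row i) with hk
  have hle : w' ≤ w := hE.wt_le i hi
  have hcap := hE.cap k
  have hcnt : σ (aCnt ε.tag k) ≤ X := hcap.le.trans (hbc k)
  have hwX : w ≤ X := hbW i
  set m := σ (aCnt ε.tag k) + w - w' with hm
  -- The rounding starts from the old capacity, which keeps capacities monotone, except that an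
  -- empty group receiving positive weight starts at `1`.
  set c0 := if σ (aCap ε.tag k) = 0 ∧ 0 < m then 1 else σ (aCap ε.tag k) with hc0
  set S0 := 1 + G.n * (Fintype.card V + 1 + 8 * (S.paths []).length) with hS0
  have hcells : S0 + (updateProg ε 0).cost + 5 ≤ L.cells := by
    have h1 := hL.cells _ he
    have h2 := Nat.mul_le_mul_right (Fintype.card V + 1 + 8 * (S.paths []).length) hN
    simp only at h1
    omega
  obtain ⟨par, hpn, hpl, hpm⟩ := hE.par k
  rw [proc]
  refine Runs.seq (Runs.mono (wp.runs (S := S0) (Q := fun f' g' M' => key ε.K f' = k ∧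
    (∀ n, 6 ≤ n → g' n = g n) ∧ g' 4 = .num m ∧ g' 5 = .num c0 ∧
    M' = enc (moved ε.tag k i w w' σ) G.row) ?_ hI.space_le
    (by rw [cost_updateProg]; omega)) ?_)
  · exact wp_updateProg hI he hX hbits hi hg fun f' g' h1 h2 h3 h4 => ⟨h1, h2, h3, h4, rfl⟩
  rintro k1 f1 g1 M1 ⟨hk1, hsp, hf1, hg1, hg14, hg15, rfl⟩
  rw [cost_updateProg] at hk1 hsp
  refine Runs.seq (runs_doubleProg (m := m) (c := c0) (by omega) ?_ m (by omega) g1 hg14 hg15 ?_)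
  · rw [hc0]
    split_ifs <;> omega
  intro e g2 hg2 hg25 hmc hlt
  set c := 2 ^ e * c0 with hc
  have hcap_le : σ (aCap ε.tag k) ≤ c0 := by
    rw [hc0]
    split_ifs <;> omega
  have hc0c : c0 ≤ c := Nat.le_mul_of_pos_left _ (Nat.two_pow_pos e)
  have hcX : c < 2 ^ L.bits := by
    rcases hlt with h0 | h0
    · rw [hc, h0, hc0]
      have := hbc k
      split_ifs <;> omega
    · omega
  have hr : Rounds m c := by
    refine ⟨hmc, ?_⟩
    by_cases h0 : σ (aCap ε.tag k) = 0
    · by_cases h1 : 0 < m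
      · have hc01 : c0 = 1 := by rw [hc0, if_pos ⟨h0, h1⟩]
        refine .inr ⟨⟨e, by rw [hc, hc01, Nat.mul_one]⟩, ?_⟩
        rcases hlt with h2 | h2
        · rw [hc, h2, hc01]
          omega
        · exact h2
      · left
        rw [hc, hc0, if_neg (by tauto), h0, Nat.mul_zero]
    · obtain ⟨⟨e0, h1⟩, h2⟩ := hcap.pow.resolve_left h0
      have hc01 : c0 = σ (aCap ε.tag k) := by rw [hc0, if_neg (by tauto)]
      refine .inr ⟨⟨e + e0, by rw [hc, hc01, h1, pow_add]⟩, ?_⟩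
      rcases hlt with h3 | h3
      · rw [hc, h3, hc01]
        omega
      · exact h3
  have hstep := hE.step hi hk.symm hw' hle (hcap_le.trans hc0c) hr
  -- Each doubling of a positive number adds one bit. If `c0 = 0`, then `m = 0` and nothing is
  -- doubled.
  have hsize : e ≤ c.size - (σ (aCap ε.tag k)).size := by
    rcases Nat.eq_zero_or_pos c0 with h0 | h0
    · have : e = 0 := by
        rcases hlt with h1 | h1
        · exact h1
        · have : m = 0 := by
            rw [hc0] at h0
            split_ifs at h0 with h2
            omega
          omega
      omega
    · rw [hc, size_two_pow_mul h0]
      have := Nat.size_le_size hcap_le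
      omega
  set σ2 := Function.update (moved ε.tag k i w w' σ) (aCap ε.tag k) c with hσ2
  -- The parents are visited only if the capacity has grown; otherwise the walk starts at the null
  -- pointer.
  set hd := if σ (aCap ε.tag k) < c then σ (aHead ε.tag k) else 0 with hhd
  set ll := if σ (aCap ε.tag k) < c then par else [] with hll
  refine Runs.seq (Runs.mono (wp.runs (S := S0 + (updateProg ε 0).cost)
    (Q := fun f' g' M' => (∀ n, n ≠ 6 → n ≠ l + 1 + 100 → g' n = g2 n) ∧
      g' (l + 1 + 100) = .num hd ∧ M' = enc σ2 G.row) ?_ hsp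
    (by rw [cost_finishProg]; omega)) ?_)
  · simp only [finishProg, wp, oEdge, List.map_cons, map_oKey, ev, hf1]
    rw [enc_num _ _ (by omega), moved_cap]
    have h5 : Function.update g2 6 (Word.num (σ (aCap ε.tag k))) 5 = .num c := by
      rw [Function.update_of_ne (by omega), hg25]
    rw [h5, update_enc_num _ _ (by omega)]
    refine ⟨hcX, σ (aCap ε.tag k), c, by simp, rfl, fun h => ⟨fun n h6 hn => ?_, ?_, rfl⟩,
      fun h => ⟨Nat.two_pow_pos _, fun n h6 hn => ?_, ?_, rfl⟩⟩
    · rw [Function.update_of_ne hn, Function.update_of_ne h6]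
    · rw [Function.update_self, enc_num _ _ (by omega), hhd, if_pos h,
        Function.update_of_ne (by simp), moved_head]
    · rw [Function.update_of_ne hn, Function.update_of_ne h6]
    · rw [Function.update_self, hhd, if_neg h]
  rintro k3 f3 g3 M3 ⟨hk3, -, hg3, hg3l, rfl⟩
  rw [cost_finishProg] at hk3
  have hI2 : Inv S G σ2 (fun t => (D t \ if t = ε.tag then {i} else ∅) ∪
      if t = τ' then {j | j ∈ ll} else ∅) := by
    refine hstep.inv hS hI he hi hk.symm hw (fun t => Set.subset_union_left) ?_
    intro hne ε' us' hus j hj hjk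
    right
    rw [if_pos (hτ' _ _ hus), hll, if_pos (by omega)]
    exact (hpm j).2 ⟨hj, hjk⟩
  have hpot := hstep.potential_le he hi hk.symm hpn fun j hj => (hpm j).1 hj
  refine (runs_walk hP ll σ2 _ f3 g3 hd hI2 ?_ ?_ hg3l).mono ?_
  · intro j hj
    rw [hll] at hj
    split_ifs at hj
    · exact ((hpm j).1 hj).1
    · simp at hj
  · have : (fun i => σ2 (aNxt ε.tag i)) = fun i => σ (aNxt ε.tag i) := funext hstep.nxt
    rw [this, hll, hhd]
    split_ifs
    · exact hpl
    · exact .nil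
  rintro k4 f4 g4 M4 ⟨σ4, rfl, hI4, hg4, hn4, hp4, hk4⟩
  refine ⟨σ4, rfl, hI4.mono ?_, fun n hn => ?_, fun t j => ?_, ?_, ?_⟩
  · rintro e' - j -
    simp only [Set.mem_sdiff, Set.mem_union]
    tauto
  · rw [hg4 n hn, hg3 _ (by omega) (by omega), hg2 _ (by omega), hg1 _ (by omega)]
  · rw [hn4, hσ2, Function.update_of_ne (by simp), moved_nxt]
  · refine le_trans ?_ hp4
    omega
  -- A visit to the parents is paid for because growth adds at least one bit. This includes growth
  -- without doubling, which is the passage from `0` to `1`.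
  · have h1 : (c.size - (σ (aCap ε.tag k)).size) + ll.length ≤
        (c.size - (σ (aCap ε.tag k)).size) * (1 + par.length) := by
      rw [hll]
      split_ifs with h
      · refine add_le_mul_one_add ?_
        rcases Nat.eq_zero_or_pos e with he0 | he0
        · have hcc : c = c0 := by rw [hc, he0, pow_zero, Nat.one_mul]
          rw [hcc, hc0] at h ⊢
          split_ifs at h ⊢ with h0
          · simp [h0.1]
          · omega
        · omega
      · rw [List.length_nil, Nat.add_zero]
        exact Nat.le_mul_of_pos_right _ (by omega)
    have h2 : potential S G σ + (e + ll.length) ≤ potential S G σ2 := by omega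
    rw [procCost]
    exact time_bound hk1 hk3 hk4 h2 hp4

theorem runs_proc [Fintype V] {S : JT V} (hS : S.tags.Nodup) (hroot : S.root = none) {L : Limits}
    {N : ℕ} (hL : Enough S L N) {G : Ghost V A} (hN : G.n ≤ N) (us : List (Edge V)) (ε : Edge V)
    (he : (ε, us) ∈ S.paths []) (l : ℕ) (σ : Key A → ℕ) (D : ℕ → Set ℕ) (f : V → Word A)
    (g : ℕ → Word A) (i : ℕ) (hI : Inv S G σ D) (hi : G.Is i ε.c.root)
    (hg : g (l + 100) = .num i) :
    Runs L (proc (ε :: us) l) f g (enc σ G.row) fun k _ g' M' =>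
      Updated S G σ (fun t => D t \ if t = ε.tag then {i} else ∅) l (procCost (ε :: us))
        (procCost (ε :: us)) g k g' M' := by
  induction us generalizing ε l σ D f g i with
  | nil =>
    -- On an edge at the top, the parent is the additional root, which has no tuples; the assumption
    -- on the recursive calls is vacuous and the tag `0` is arbitrary.
    refine runs_proc_cons hS hL hN [] ε he l σ D f g i hI hi hg (τ' := 0) (by simp) ?_
    intro σ D f g j hI hj
    rcases JT.paths_snd S [] _ he with ⟨-, h⟩ | ⟨d, -, h, -⟩
    · exact (hI.lab j _ hj (h.trans hroot)).elim
    · simp at h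
  | cons ε' us ih =>
    rcases JT.paths_snd S [] _ he with ⟨h, -⟩ | ⟨d, hd, h, h'⟩
    · simp at h
    · simp only [List.cons.injEq] at h h'
      obtain ⟨rfl, rfl⟩ := h
      refine runs_proc_cons hS hL hN _ ε he l σ D f g i hI hi hg (τ' := d.1.tag) ?_ ?_
      · rintro ε' us' h
        simp only [List.cons.injEq] at h
        rw [h.1]
      · intro σ D f g j hI hj hg
        exact ih d.1 hd (l + 1) σ D f g j hI (h' ▸ hj) hg

end ProcSpec

/-! ## Insertion of a tuple -/

section Insert

variable {V : Type u} [Encodable V]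

/-- Stores the values of the attribute registers for the tuple with the number in register `1`. -/
noncomputable def storeRow : List V → Prog (Reg V)
  | [] => .skip
  | x :: xs => .seq (.store [.const 1, rg 1, .const (Encodable.encode x)] (.reg (.inl x)))
      (storeRow xs)

/-- Adds the tuple with the number in register `100` to the lists of parents. -/
noncomputable def linkProg : List (Edge V) → Prog (Reg V)
  | [] => .skip
  | ε :: es => .seq (.load (.inr 2) (oEdge ε.tag 5 (oKey ε.K))) <|
      .seq (.store (oEdge ε.tag 2 [rg 100]) (rg 2)) <|
      .seq (.store (oEdge ε.tag 5 (oKey ε.K)) (rg 100)) (linkProg es)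

/-- Adds the tuple in the attribute registers to the database. -/
noncomputable def allocProg (a : Lab V) : Prog (Reg V) :=
  .seq (.load (.inr 1) [.const 0]) <|
  .seq (.arith (.inr 1) .plus (rg 1) (.const 1)) <|
  .seq (.store [.const 0] (rg 1)) <|
  .seq (.store (.const 2 :: .const (Encodable.encode a) :: oKey (att a)) (rg 1)) <|
  .seq (.move (.inr 100) (rg 1)) (storeRow (att a).toList)

open Classical in
/-- The edges from the nodes with label `a` to their children. -/
noncomputable def edgesBelow (S : JT V) (a : Lab V) : List (Edge V) :=
  ((S.paths []).map Prod.fst).filter fun ε => ε.par = a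

/-- Executes `proc` for a list of paths. -/
noncomputable def procs : List (Edge V × List (Edge V)) → Prog (Reg V)
  | [] => .skip
  | e :: es => .seq (proc (e.1 :: e.2) 0) (procs es)

/-- Adds the tuple in the attribute registers to the database and to the lists of parents. -/
noncomputable def prepareProg (S : JT V) (a : Lab V) : Prog (Reg V) :=
  .seq (allocProg a) (linkProg (edgesBelow S a))

open Classical in
/-- Insertion of the tuple in the attribute registers into the relation `a`. -/
noncomputable def insertProg (S : JT V) (a : Lab V) : Prog (Reg V) :=
  .seq (.load (.inr 1) (.const 2 :: .const (Encodable.encode a) :: oKey (att a))) <|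
  .cond (.eq (rg 1) (.const 0))
    (.seq (prepareProg S a) (procs ((S.paths []).filter fun e => e.1.c.root = a)))
    .skip

variable {A : Type v}

open Classical in
/-- The database with one more tuple `f` in relation `a`. -/
noncomputable def Ghost.add (G : Ghost V A) (a : Lab V) (f : V → Word A) : Ghost V A where
  n := G.n + 1
  rel := Function.update G.rel (G.n + 1) a
  row := Function.update G.row (G.n + 1) fun x => if x ∈ att a then f x else .num 0

/-- The tuple number `i` with the values `f` has been added to the lists of parents for the edges
`es`. -/
structure LinkStep (σ σ' : Key A → ℕ) (es : List (Edge V)) (f : V → Word A) (i : ℕ) : Prop where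
  head : ∀ ε ∈ es, ∀ k, σ' (aHead ε.tag k) =
    open Classical in if k = key ε.K f then i else σ (aHead ε.tag k)
  nxt : ∀ ε ∈ es, ∀ j, σ' (aNxt ε.tag j) =
    if j = i then σ (aHead ε.tag (key ε.K f)) else σ (aNxt ε.tag j)
  off : ∀ ad, (∀ ε ∈ es, ad ≠ aHead ε.tag (key ε.K f) ∧ ad ≠ aNxt ε.tag i) → σ' ad = σ ad

/-- The tuple is prepended to one list per edge. Distinct tags mean distinct cells, so the edges do
not interfere. -/
theorem wp_linkProg {b i : ℕ} {row : ℕ → V → Word A} (hib : i < 2 ^ b) {f : V → Word A}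
    (es : List (Edge V)) (hes : (es.map Edge.tag).Nodup) {σ : Key A → ℕ}
    (hσ : ∀ ε ∈ es, σ (aHead ε.tag (key ε.K f)) < 2 ^ b)
    {Q : (V → Word A) → (ℕ → Word A) → Mem A → Prop} {g : ℕ → Word A} (hg : g 100 = .num i)
    (hQ : ∀ g' σ', g' 100 = .num i → LinkStep σ σ' es f i → Q f g' (enc σ' row)) :
    wp b (linkProg es) Q f g (enc σ row) := by
  classical
  induction es generalizing σ g with
  | nil => exact hQ g σ hg ⟨by simp, by simp, fun _ _ => rfl⟩
  | cons ε es ih =>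
    simp only [List.map_cons, List.nodup_cons, List.mem_map, not_exists, not_and] at hes
    simp only [linkProg, wp, oEdge, List.map_cons, map_oKey, List.map_nil, ev]
    simp only [ne_eq, Nat.reduceEqDiff, not_false_eq_true, Function.update_of_ne, hg,
      Function.update_self]
    rw [enc_num _ _ (by omega), update_enc_num _ _ (by omega), update_enc_num _ _ (by omega)]
    have hne : ∀ ε' ∈ es, ε'.tag ≠ ε.tag := fun ε' h' h => hes.1 ε' h' h
    refine ⟨hσ ε (by simp), hib, ih hes.2 ?_ (by simp [hg]) fun g' σ' hg' h => hQ g' σ' hg' ?_⟩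
    · intro ε' h'
      have := hσ ε' (by simp [h'])
      rw [Function.update_of_ne (by simp [hne ε' h']), Function.update_of_ne (by simp)]
      exact this
    · have off : ∀ ad, ad.head? = some (Word.num (ε.tag + 3)) → σ' ad = _ := fun ad had =>
        h.off ad fun ε' h' => by
          constructor <;>
          · rintro rfl
            simp [hne ε' h'] at had
      constructor
      · intro ε' h' k
        rcases List.mem_cons.1 h' with rfl | h'
        · rw [off _ (by simp)]
          by_cases hk : k = key ε'.K f <;> simp [hk]
        · rw [h.head ε' h' k]
          simp [hne ε' h']
      · intro ε' h' j
        rcases List.mem_cons.1 h' with rfl | h'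
        · rw [off _ (by simp)]
          by_cases hj : j = i <;> simp [hj]
        · rw [h.nxt ε' h' j]
          simp [hne ε' h']
      · intro ad had
        rw [h.off ad fun ε' h' => had ε' (by simp [h'])]
        obtain ⟨h1, h2⟩ := had ε (by simp)
        rw [Function.update_of_ne h1, Function.update_of_ne h2]

theorem wp_storeRow {b i : ℕ} {σ : Key A → ℕ} (xs : List V) {row : ℕ → V → Word A}
    {f : V → Word A} (hf : ∀ x ∈ xs, (f x).Fits b)
    {Q : (V → Word A) → (ℕ → Word A) → Mem A → Prop} {g : ℕ → Word A} (hg : g 1 = .num i)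
    (hQ : Q f g (enc σ (open Classical in
      Function.update row i fun x => if x ∈ xs then f x else row i x))) :
    wp b (storeRow xs) Q f g (enc σ row) := by
  classical
  induction xs generalizing row with
  | nil =>
    rw [storeRow]
    simpa [wp] using hQ
  | cons x xs ih =>
    simp only [storeRow, wp, List.map_cons, List.map_nil, ev, hg]
    refine ⟨hf x (by simp), ?_⟩
    rw [update_enc_row]
    refine ih (fun y hy => hf y (by simp [hy])) ?_
    convert hQ using 2
    funext j y
    by_cases hj : j = i
    · subst hj
      by_cases hy : y ∈ xs
      · simp [hy]
      · by_cases hyx : y = x <;> simp [hy, hyx]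
    · simp [hj]

omit [Encodable V] in
theorem Ghost.add_is {G : Ghost V A} {a : Lab V} {f : V → Word A} {i : ℕ} {c : Lab V} :
    (G.add a f).Is i c ↔ G.Is i c ∨ (i = G.n + 1 ∧ c = a) := by
  unfold Is add
  by_cases hi : i = G.n + 1
  · subst hi
    simp [eq_comm]
  · simp only [Function.update_of_ne hi, hi, false_and, or_false]
    constructor
    · rintro ⟨h1, h2, h3⟩
      exact ⟨h1, by omega, h3⟩
    · rintro ⟨h1, h2, h3⟩
      exact ⟨h1, by omega, h3⟩

omit [Encodable V] in
theorem Ghost.add_rel {G : Ghost V A} {a : Lab V} {f : V → Word A} {i : ℕ} (hi : i ≠ G.n + 1) :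
    (G.add a f).rel i = G.rel i := by
  simp [add, hi]

omit [Encodable V] in
theorem Ghost.add_row {G : Ghost V A} {a : Lab V} {f : V → Word A} {i : ℕ} (hi : i ≠ G.n + 1) :
    (G.add a f).row i = G.row i := by
  simp [add, hi]

omit [Encodable V] in
theorem Ghost.add_row_new {G : Ghost V A} {a : Lab V} {f : V → Word A} {x : V} (hx : x ∈ att a) :
    (G.add a f).row (G.n + 1) x = f x := by
  simp [add, hx]

omit [Encodable V] in
theorem Ghost.Is.ne {G : Ghost V A} {i : ℕ} {c : Lab V} (h : G.Is i c) : i ≠ G.n + 1 := by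
  have := h.2.1
  omega

omit [Encodable V] in
-- A new tuple starts with stored weight `0`: it lies in no bucket and adds nothing to a total, so
-- all invariants survive if it is marked as outdated. Only the lists of parents have to change.
theorem EInv.addTuple {G : Ghost V A} {σ σ' : Key A → ℕ} {ε : Edge V} {D : Set ℕ} {a : Lab V}
    {f : V → Word A} (h : EInv G σ ε D) (hK : ∀ x ∈ ε.K, x ∈ att ε.par)
    (hσ : ∀ fld b, fld ≠ 2 → fld ≠ 5 → σ' (.num (ε.tag + 3) :: .num fld :: b) =
      σ (.num (ε.tag + 3) :: .num fld :: b))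
    (hcap : ∀ τ k, σ' (aCap τ k) = σ (aCap τ k))
    (hpar : ε.par = a → (∀ k, σ' (aHead ε.tag k) =
        open Classical in if k = key ε.K f then G.n + 1 else σ (aHead ε.tag k)) ∧
      ∀ j, σ' (aNxt ε.tag j) =
        if j = G.n + 1 then σ (aHead ε.tag (key ε.K f)) else σ (aNxt ε.tag j))
    (hpar' : ε.par ≠ a → (∀ k, σ' (aHead ε.tag k) = σ (aHead ε.tag k)) ∧
      ∀ j, σ' (aNxt ε.tag j) = σ (aNxt ε.tag j)) :
    EInv (G.add a f) σ' ε (insert (G.n + 1) D) := by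
  have hwt : ∀ i, σ' (aWt ε.tag i) = σ (aWt ε.tag i) := fun i => hσ _ _ (by omega) (by omega)
  have hpos : ∀ i, σ' (aPos ε.tag i) = σ (aPos ε.tag i) := fun i => hσ _ _ (by omega) (by omega)
  have hcnt : ∀ k, σ' (aCnt ε.tag k) = σ (aCnt ε.tag k) := fun i => hσ _ _ (by omega) (by omega)
  have hbl : ∀ w k, σ' (aBl ε.tag w k) = σ (aBl ε.tag w k) :=
    fun w k => hσ _ _ (by omega) (by omega)
  have hbk : ∀ w j k, σ' (aBk ε.tag w j k) = σ (aBk ε.tag w j k) :=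
    fun w j k => hσ _ _ (by omega) (by omega)
  have hW : ∀ T (f : V → Word A), W σ' T f = W σ T f := fun T f => W_congr fun t _ => hcap _ _
  have hnew : σ (aWt ε.tag (G.n + 1)) = 0 := by
    by_contra hc
    exact (h.wt_is _ hc).ne rfl
  obtain ⟨h1, h2, h3, h4, h5, h6, h7, h8, h9, h10⟩ := h
  constructor
  · intro i hi
    rw [hwt] at hi
    exact Ghost.add_is.2 (.inl (h1 i hi))
  · intro i hi
    rw [hpos] at hi
    exact Ghost.add_is.2 (.inl (h2 i hi))
  · intro i hi
    by_cases hp : ε.par = a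
    · rw [(hpar hp).2] at hi
      split_ifs at hi with hin
      · exact Ghost.add_is.2 (.inr ⟨hin, hp⟩)
      · exact Ghost.add_is.2 (.inl (h3 i hi))
    · rw [(hpar' hp).2] at hi
      exact Ghost.add_is.2 (.inl (h3 i hi))
  · simpa only [hwt] using h4
  · simp only [hwt, hpos, hbl, hbk]
    have hrow : ∀ i, σ (aWt ε.tag i) ≠ 0 → (G.add a f).row i = G.row i :=
      fun i hi => Ghost.add_row (h1 i hi).ne
    constructor
    · intro w j k hj
      have hm := h5.mem w j k hj
      refine ⟨hm.1, hm.2.1, ?_, hm.2.2.2⟩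
      rw [hrow _ (by rw [hm.1]; exact hm.2.2.2)]
      exact hm.2.2.1
    · intro i hi
      rw [hrow i hi]
      exact h5.pos_lt i hi
    · exact h5.out
  · intro k
    rw [hcnt, h6 k]
    have : Finset.Icc 1 (G.add a f).n = insert (G.n + 1) (Finset.Icc 1 G.n) := by
      ext i
      simp [Ghost.add]
      omega
    rw [this, Finset.sum_insert (by simp), hwt, hnew]
    simp only [ite_self, zero_add]
    refine Finset.sum_congr rfl fun i hi => ?_
    rw [hwt, Ghost.add_row (by have := Finset.mem_Icc.1 hi; omega)]
  · intro k
    rw [hcnt, hcap]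
    exact h7 k
  · intro i hi
    rw [hwt, hW]
    rcases Ghost.add_is.1 hi with hi | ⟨rfl, -⟩
    · rw [Ghost.add_row hi.ne]
      exact h8 i hi
    · rw [hnew]
      exact Nat.zero_le _
  · intro i hi hiD
    rw [hwt, hW]
    simp only [Set.mem_insert_iff, not_or] at hiD
    rcases Ghost.add_is.1 hi with hi | ⟨rfl, -⟩
    · rw [Ghost.add_row hi.ne]
      exact h9 i hi hiD.2
    · exact (hiD.1 rfl).elim
  · intro k
    obtain ⟨l, hl1, hl2, hl3⟩ := h10 k
    have hold : ∀ i ∈ l, i ≠ G.n + 1 := fun i hi => ((hl3 i).1 hi).1.ne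
    by_cases hp : ε.par = a
    · have hkey : key ε.K ((G.add a f).row (G.n + 1)) = key ε.K f :=
        key_eq_iff.2 fun x hx => Ghost.add_row_new (hp ▸ hK x hx)
      have hlink : Linked (fun i => σ' (aNxt ε.tag i)) (σ (aHead ε.tag k)) l :=
        hl2.congr fun i hi => by rw [(hpar hp).2, if_neg (hold i hi)]
      by_cases hk : k = key ε.K f
      · refine ⟨(G.n + 1) :: l, List.nodup_cons.2 ⟨fun hc => hold _ hc rfl, hl1⟩, ?_, ?_⟩
        · rw [(hpar hp).1, if_pos hk]
          refine .cons _ _ (by omega) ?_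
          rw [(hpar hp).2, if_pos rfl, ← hk]
          exact hlink
        · intro i
          rw [List.mem_cons, hl3, Ghost.add_is]
          constructor
          · rintro (rfl | ⟨h1, h2⟩)
            · exact ⟨.inr ⟨rfl, hp⟩, hkey.trans hk.symm⟩
            · exact ⟨.inl h1, by rw [Ghost.add_row h1.ne]; exact h2⟩
          · rintro ⟨h1 | ⟨rfl, -⟩, h2⟩
            · rw [Ghost.add_row h1.ne] at h2
              exact .inr ⟨h1, h2⟩
            · exact .inl rfl
      · refine ⟨l, hl1, ?_, ?_⟩
        · rw [(hpar hp).1, if_neg hk]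
          exact hlink
        · intro i
          rw [hl3, Ghost.add_is]
          constructor
          · rintro ⟨h1, h2⟩
            exact ⟨.inl h1, by rw [Ghost.add_row h1.ne]; exact h2⟩
          · rintro ⟨h1 | ⟨rfl, -⟩, h2⟩
            · rw [Ghost.add_row h1.ne] at h2
              exact ⟨h1, h2⟩
            · exact (hk (h2.symm.trans hkey)).elim
    · refine ⟨l, hl1, ?_, ?_⟩
      · rw [(hpar' hp).1]
        exact hl2.congr fun i _ => (hpar' hp).2 i
      · intro i
        rw [hl3, Ghost.add_is]
        constructor
        · rintro ⟨h1, h2⟩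
          exact ⟨.inl h1, by rw [Ghost.add_row h1.ne]; exact h2⟩
        · rintro ⟨h1 | ⟨rfl, h1⟩, h2⟩
          · rw [Ghost.add_row h1.ne] at h2
            exact ⟨h1, h2⟩
          · exact (hp h1).elim

theorem Inv.head_le {S : JT V} {G : Ghost V A} {σ : Key A → ℕ} {D : ℕ → Set ℕ}
    (h : Inv S G σ D) {e : Edge V × List (Edge V)} (he : e ∈ S.paths []) (k : Key A) :
    σ (aHead e.1.tag k) ≤ G.n := by
  obtain ⟨l, -, h1, h2⟩ := (h.edges e he).par k
  cases h1' : σ (aHead e.1.tag k) with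
  | zero => exact Nat.zero_le _
  | succ i =>
    rw [h1'] at h1
    cases h1 with
    | cons _ l' _ _ => exact ((h2 (i + 1)).1 (by simp)).1.2.1

omit [Encodable V] in
theorem nodup_edgesBelow {S : JT V} (hS : S.tags.Nodup) (a : Lab V) :
    ((edgesBelow S a).map Edge.tag).Nodup := by
  have h : (((S.paths []).map Prod.fst).map Edge.tag).Nodup := by
    rw [List.map_map]
    have := JT.map_tag_paths S []
    rw [← this] at hS
    exact hS
  exact h.sublist (List.filter_sublist.map _)

open Classical in
theorem Inv.addTuple {S : JT V} (hS : S.tags.Nodup) {G : Ghost V A} {σ σ' : Key A → ℕ}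
    {D : ℕ → Set ℕ} (h : Inv S G σ D) {a : Lab V} (ha : a ≠ none) {f : V → Word A}
    (hnew : ∀ i, G.Is i a → key (att a) (G.row i) ≠ key (att a) f)
    (hσ : LinkStep (Function.update (Function.update σ aN (G.n + 1))
      (aId a (key (att a) f)) (G.n + 1)) σ' (edgesBelow S a) f (G.n + 1)) :
    Inv S (G.add a f) σ' (fun t => insert (G.n + 1) (D t)) := by
  set σ1 := Function.update (Function.update σ aN (G.n + 1)) (aId a (key (att a) f)) (G.n + 1)
    with hσ1
  have hkey : key (att a) ((G.add a f).row (G.n + 1)) = key (att a) f :=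
    key_eq_iff.2 fun x hx => Ghost.add_row_new hx
  have hoff : ∀ (fld n : ℕ) b, fld ≠ 5 → fld ≠ 2 → σ' (.num (n + 3) :: .num fld :: b) =
      σ (.num (n + 3) :: .num fld :: b) := by
    intro fld n b h5 h2
    rw [hσ.off _ fun ε hε => by simp [h5, h2], hσ1, Function.update_of_ne (by simp),
      Function.update_of_ne (by simp)]
  have hlow : ∀ fld b, fld < 3 → σ' (.num fld :: b) = σ1 (.num fld :: b) := by
    intro fld b hf
    exact hσ.off _ fun ε hε => by
      constructor <;>
      · intro hc
        simp at hc
        omega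
  have hedge : ∀ fld n b, σ1 (.num (n + 3) :: .num fld :: b) =
      σ (.num (n + 3) :: .num fld :: b) := by
    intro fld n b
    rw [hσ1, Function.update_of_ne (by simp), Function.update_of_ne (by simp)]
  refine ⟨?_, ?_, ?_, ?_, ?_, ?_, ?_⟩
  · intro e he
    have hmem : e.1.par = a → e.1 ∈ edgesBelow S a := fun hp => by
      simp only [edgesBelow, List.mem_filter, List.mem_map, decide_eq_true_eq]
      exact ⟨⟨e, he, rfl⟩, hp⟩
    refine (h.edges e he).addTuple ?_ (fun fld b h2 h5 => hoff fld _ b h5 h2)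
      (fun τ k => hoff 4 τ k (by omega) (by omega)) (fun hp => ⟨fun k => ?_, fun j => ?_⟩)
      (fun hp => ⟨fun k => ?_, fun j => ?_⟩)
    · intro x hx
      rw [(JT.paths_sub S [] e he).2.2] at hx
      exact (Finset.mem_inter.1 hx).1
    · rw [hσ.head _ (hmem hp), hedge]
    · rw [hσ.nxt _ (hmem hp), hedge, hedge]
    all_goals
      have hne : ∀ ε ∈ edgesBelow S a, ε.tag ≠ e.1.tag := by
        intro ε hε hc
        simp only [edgesBelow, List.mem_filter, List.mem_map, decide_eq_true_eq] at hε
        obtain ⟨⟨d, hd, rfl⟩, hpd⟩ := hε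
        have hn : ((S.paths []).map fun e => e.1.tag).Nodup := by rwa [JT.map_tag_paths]
        have : d = e := List.inj_on_of_nodup_map hn hd he hc
        exact hp (this ▸ hpd)
      rw [hσ.off _ fun ε hε => by simp [(hne ε hε).symm], hedge]
  · rw [hlow 0 _ (by omega), hσ1, Function.update_of_ne (by simp), Function.update_self]
    rfl
  · intro i c hi
    rcases Ghost.add_is.1 hi with hi | ⟨-, rfl⟩
    · exact h.lab i c hi
    · exact ha
  · intro i x hx
    by_cases hi : i = G.n + 1
    · subst hi
      simp only [Ghost.add, Function.update_self] at hx ⊢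
      rw [if_neg]
      intro hc
      exact hx ⟨by omega, le_rfl, hc⟩
    · rw [Ghost.add_row hi]
      refine h.row_out i x fun hc => hx ⟨hc.1, ?_, ?_⟩
      · simp only [Ghost.add]
        omega
      · simp only [Ghost.add, Function.update_of_ne hi]
        exact hc.2.2
  · intro c k hk
    rw [hlow 2 _ (by omega), hσ1] at hk ⊢
    by_cases hc : aId c k = aId a (key (att a) f)
    · simp only [List.cons.injEq, Word.num.injEq, Encodable.encode_inj, true_and] at hc
      obtain ⟨rfl, rfl⟩ := hc
      rw [Function.update_self]
      exact ⟨Ghost.add_is.2 (.inr ⟨rfl, rfl⟩), hkey⟩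
    · rw [Function.update_of_ne hc, Function.update_of_ne (by simp)] at hk ⊢
      obtain ⟨h1, h2⟩ := h.id_is c k hk
      exact ⟨Ghost.add_is.2 (.inl h1), by rw [Ghost.add_row h1.ne, h2]⟩
  · intro i c hi
    rw [hlow 2 _ (by omega), hσ1]
    rcases Ghost.add_is.1 hi with hi' | ⟨rfl, rfl⟩
    · rw [Ghost.add_row hi'.ne, Function.update_of_ne, Function.update_of_ne (by simp)]
      · exact h.is_id i c hi'
      · intro hc
        simp only [List.cons.injEq, Word.num.injEq, Encodable.encode_inj, true_and] at hc
        obtain ⟨rfl, hc⟩ := hc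
        exact hnew i hi' hc
    · rw [hkey, Function.update_self]
  · intro ad had
    by_cases h1 : ∃ ε ∈ edgesBelow S a, ad = aHead ε.tag (key ε.K f) ∨ ad = aNxt ε.tag (G.n + 1)
    · obtain ⟨ε, hε, h1⟩ := h1
      simp only [edgesBelow, List.mem_filter, List.mem_map, decide_eq_true_eq] at hε
      obtain ⟨⟨d, hd, rfl⟩, -⟩ := hε
      refine .inr (.inr ⟨d, hd, ?_⟩)
      rcases h1 with rfl | rfl
      · exact .head _
      · exact .nxt _
    · push Not at h1
      rw [hσ.off ad h1, hσ1] at had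
      by_cases h2 : ad = aId a (key (att a) f)
      · exact .inr (.inl ⟨_, _, h2⟩)
      · rw [Function.update_of_ne h2] at had
        by_cases h3 : ad = aN
        · exact .inl h3
        · rw [Function.update_of_ne h3] at had
          exact h.supp ad had

omit [Encodable V] in
theorem potential_add {S : JT V} {G : Ghost V A} {σ σ' : Key A → ℕ} {a : Lab V}
    {f : V → Word A} (hcap : ∀ τ k, σ' (aCap τ k) = σ (aCap τ k)) :
    potential S G σ ≤ potential S (G.add a f) σ' := by
  refine List.sum_le_sum fun e _ => ?_
  unfold pot
  have : Finset.Icc 1 G.n ⊆ Finset.Icc 1 (G.add a f).n :=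
    Finset.Icc_subset_Icc_right (Nat.le_succ _)
  refine le_trans (Finset.sum_le_sum fun i hi => ?_) (Finset.sum_le_sum_of_subset this)
  have hi : i ≠ G.n + 1 := by have := Finset.mem_Icc.1 hi; omega
  rw [Ghost.add_row hi, Ghost.add_rel hi, hcap]

/-- The factor for the number of steps of `procs`. -/
noncomputable def procsCost : List (Edge V × List (Edge V)) → ℕ
  | [] => 1
  | e :: es => procCost (e.1 :: e.2) + procsCost es

/-- A relation labels a node in each of the rooted join trees, so an inserted tuple has to be
brought up to date at several edges. The updates at different edges are independent, and their
amortized costs add up. -/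
theorem runs_procs [Fintype V] {S : JT V} (hS : S.tags.Nodup) (hroot : S.root = none) {L : Limits}
    {N : ℕ} (hL : Enough S L N) {G : Ghost V A} (hN : G.n ≤ N) {i : ℕ}
    (es : List (Edge V × List (Edge V))) (hes : ∀ e ∈ es, e ∈ S.paths [] ∧ G.Is i e.1.c.root)
    (σ : Key A → ℕ) (D : ℕ → Set ℕ) (f : V → Word A) (g : ℕ → Word A) (hI : Inv S G σ D)
    (hg : g 100 = .num i) :
    Runs L (procs es) f g (enc σ G.row) fun k _ g' M' =>
      Updated S G σ (fun t => D t \ if t ∈ es.map (fun e => e.1.tag) then {i} else ∅) 0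
        (procsCost es) (procsCost es) g k g' M' := by
  induction es generalizing σ D f g with
  | nil =>
    refine ⟨1, f, g, _, .skip _, σ, rfl, hI.mono (by simp), fun _ _ => rfl, fun _ _ => rfl,
      le_rfl, by simp [procsCost]⟩
  | cons e es ih =>
    have he := hes e (by simp)
    rw [procs]
    refine Runs.seq ((runs_proc hS hroot hL hN e.2 e.1 he.1 0 σ D f g i hI he.2 hg).mono ?_)
    rintro k f1 g1 M1 ⟨σ1, rfl, hI1, hg1, hn1, hp1, hk1⟩
    refine (ih (fun e he => hes e (by simp [he])) σ1 _ f1 g1 hI1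
      (by rw [← hg]; exact hg1 0 le_rfl)).mono ?_
    rintro k2 f2 g2 M2 ⟨σ2, rfl, hI2, hg2, hn2, hp2, hk2⟩
    refine ⟨σ2, rfl, hI2.mono ?_, fun n hn => (hg2 n hn).trans (hg1 n hn),
      fun t j => (hn2 t j).trans (hn1 t j), hp1.trans hp2, ?_⟩
    · intro e' _ j _
      simp only [List.map_cons, List.mem_cons]
      by_cases h1 : e'.1.tag = e.1.tag <;> by_cases h2 : e'.1.tag ∈ es.map (fun e => e.1.tag) <;>
        simp [h1, h2] <;> tauto
    · rw [procsCost]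
      nlinarith [Nat.mul_le_mul_left (procsCost es) hp1,
        Nat.mul_le_mul_left (procCost (e.1 :: e.2)) hp2]

theorem wp_prepareProg {S : JT V} (hS : S.tags.Nodup) {G : Ghost V A} {σ : Key A → ℕ}
    {D : ℕ → Set ℕ} (hI : Inv S G σ D) {b : ℕ} (hb : G.n + 1 < 2 ^ b) {a : Lab V} (ha : a ≠ none)
    {f : V → Word A} (hf : ∀ x ∈ att a, (f x).Fits b)
    (hnew : ∀ i, G.Is i a → key (att a) (G.row i) ≠ key (att a) f)
    {Q : (V → Word A) → (ℕ → Word A) → Mem A → Prop} {g : ℕ → Word A}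
    (hQ : ∀ g' σ', g' 100 = .num (G.n + 1) →
      Inv S (G.add a f) σ' (fun t => insert (G.n + 1) (D t)) →
      potential S G σ ≤ potential S (G.add a f) σ' → Q f g' (enc σ' (G.add a f).row)) :
    wp b (prepareProg S a) Q f g (enc σ G.row) := by
  classical
  -- By `row_out`, the row of an unused number is zero, so it suffices to write the attributes of
  -- `a`.
  have hrow : (open Classical in Function.update G.row (G.n + 1) fun x =>
      if x ∈ (att a).toList then f x else G.row (G.n + 1) x) = (G.add a f).row := by
    funext j x
    by_cases hj : j = G.n + 1
    · subst hj
      have h0 := hI.row_out (G.n + 1) x (by rintro ⟨-, h, -⟩; omega)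
      simp [Ghost.add, h0]
    · simp [Ghost.add, hj]
  rw [prepareProg, wp, allocProg]
  simp only [wp, List.map_cons, List.map_nil, map_oKey, ev]
  rw [enc_num _ _ (by omega), hI.num]
  refine ⟨G.n, 1, by simp, rfl, hb, ?_⟩
  simp only [Function.update_self, Arith.eval]
  refine ⟨hb, hb, hb, ?_⟩
  rw [update_enc_num _ _ (by omega), update_enc_num _ _ (by omega)]
  refine wp_storeRow _ (fun x hx => hf x (by simpa using hx)) (i := G.n + 1) (by simp) ?_
  rw [hrow]
  refine wp_linkProg hb _ (nodup_edgesBelow hS a) ?_ (by simp) fun g' σ' hg' hσ' => ?_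
  · intro ε hε
    simp only [edgesBelow, List.mem_filter, List.mem_map, decide_eq_true_eq] at hε
    obtain ⟨⟨d, hd, rfl⟩, -⟩ := hε
    rw [Function.update_of_ne (by simp), Function.update_of_ne (by simp)]
    have := hI.head_le hd (key d.1.K f)
    omega
  · refine hQ g' σ' hg' (hI.addTuple hS ha hnew (by convert hσ')) (potential_add fun τ k => ?_)
    rw [hσ'.off _ (by simp), Function.update_of_ne (by simp), Function.update_of_ne (by simp)]

open Classical in
/-- The factor for the number of steps of `insertProg`. -/
noncomputable def insertCost (S : JT V) (a : Lab V) : ℕ :=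
  (prepareProg S a).cost + procsCost ((S.paths []).filter fun e => e.1.c.root = a) + 3

open Classical in
/-- The database after the insertion of the tuple `f` into the relation `a`. -/
noncomputable def Ghost.insert (G : Ghost V A) (a : Lab V) (f : V → Word A) : Ghost V A :=
  if ∃ i, G.Is i a ∧ key (att a) (G.row i) = key (att a) f then G else G.add a f

/-- A repeated tuple is recognized by its nonzero number and changes nothing. Otherwise the tuple is
prepared as outdated everywhere and then updated at all edges whose child has its label. -/
theorem runs_insertProg [Fintype V] {S : JT V} (hS : S.tags.Nodup) (hroot : S.root = none)
    {L : Limits} {N : ℕ} (hL : Enough S L N) {G : Ghost V A} (hN : G.n + 1 ≤ N) {a : Lab V}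
    (hc : 1 + N * (Fintype.card V + 1 + 8 * (S.paths []).length) + (prepareProg S a).cost ≤ L.cells)
    (ha : a ≠ none) {σ : Key A → ℕ} (hI : Inv S G σ fun _ => ∅) {f : V → Word A}
    (hf : ∀ x ∈ att a, (f x).Fits L.bits) (g : ℕ → Word A) :
    Runs L (insertProg S a) f g (enc σ G.row) fun k _ _ M' =>
      ∃ σ', M' = enc σ' (G.insert a f).row ∧ Inv S (G.insert a f) σ' (fun _ => ∅) ∧
        potential S G σ ≤ potential S (G.insert a f) σ' ∧
        k + insertCost S a * potential S G σ ≤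
          insertCost S a + insertCost S a * potential S (G.insert a f) σ' := by
  classical
  rw [insertProg]
  refine Runs.seq (Runs.load ?_)
  simp only [List.map_cons, map_oKey, ev]
  rw [enc_num _ _ (by omega)]
  refine Runs.cond_eq (fun h0 => ?_) (fun h0 => ?_)
  · simp only [ev, Function.update_self, Word.num.injEq] at h0
    have hnew : ∀ i, G.Is i a → key (att a) (G.row i) ≠ key (att a) f := by
      intro i hi hk
      have := hI.is_id i a hi
      rw [hk] at this
      exact Nat.pos_iff_ne_zero.1 hi.1 (this.symm.trans h0)
    have hG : G.insert a f = G.add a f := if_neg (by push Not; exact hnew)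
    rw [hG]
    have hb : G.n + 1 < 2 ^ L.bits := by
      have h1 := hL.bits
      have h2 : (2 * N + 2) ≤ (2 * N + 2) ^ S.size := Nat.le_self_pow S.size_pos.ne' _
      omega
    have hcells := Nat.mul_le_mul_right (Fintype.card V + 1 + 8 * (S.paths []).length)
      (show G.n ≤ N by omega)
    refine Runs.seq ((wp.runs
      (S := 1 + G.n * (Fintype.card V + 1 + 8 * (S.paths []).length)) (wp_prepareProg hS hI hb ha hf hnew
      (Q := fun f' g' M' => ∃ σ', g' 100 = .num (G.n + 1) ∧ M' = enc σ' (G.add a f).row ∧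
        Inv S (G.add a f) σ' (fun _ => insert (G.n + 1) ∅) ∧
        potential S G σ ≤ potential S (G.add a f) σ')
      fun g' σ' h1 h2 h3 => ⟨σ', h1, rfl, h2, h3⟩) hI.space_le (by omega)).mono ?_)
    rintro k1 f1 g1 M1 ⟨hk1, -, σ1, hg1, rfl, hI1, hp1⟩
    refine (runs_procs hS hroot hL (G := G.add a f) hN ((S.paths []).filter fun e => e.1.c.root = a)
      (fun e he => ?_) σ1 _ f1 g1 hI1 hg1).mono ?_
    · simp only [List.mem_filter, decide_eq_true_eq] at he
      exact ⟨he.1, Ghost.add_is.2 (.inr ⟨rfl, he.2⟩)⟩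
    rintro k2 f2 g2 M2 ⟨σ2, rfl, hI2, -, -, hp2, hk2⟩
    -- At the edges that are not processed, the new tuple remains in the formal set of outdated
    -- tuples, but it does not belong to the child there, so the set may be replaced by `∅`.
    refine ⟨σ2, rfl, hI2.mono ?_, hp1.trans hp2, ?_⟩
    · rintro e he i hi ⟨hi1, hi2⟩
      obtain rfl : i = G.n + 1 := by simpa using hi1
      exfalso
      apply hi2
      rw [if_pos]
      · rfl
      · refine List.mem_map.2 ⟨e, List.mem_filter.2 ⟨he, ?_⟩, rfl⟩
        rcases Ghost.add_is.1 hi with hi | ⟨-, hi⟩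
        · exact (hi.ne rfl).elim
        · simpa using hi
    · have h12 := hp1.trans hp2
      unfold insertCost
      set P := procsCost ((S.paths []).filter fun e => e.1.c.root = a)
      have := Nat.mul_le_mul_left ((prepareProg S a).cost + 3) h12
      have := Nat.mul_le_mul_left P hp1
      nlinarith
  · simp only [ev, Function.update_self, ne_eq, Word.num.injEq] at h0
    have hG : G.insert a f = G := if_pos ⟨_, hI.id_is a _ h0⟩
    rw [hG]
    refine ⟨_, _, _, _, .skip _, σ, rfl, hI, le_rfl, ?_⟩
    unfold insertCost
    omega

end Insert

/-! ## The arrays of join results -/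

section Arrays

variable {V : Type u} {A : Type v}

/-- The numbers of the tuples with key `k` and weights `2 ^ e, …, 2 ^ (e + n - 1)`, in the order of
their weights. -/
def group (σ : Key A → ℕ) (τ e n : ℕ) (k : Key A) : List ℕ :=
  (List.range' e n).flatMap fun e =>
    (List.range (σ (aBl τ (2 ^ e) k))).map fun j => σ (aBk τ (2 ^ e) j k)

/-- The array for the join of the relations at the nodes of `T`, except the root, with the tuple `f`
at the root.  Its entries are the lists of the numbers of the tuples. -/
noncomputable def arr (σ : Key A → ℕ) (row : ℕ → V → Word A) (m : ℕ) :
    JT V → (V → Word A) → List (Option (List ℕ))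
  | .leaf _, _ => [some []]
  | .join τ p c, f => prod (· ++ ·) (arr σ row m p f)
      (pad (σ (aCap τ (key (sep p c) f))) ((group σ τ 0 m (key (sep p c) f)).flatMap fun i =>
        (arr σ row m c (row i)).map (Option.map (i :: ·))))

/-- All weights in `T` are up to date, and the numbers are less than `2 ^ m`. -/
def Clean (G : Ghost V A) (σ : Key A → ℕ) (m : ℕ) : JT V → Prop
  | .leaf _ => True
  | .join τ p c => Clean G σ m p ∧ EInv G σ ⟨τ, p.root, sep p c, c⟩ ∅ ∧
      (∀ i, σ (aWt τ i) < 2 ^ m) ∧ (∀ k, σ (aCap τ k) < 2 ^ m) ∧ Clean G σ m c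

/-- The lists of tuples at the nodes of `T`, except the root, that join with each other and with the
tuple `f` at the root. -/
def Sel (G : Ghost V A) : JT V → (V → Word A) → List ℕ → Prop
  | .leaf _, _, l => l = []
  | .join _ p c, f, l => ∃ l₁ i l₂, l = l₁ ++ i :: l₂ ∧ Sel G p f l₁ ∧ G.Is i c.root ∧
      key (sep p c) (G.row i) = key (sep p c) f ∧ Sel G c (G.row i) l₂

/-- The density of the arrays. -/
noncomputable def JT.density : JT V → ℝ
  | .leaf _ => 1
  | .join _ p c => p.density * (c.density / 2) / 2

theorem JT.density_pos (T : JT V) : 0 < T.density := by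
  induction T with
  | leaf => exact one_pos
  | join τ p c ihp ihc =>
    rw [density]
    positivity

theorem JT.density_le_one (T : JT V) : T.density ≤ 1 := by
  induction T with
  | leaf => exact le_rfl
  | join τ p c ihp ihc =>
    rw [density]
    have := p.density_pos
    have := c.density_pos
    nlinarith

variable {G : Ghost V A} {σ : Key A → ℕ} {m : ℕ}

section Group

variable {ε : Edge V} {D : Set ℕ} {k : Key A}

/-- Nonzero weights are powers of two below `2 ^ m`, so the buckets for the exponents below `m` miss
no tuple of positive weight. -/
theorem mem_group (h : EInv G σ ε D) (hm : ∀ i, σ (aWt ε.tag i) < 2 ^ m) {i : ℕ} :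
    i ∈ group σ ε.tag 0 m k ↔ σ (aWt ε.tag i) ≠ 0 ∧ key ε.K (G.row i) = k := by
  simp only [group, List.mem_flatMap, List.mem_range'_1, List.mem_range, List.mem_map]
  constructor
  · rintro ⟨e, -, j, hj, rfl⟩
    obtain ⟨h1, -, h2, -⟩ := h.buckets.mem _ _ _ hj
    exact ⟨by rw [h1]; positivity, h2⟩
  · rintro ⟨h0, rfl⟩
    obtain ⟨e, he⟩ := (h.wt_pow i).resolve_left h0
    obtain ⟨h1, h2⟩ := h.buckets.pos_lt i h0
    simp only [he] at h1 h2
    refine ⟨e, ⟨Nat.zero_le _, ?_⟩, _, h1, h2⟩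
    have := hm i
    rw [he] at this
    rw [Nat.zero_add]
    exact (Nat.pow_lt_pow_iff_right (by omega)).1 this

theorem nodup_group (h : EInv G σ ε D) {e n : ℕ} : (group σ ε.tag e n k).Nodup := by
  rw [group, List.nodup_flatMap]
  constructor
  · intro e _
    refine List.nodup_range.map_on fun j hj j' hj' hjj => ?_
    have h1 := (h.buckets.mem _ _ _ (List.mem_range.1 hj)).2.1
    have h2 := (h.buckets.mem _ _ _ (List.mem_range.1 hj')).2.1
    rw [← h1, ← h2, hjj]
  · refine (List.nodup_range' (step := 1)).imp ?_
    intro e e' hee i hi hi'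
    simp only [List.mem_map, List.mem_range] at hi hi'
    obtain ⟨j, hj, rfl⟩ := hi
    obtain ⟨j', hj', hjj⟩ := hi'
    have h1 := (h.buckets.mem _ _ _ hj).1
    have h2 := (h.buckets.mem _ _ _ hj').1
    rw [hjj, h1] at h2
    exact hee (Nat.pow_right_injective le_rfl h2)

theorem sum_group (h : EInv G σ ε D) (hm : ∀ i, σ (aWt ε.tag i) < 2 ^ m) :
    ((group σ ε.tag 0 m k).map fun i => σ (aWt ε.tag i)).sum = σ (aCnt ε.tag k) := by
  classical
  rw [h.cnt, ← List.sum_toFinset _ (nodup_group h), ← Finset.sum_filter]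
  have hsub : (group σ ε.tag 0 m k).toFinset ⊆
      (Finset.Icc 1 G.n).filter fun i => key ε.K (G.row i) = k := by
    intro i hi
    obtain ⟨h1, h2⟩ := (mem_group h hm).1 (List.mem_toFinset.1 hi)
    have := h.wt_is i h1
    exact Finset.mem_filter.2 ⟨Finset.mem_Icc.2 ⟨this.1, this.2.1⟩, h2⟩
  refine Eq.trans (Finset.sum_subset hsub fun i hi hi' => ?_) (by congr)
  by_contra h0
  exact hi' (List.mem_toFinset.2 ((mem_group h hm).2 ⟨h0, (Finset.mem_filter.1 hi).2⟩))

end Group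

/-- Lengths multiply in products, and padding brings each factor to the capacity. The padding is
legitimate because the members' arrays have, by induction, their stored weights as lengths, which
sum to the total of the group. -/
theorem length_arr {T : JT V} (hT : Clean G σ m T) (f : V → Word A) :
    (arr σ G.row m T f).length = W σ T f := by
  induction T generalizing f with
  | leaf => rfl
  | join τ p c ihp ihc =>
    obtain ⟨hp, he, hm, -, hc⟩ := hT
    rw [arr, length_prod, ihp hp, W, length_pad]
    refine le_trans (le_of_eq ?_) (he.cap _).le
    rw [← sum_group he hm, List.length_flatMap]
    congr 1
    refine List.map_congr_left fun i hi => ?_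
    have hi := he.wt_is i ((mem_group he hm).1 hi).1
    rw [List.length_map, ihc hc, he.wt_eq i hi (Set.notMem_empty _)]

theorem length_inner {τ : ℕ} {p c : JT V} (hT : Clean G σ m (.join τ p c)) (k : Key A) :
    ((group σ τ 0 m k).flatMap fun i =>
      (arr σ G.row m c (G.row i)).map (Option.map (i :: ·))).length = σ (aCnt τ k) := by
  obtain ⟨-, he, hm, -, hc⟩ := hT
  rw [← sum_group he hm, List.length_flatMap]
  congr 1
  refine List.map_congr_left fun i hi => ?_
  have hi := he.wt_is i ((mem_group he hm).1 hi).1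
  rw [List.length_map, length_arr hc, he.wt_eq i hi (Set.notMem_empty _)]

/-- By `Rounds`, a capacity is less than twice the unpadded length (or zero), so padding halves the
density at most; the product contributes the other factor `1 / 2`. -/
theorem dense_arr {T : JT V} (hT : Clean G σ m T) (f : V → Word A) :
    Dense T.density (arr σ G.row m T f) := by
  induction T generalizing f with
  | leaf =>
    intro i hi
    simp only [arr, List.length_singleton] at hi
    interval_cases i <;> simp [arr, JT.density]
  | join τ p c ihp ihc =>
    have hl := length_inner hT (key (sep p c) f)
    obtain ⟨hp, he, hm, -, hc⟩ := hT
    refine Dense.prod p.density_pos p.density_le_one (half_pos c.density_pos) (ihp hp f) ?_ _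
    refine Dense.pad c.density_pos.le (Dense.flatMap fun i hi => (ihc hc _).map ?_) ?_
    · intro o _
      cases o <;> rfl
    · rw [hl]
      rcases (he.cap (key (sep p c) f)).pow with h | ⟨-, h⟩
      · exact h.le.trans (Nat.zero_le _)
      · exact h.le

theorem mem_arr {T : JT V} (hT : Clean G σ m T) (f : V → Word A) (l : List ℕ) :
    l ∈ (arr σ G.row m T f).reduceOption ↔ Sel G T f l := by
  induction T generalizing f l with
  | leaf => simp [arr, Sel]
  | join τ p c ihp ihc =>
    obtain ⟨hp, he, hm, -, hc⟩ := hT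
    have hin : ∀ l', l' ∈ (pad (σ (aCap τ (key (sep p c) f))) ((group σ τ 0 m
        (key (sep p c) f)).flatMap fun i =>
          (arr σ G.row m c (G.row i)).map (Option.map (i :: ·)))).reduceOption ↔
        ∃ i l₂, l' = i :: l₂ ∧ G.Is i c.root ∧
          key (sep p c) (G.row i) = key (sep p c) f ∧ Sel G c (G.row i) l₂ := by
      intro l'
      rw [reduceOption_pad, List.reduceOption_mem_iff, List.mem_flatMap]
      constructor
      · rintro ⟨i, hi, h⟩
        obtain ⟨h1, h2⟩ := (mem_group he hm).1 hi
        obtain ⟨o, ho, h⟩ := List.mem_map.1 h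
        rcases o with - | l₂
        · simp at h
        · simp only [Option.map_some, Option.some.injEq] at h
          exact ⟨i, l₂, h.symm, he.wt_is i h1, h2,
            (ihc hc _ _).1 (List.reduceOption_mem_iff.2 ho)⟩
      · rintro ⟨i, l₂, rfl, h1, h2, h3⟩
        have h4 := List.reduceOption_mem_iff.1 ((ihc hc _ _).2 h3)
        refine ⟨i, (mem_group he hm).2 ⟨?_, h2⟩, List.mem_map.2 ⟨some l₂, h4, rfl⟩⟩
        -- A tuple of weight `0` is in no bucket, but then its array is empty; a tuple with a
        -- selection below it has positive weight.
        rw [he.wt_eq i h1 (Set.notMem_empty _)]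
        simp only
        rw [← length_arr hc]
        exact (List.length_pos_of_mem h4).ne'
    rw [arr, mem_reduceOption_prod, Sel]
    constructor
    · rintro ⟨l₁, h1, l', h2, rfl⟩
      obtain ⟨i, l₂, rfl, h3⟩ := (hin l').1 h2
      exact ⟨l₁, i, l₂, rfl, (ihp hp _ _).1 h1, h3⟩
    · rintro ⟨l₁, i, l₂, rfl, h1, h3⟩
      exact ⟨l₁, (ihp hp _ _).2 h1, i :: l₂, (hin _).2 ⟨i, l₂, rfl, h3⟩, rfl⟩

/-- The labels of the nodes of `T` except the root. -/
def JT.labs : JT V → List (Lab V)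
  | .leaf _ => []
  | .join _ p c => p.labs ++ c.root :: c.labs

/-- The sequence of relations in a selection depends on the tree only. In particular all selections
have the same length, so concatenations of them can be split uniquely. -/
theorem Sel.map_rel {T : JT V} {f : V → Word A} {l : List ℕ} (h : Sel G T f l) :
    l.map G.rel = T.labs := by
  induction T generalizing f l with
  | leaf =>
    rw [Sel] at h
    rw [h]
    rfl
  | join τ p c ihp ihc =>
    obtain ⟨l₁, i, l₂, rfl, h1, h2, -, h3⟩ := h
    rw [List.map_append, List.map_cons, ihp h1, ihc h3, h2.2.2, JT.labs]

theorem nodup_arr {T : JT V} (hT : Clean G σ m T) (f : V → Word A) :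
    (arr σ G.row m T f).reduceOption.Nodup := by
  induction T generalizing f with
  | leaf => simp [arr]
  | join τ p c ihp ihc =>
    obtain ⟨hp, he, hm, -, hc⟩ := hT
    refine nodup_reduceOption_prod ?_ (ihp hp f) ?_
    · intro l hl l' hl' y y' h
      have h1 := congrArg List.length ((mem_arr hp f l).1 hl).map_rel
      have h2 := congrArg List.length ((mem_arr hp f l').1 hl').map_rel
      rw [List.length_map] at h1 h2
      exact List.append_inj h (h1.trans h2.symm)
    · rw [reduceOption_pad]
      have := nodup_group (e := 0) (n := m) (k := key (sep p c) f) he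
      simp only at this
      generalize group σ τ 0 m (key (sep p c) f) = l at this ⊢
      induction l with
      | nil => simp
      | cons i l ih =>
        rw [List.nodup_cons] at this
        rw [List.flatMap_cons, List.reduceOption_append, List.nodup_append]
        refine ⟨?_, ih this.2, ?_⟩
        · rw [List.reduceOption_map]
          exact (ihc hc _).map (List.cons_injective)
        · rintro l₁ h1 _ h2 rfl
          rw [List.reduceOption_mem_iff] at h1 h2
          obtain ⟨o, -, ho⟩ := List.mem_map.1 h1
          obtain ⟨i', hi', h2⟩ := List.mem_flatMap.1 h2
          obtain ⟨o', -, ho'⟩ := List.mem_map.1 h2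
          rcases o with - | o <;> rcases o' with - | o' <;> simp at ho ho'
          rw [← ho'] at ho
          simp only [List.cons.injEq] at ho
          exact this.1 (ho.1 ▸ hi')

theorem arr_congr {row : ℕ → V → Word A} {T : JT V} {f f' : V → Word A}
    (h : ∀ x ∈ att T.root, f x = f' x) : arr σ row m T f = arr σ row m T f' := by
  induction T generalizing f f' with
  | leaf => rfl
  | join τ p c ihp _ =>
    have : key (sep p c) f = key (sep p c) f' := key_eq_iff.2 fun x hx => h x (mem_sep.1 hx).1
    rw [arr, arr, ihp h, this]

section Lookup

variable {X : Type*} {τ : ℕ} {k : Key A} {F : ℕ → List X}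

theorem length_bucket (hF : ∀ e j, j < σ (aBl τ (2 ^ e) k) →
    (F (σ (aBk τ (2 ^ e) j k))).length = 2 ^ e) (e : ℕ) :
    (((List.range (σ (aBl τ (2 ^ e) k))).map fun j => σ (aBk τ (2 ^ e) j k)).flatMap F).length =
      σ (aBl τ (2 ^ e) k) * 2 ^ e := by
  have h : ∀ j ∈ List.range (σ (aBl τ (2 ^ e) k)),
      ((fun i => (F i).length) ∘ fun j => σ (aBk τ (2 ^ e) j k)) j = 2 ^ e :=
    fun j hj => hF e j (List.mem_range.1 hj)
  rw [List.length_flatMap, List.map_map, List.map_congr_left h]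
  simp

theorem flatMap_group_succ (e n : ℕ) : (group σ τ e (n + 1) k).flatMap F =
    ((List.range (σ (aBl τ (2 ^ e) k))).map fun j => σ (aBk τ (2 ^ e) j k)).flatMap F ++
      (group σ τ (e + 1) n k).flatMap F := by
  rw [group, List.range'_succ, List.flatMap_cons, List.flatMap_append, group]

/-- Here the equal weights within a bucket are exploited: the member responsible for a position is
found by one division. -/
theorem getElem?_bucket (hF : ∀ e j, j < σ (aBl τ (2 ^ e) k) →
    (F (σ (aBk τ (2 ^ e) j k))).length = 2 ^ e) {e j : ℕ} (hj : j < σ (aBl τ (2 ^ e) k) * 2 ^ e) :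
    (((List.range (σ (aBl τ (2 ^ e) k))).map fun j => σ (aBk τ (2 ^ e) j k)).flatMap F)[j]? =
      (F (σ (aBk τ (2 ^ e) (j / 2 ^ e) k)))[j % 2 ^ e]? := by
  rw [getElem?_flatMap_uniform (Nat.two_pow_pos e)]
  · have : j / 2 ^ e < σ (aBl τ (2 ^ e) k) := (Nat.div_lt_iff_lt_mul (Nat.two_pow_pos e)).2 hj
    simp [this]
  · intro i hi
    obtain ⟨j, hj, rfl⟩ := List.mem_map.1 hi
    exact hF e j (List.mem_range.1 hj)

end Lookup

end Arrays

/-! ## Access to the arrays -/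

section Access

variable {V : Type u} {A : Type v}

/-- The attributes of the nodes of `T`. -/
def JT.Has (T : JT V) (x : V) : Prop := x ∈ att T.root ∨ ∃ a ∈ T.labs, x ∈ att a

/-- For every attribute, the nodes that contain it are connected. -/
def JT.Valid : JT V → Prop
  | .leaf _ => True
  | .join _ p c => p.Valid ∧ c.Valid ∧ ∀ x, p.Has x → c.Has x → x ∈ att p.root ∧ x ∈ att c.root

theorem JT.has_join {τ : ℕ} {p c : JT V} {x : V} :
    (JT.join τ p c).Has x ↔ p.Has x ∨ c.Has x := by
  simp only [Has, labs, root, List.mem_append, List.mem_cons, or_and_right, exists_or,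
    exists_eq_left]
  exact or_assoc.symm

/-- Programs without loops that do not change the memory. -/
def Prog.Pure {ρ : Type u} : Prog ρ → Prop
  | .skip | .move _ _ | .arith _ _ _ _ | .load _ _ => True
  | .store _ _ | .loop _ _ => False
  | .seq c d | .cond _ c d => c.Pure ∧ d.Pure

/-- Without stores the limit on the cells plays no role, so queries need no bound on the space. -/
theorem wp.runs_of_pure {L : Limits} {c : Prog (Reg V)} (hc : c.Pure)
    {Q : (V → Word A) → (ℕ → Word A) → Mem A → Prop} {f : V → Word A} {g : ℕ → Word A}
    {M : Mem A} (h : wp L.bits c Q f g M) :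
    Runs L c f g M fun k f' g' M' => k ≤ c.cost ∧ Q f' g' M' := by
  induction c generalizing Q f g M with
  | skip => exact ⟨_, _, _, _, .skip _, le_rfl, h⟩
  | move r o =>
    rcases r with r | r
    · refine ⟨1, _, _, _, ?_, le_rfl, h.2⟩
      rw [← setReg_inl, ← eval_eq_ev]
      exact .move _ _ _ (by simpa [eval_eq_ev] using h.1)
    · refine ⟨1, _, _, _, ?_, le_rfl, h.2⟩
      rw [← setReg_inr, ← eval_eq_ev]
      exact .move _ _ _ (by simpa [eval_eq_ev] using h.1)
  | arith r o x y =>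
    rcases r with r | r <;> obtain ⟨m, n, h1, h2, h3, h4⟩ := h
    · refine ⟨1, _, _, _, ?_, le_rfl, h4⟩
      rw [← setReg_inl]
      exact .arith _ _ _ _ _ _ _ (by simpa [eval_eq_ev] using h1)
        (by simpa [eval_eq_ev] using h2) h3
    · refine ⟨1, _, _, _, ?_, le_rfl, h4⟩
      rw [← setReg_inr]
      exact .arith _ _ _ _ _ _ _ (by simpa [eval_eq_ev] using h1)
        (by simpa [eval_eq_ev] using h2) h3
  | load r a =>
    rcases r with r | r
    · refine ⟨1, _, _, _, ?_, le_rfl, h⟩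
      rw [← setReg_inl, ← eval_eq_ev]
      exact .load _ _ _
    · refine ⟨1, _, _, _, ?_, le_rfl, h⟩
      rw [← setReg_inr, ← eval_eq_ev]
      exact .load _ _ _
  | store a x => exact hc.elim
  | seq c d ihc ihd =>
    refine Runs.seq ((ihc hc.1 h).mono ?_)
    rintro k f' g' M' ⟨hk, hQ⟩
    refine (ihd hc.2 hQ).mono ?_
    rintro l f'' g'' M'' ⟨hl, hQ⟩
    exact ⟨Nat.add_le_add hk hl, hQ⟩
  | cond t c d ihc ihd =>
    rcases t with ⟨x, y⟩ | ⟨x, y⟩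
    · refine Runs.cond_eq (fun e => (ihc hc.1 (h.1 e)).mono ?_)
        (fun e => (ihd hc.2 (h.2 e)).mono ?_) <;>
      · rintro k f' g' M' ⟨hk, hQ⟩
        exact ⟨by simp only [Prog.cost]; omega, hQ⟩
    · obtain ⟨m, n, h1, h2, h3, h4⟩ := h
      refine Runs.cond_lt m n h1 h2 (fun e => (ihc hc.1 (h3 e)).mono ?_)
        (fun e => (ihd hc.2 (h4 e)).mono ?_) <;>
      · rintro k f' g' M' ⟨hk, hQ⟩
        exact ⟨by simp only [Prog.cost]; omega, hQ⟩
  | loop t c ih => exact hc.elim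

theorem Runs.move {L : Limits} {n : ℕ} {x : Operand (Reg V)} {f : V → Word A}
    {g : ℕ → Word A} {M : Mem A} {Q : ℕ → (V → Word A) → (ℕ → Word A) → Mem A → Prop}
    (hx : (ev f g x).Fits L.bits) (h : Q 1 f (Function.update g n (ev f g x)) M) :
    Runs L (.move (.inr n) x) f g M Q := by
  refine ⟨1, f, _, M, ?_, h⟩
  rw [← setReg_inr, ← eval_eq_ev]
  exact .move _ _ _ (by rwa [eval_eq_ev])

/-- Divides the position in register `b` by the capacity of the group of the edge with tag `τ`; the
quotient is put into register `b + 1`, and the remainder into register `b`. -/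
noncomputable def splitProg (τ : ℕ) (K : Finset V) (b : ℕ) : Prog (Reg V) :=
  .seq (.load (.inr 2) (oEdge τ 4 (oKey K))) <|
  .seq (.arith (.inr (b + 1)) .quotient (rg b) (rg 2)) <|
  .seq (.arith (.inr 3) .times (rg (b + 1)) (rg 2)) <|
  .arith (.inr b) .minus (rg b) (rg 3)

/-- Loads the total weight of the bucket for the weight in register `2`, and increments the
position. -/
noncomputable def blockProg (τ : ℕ) (K : Finset V) (b : ℕ) : Prog (Reg V) :=
  .seq (.load (.inr 3) (oEdge τ 6 (rg 2 :: oKey K))) <|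
  .seq (.arith (.inr 3) .times (rg 3) (rg 2)) <|
  .arith (.inr 4) .plus (rg b) (.const 1)

/-- Skips the buckets before the position in register `b`. -/
noncomputable def scanProg (τ : ℕ) (K : Finset V) (b : ℕ) : Prog (Reg V) :=
  .loop (.lt (rg 3) (rg 4)) <|
    .seq (.arith (.inr b) .minus (rg b) (rg 3)) <|
    .seq (.arith (.inr 2) .plus (rg 2) (rg 2)) <|
    blockProg τ K b

variable [Encodable V]

/-- Loads the tuple at the position in register `b` of the bucket for the weight in register `2`. -/
noncomputable def pickProg (τ : ℕ) (K : Finset V) (b : ℕ) (a : Lab V) : Prog (Reg V) :=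
  .seq (.arith (.inr 3) .quotient (rg b) (rg 2)) <|
  .seq (.load (.inr 5) (oEdge τ 7 (rg 2 :: rg 3 :: oKey K))) <|
  .seq (.arith (.inr 3) .times (rg 3) (rg 2)) <|
  .seq (.arith (.inr b) .minus (rg b) (rg 3)) (loadRow 5 (att a).toList)

/-- Loads the tuple for the position in register `b` of the group of the edge with tag `τ`; the
position in its array is put into register `b`. -/
noncomputable def locateProg (τ : ℕ) (K : Finset V) (b : ℕ) (a : Lab V) : Prog (Reg V) :=
  .seq (.seq (.move (.inr 2) (.const 1)) (blockProg τ K b)) <|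
  .seq (scanProg τ K b) (pickProg τ K b a)

/-- Access to the array for the tree, for the tuple in the attribute registers and the position in
register `b`. -/
noncomputable def accessProg : JT V → ℕ → Prog (Reg V)
  | .leaf _, _ => .move (.inr 0) (.const 1)
  | .join τ p c, b => .seq (splitProg τ (sep p c) b) <| .seq (accessProg p (b + 1)) <|
      .cond (.eq (rg 0) (.const 1))
        (.seq (.load (.inr 2) (oEdge τ 3 (oKey (sep p c)))) <|
          .cond (.lt (rg b) (rg 2))
            (.seq (locateProg τ (sep p c) b c.root) (accessProg c b))
            (.move (.inr 0) (.const 0)))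
        .skip

omit [Encodable V] in
/-- The factor for the number of steps of `accessProg`. -/
noncomputable def accessCost : JT V → ℕ
  | .leaf _ => 1
  | .join _ p c => accessCost p + accessCost c + (att c.root).card + 30

variable {G : Ghost V A} {σ : Key A → ℕ} {m : ℕ} {L : Limits}

/-- The position is kept relative to the buckets `e, …, e + n - 1` that remain. Register `4` holds
the position plus one, so that the strict test means that the bucket ends at or before the position.
A round takes five instructions and one test. -/
theorem runs_scanProg {X : Type*} {row : ℕ → V → Word A} {τ : ℕ} {K : Finset V} {f : V → Word A}
    {k : Key A} (hk : key K f = k) {F : ℕ → List X}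
    (hF : ∀ e j, j < σ (aBl τ (2 ^ e) k) → (F (σ (aBk τ (2 ^ e) j k))).length = 2 ^ e) {b : ℕ}
    (hb : 20 ≤ b) (n : ℕ) {e j : ℕ} (hn : e + n ≤ L.bits)
    (hR : ((group σ τ e n k).flatMap F).length < 2 ^ L.bits)
    (hj : j < ((group σ τ e n k).flatMap F).length) {g : ℕ → Word A} (h2 : g 2 = .num (2 ^ e))
    (h3 : g 3 = .num (σ (aBl τ (2 ^ e) k) * 2 ^ e)) (h4 : g 4 = .num (j + 1))
    (hgb : g b = .num j) :
    Runs L (scanProg τ K b) f g (enc σ row) fun s f' g' M' => s ≤ 6 * n + 1 ∧ f' = f ∧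
      M' = enc σ row ∧ (∀ i, i < b → 20 ≤ i → g' i = g i) ∧ ∃ e' j', e' < L.bits ∧
        g' 2 = .num (2 ^ e') ∧ g' b = .num j' ∧ j' < σ (aBl τ (2 ^ e') k) * 2 ^ e' ∧
        σ (aBl τ (2 ^ e') k) * 2 ^ e' < 2 ^ L.bits ∧ ((group σ τ e n k).flatMap F)[j]? =
          (F (σ (aBk τ (2 ^ e') (j' / 2 ^ e') k)))[j' % 2 ^ e']? := by
  induction n generalizing e j g with
  | zero => simp [group] at hj
  | succ n ih =>
    have hlen := congrArg List.length (flatMap_group_succ (σ := σ) (τ := τ) (k := k) (F := F) e n)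
    rw [List.length_append, length_bucket hF] at hlen
    set B := σ (aBl τ (2 ^ e) k) * 2 ^ e with hB
    rcases lt_or_ge B (j + 1) with hBj | hBj
    · refine Runs.loop_true (m := B) (n := j + 1) (by simp [ev, h3]) (by simp [ev, h4]) hBj ?_
      -- The position is behind the current bucket but within the array, so another bucket follows;
      -- hence the doubled weight still fits in a word.
      have hn0 : n ≠ 0 := by
        rintro rfl
        have : (group σ τ (e + 1) 0 k).flatMap F = [] := by simp [group]
        rw [this, List.length_nil] at hlen
        omega
      have h1 : 2 ^ (e + 1) < 2 ^ L.bits := (Nat.pow_lt_pow_iff_right (by omega)).2 (by omega)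
      obtain ⟨n, rfl⟩ := Nat.exists_eq_add_one_of_ne_zero hn0
      have hlen' := congrArg List.length
        (flatMap_group_succ (σ := σ) (τ := τ) (k := k) (F := F) (e + 1) n)
      rw [List.length_append, length_bucket hF] at hlen'
      refine (wp.runs_of_pure (Q := fun f' g' M' => f' = f ∧ M' = enc σ row ∧
        (∀ i, i < b → 20 ≤ i → g' i = g i) ∧ g' 2 = .num (2 ^ (e + 1)) ∧
        g' 3 = .num (σ (aBl τ (2 ^ (e + 1)) k) * 2 ^ (e + 1)) ∧ g' 4 = .num (j - B + 1) ∧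
        g' b = .num (j - B)) (by simp [Prog.Pure, blockProg]) ?_).mono ?_
      · have e1 : 2 ^ e + 2 ^ e = 2 ^ (e + 1) := by ring
        simp only [wp, blockProg, ev, List.map_cons, map_oKey, hk]
        refine ⟨j, B, hgb, h3, by simp only [Arith.eval]; omega, 2 ^ e, 2 ^ e, ?_, ?_, ?_,
          ?_⟩
        · rw [Function.update_of_ne (by omega), h2]
        · rw [Function.update_of_ne (by omega), h2]
        · simp only [Arith.eval]
          omega
        simp only [Arith.eval, e1]
        rw [enc_num _ _ (by omega), Function.update_self]
        refine ⟨σ (aBl τ (2 ^ (e + 1)) k), 2 ^ (e + 1), by simp, by simp, by omega, j - B, 1, ?_,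
          rfl, by omega, trivial, trivial, ?_, ?_, ?_, ?_, ?_⟩
        · rw [Function.update_of_ne (by omega), Function.update_of_ne (by omega),
            Function.update_of_ne (by omega), Function.update_self]
        · intro i hi hi'
          rw [Function.update_of_ne (by omega), Function.update_of_ne (by omega),
            Function.update_of_ne (by omega), Function.update_of_ne (by omega),
            Function.update_of_ne (by omega)]
        · simp
        · simp
        · simp
        · rw [Function.update_of_ne (by omega), Function.update_of_ne (by omega),
            Function.update_of_ne (by omega), Function.update_of_ne (by omega),
            Function.update_self]
      · rintro s f1 g1 M1 ⟨hs, rfl, rfl, hg1, h12, h13, h14, h1b⟩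
        refine (ih (e := e + 1) (j := j - B) (by omega) (by omega) (by omega) h12 h13 h14
          h1b).mono ?_
        rintro s' f2 g2 M2 ⟨hs', rfl, rfl, hg2, e', j', h5, h6, h7, h8, h9, h10⟩
        refine ⟨?_, rfl, rfl, fun i hi hi' => (hg2 i hi hi').trans (hg1 i hi hi'),
          e', j', h5, h6, h7, h8, h9, ?_⟩
        · simp only [Prog.cost, blockProg] at hs
          omega
        · rw [flatMap_group_succ, List.getElem?_append_right (by rw [length_bucket hF]; omega),
            length_bucket hF]
          exact h10
    · refine Runs.loop_false (m := B) (n := j + 1) (by simp [ev, h3]) (by simp [ev, h4]) (by omega)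
        ⟨by omega, rfl, rfl, fun _ _ _ => rfl, e, j, by omega, h2, hgb, by omega, by omega, ?_⟩
      rw [flatMap_group_succ, List.getElem?_append_left (by rw [length_bucket hF]; omega),
        getElem?_bucket hF (by omega)]

theorem pure_loadRow (r : ℕ) (xs : List V) : (loadRow r xs).Pure := by
  induction xs with
  | nil => trivial
  | cons x xs ih => exact ⟨trivial, ih⟩

/-- The registers after access to the entry `o` of the array for the tree `T` and the tuple `f`. -/
def Accessed (G : Ghost V A) (T : JT V) (f f' : V → Word A) (g' : ℕ → Word A) :
    Option (List ℕ) → Prop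
  | none => g' 0 = .num 0
  | some l => g' 0 = .num 1 ∧ (∀ i ∈ l, ∀ x ∈ att (G.rel i), f' x = G.row i x) ∧
      (∀ x ∈ att T.root, f' x = f x) ∧ ∀ x, ¬T.Has x → f' x = f x

omit [Encodable V] in
theorem Sel.has {T : JT V} {f : V → Word A} {l : List ℕ} (h : Sel G T f l) {i : ℕ} (hi : i ∈ l)
    {x : V} (hx : x ∈ att (G.rel i)) : T.Has x :=
  .inr ⟨_, by rw [← h.map_rel]; exact List.mem_map_of_mem hi, hx⟩

omit [Encodable V] in
-- Access to `c` may overwrite registers filled by the access to `p`. By validity such an attribute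
-- belongs to both roots, hence to the key, where the new value equals the old one.
theorem Accessed.join {τ : ℕ} {p c : JT V} (hv : (JT.join τ p c).Valid) {f f₁ f₂ f₃ : V → Word A}
    {g₁ g₃ : ℕ → Word A} {l₁ : List ℕ} {i : ℕ} {o : Option (List ℕ)} (hl₁ : Sel G p f l₁)
    (h₁ : Accessed G p f f₁ g₁ (some l₁)) (hi : G.Is i c.root)
    (hk : key (sep p c) (G.row i) = key (sep p c) f₁) (h₂ : ∀ x ∈ att c.root, f₂ x = G.row i x)
    (h₂' : ∀ x, x ∉ att c.root → f₂ x = f₁ x) (h₃ : Accessed G c f₂ f₃ g₃ o) :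
    Accessed G (.join τ p c) f f₃ g₃ (o.map fun l => l₁ ++ i :: l) := by
  rcases o with - | l₂
  · exact h₃
  obtain ⟨-, h11, h12, h13⟩ := h₁
  obtain ⟨h30, h31, h32, h33⟩ := h₃
  have hp : ∀ x, p.Has x → f₃ x = f₁ x := by
    intro x hx
    by_cases hc : c.Has x
    · have hx := hv.2.2 x hx hc
      rw [h32 x hx.2, h₂ x hx.2]
      exact key_eq_iff.1 hk x (mem_sep.2 hx)
    · rw [h33 x hc, h₂' x fun h => hc (.inl h)]
  refine ⟨h30, ?_, fun x hx => (hp x (.inl hx)).trans (h12 x hx), fun x hx => ?_⟩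
  · intro j hj x hx
    rw [List.mem_append, List.mem_cons] at hj
    rcases hj with hj | rfl | hj
    · rw [hp x (hl₁.has hj hx), h11 j hj x hx]
    · rw [hi.2.2] at hx
      rw [h32 x hx, h₂ x hx]
    · exact h31 j hj x hx
  · rw [JT.has_join, not_or] at hx
    rw [h33 x hx.2, h₂' x fun h => hx.2 (.inl h), h13 x hx.1]

theorem runs_locateProg (hm : 1 ≤ m) (hL : m ≤ L.bits) {τ : ℕ} {p c : JT V}
    (hT : Clean G σ m (.join τ p c)) {f : V → Word A} {j : ℕ}
    (hj : j < σ (aCnt τ (key (sep p c) f))) {b : ℕ} (hb : 20 ≤ b) {g : ℕ → Word A}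
    (hgb : g b = .num j) {o : Option (List ℕ)}
    (ho : ((group σ τ 0 m (key (sep p c) f)).flatMap fun i =>
      (arr σ G.row m c (G.row i)).map (Option.map (i :: ·)))[j]? = some o) :
    Runs L (locateProg τ (sep p c) b c.root) f g (enc σ G.row) fun s f' g' M' =>
      s ≤ 6 * m + (att c.root).card + 10 ∧ M' = enc σ G.row ∧
      (∀ n, n < b → 20 ≤ n → g' n = g n) ∧ ∃ i j' o', G.Is i c.root ∧
        key (sep p c) (G.row i) = key (sep p c) f ∧ j' < 2 ^ L.bits ∧ g' b = .num j' ∧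
        (∀ x ∈ att c.root, f' x = G.row i x) ∧ (∀ x, x ∉ att c.root → f' x = f x) ∧
        (arr σ G.row m c (G.row i))[j']? = some o' ∧ o'.map (i :: ·) = o := by
  have hm2 : 2 ^ m ≤ 2 ^ L.bits := Nat.pow_le_pow_right (by omega) hL
  have h12 : 1 < 2 ^ L.bits := (Nat.one_lt_two_pow (by omega)).trans_le hm2
  have hlen := length_inner hT (key (sep p c) f)
  obtain ⟨hp, he, hmw, hmc, hc⟩ := hT
  generalize hkey : key (sep p c) f = k at *
  set inner := (group σ τ 0 m k).flatMap fun i =>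
    (arr σ G.row m c (G.row i)).map (Option.map (i :: ·)) with hinner
  have hcap : σ (aCnt τ k) ≤ σ (aCap τ k) := (he.cap k).le
  have hcapb := (hmc k).trans_le hm2
  rw [locateProg]
  have hwt : ∀ e j, j < σ (aBl τ (2 ^ e) k) → σ (aWt τ (σ (aBk τ (2 ^ e) j k))) = 2 ^ e :=
    fun e j hj => (he.buckets.mem _ _ _ hj).1
  have hF : ∀ e j, j < σ (aBl τ (2 ^ e) k) →
      (((fun i => (arr σ G.row m c (G.row i)).map (Option.map (i :: ·)))
        (σ (aBk τ (2 ^ e) j k))).length) = 2 ^ e := by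
    intro e j hj
    have hw := hwt e j hj
    have hi := he.wt_is (σ (aBk τ (2 ^ e) j k)) (by rw [hw]; positivity)
    have := he.wt_eq _ hi (Set.notMem_empty _)
    simp only at this
    rw [List.length_map, length_arr hc, ← this, hw]
  refine Runs.seq ((wp.runs_of_pure (Q := fun f' g' M' => f' = f ∧ M' = enc σ G.row ∧
    (∀ n, n < b → 20 ≤ n → g' n = g n) ∧ g' 2 = .num (2 ^ 0) ∧
    g' 3 = .num (σ (aBl τ (2 ^ 0) k) * 2 ^ 0) ∧ g' 4 = .num (j + 1) ∧
    g' b = .num j) (by simp [Prog.Pure, blockProg]) ?_).mono ?_)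
  · simp only [wp, blockProg, ev, List.map_cons, map_oKey, hkey]
    rw [enc_num _ _ (by omega), Function.update_self]
    simp only [Arith.eval]
    have hb0 : σ (aBl τ (2 ^ 0) k) * 2 ^ 0 < 2 ^ L.bits := by
      have hl := congrArg List.length (flatMap_group_succ (σ := σ) (τ := τ) (k := k)
        (F := fun i => (arr σ G.row m c (G.row i)).map (Option.map (i :: ·))) 0 (m - 1))
      rw [List.length_append, length_bucket hF, Nat.sub_add_cancel hm, ← hinner, hlen] at hl
      omega
    refine ⟨h12, σ (aBl τ (2 ^ 0) k), 1, by simp, by simp, by simpa using hb0, j, 1, ?_,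
      rfl, by omega, trivial, trivial, ?_, ?_, ?_, ?_, ?_⟩
    · rw [Function.update_of_ne (by omega), Function.update_of_ne (by omega),
        Function.update_of_ne (by omega), hgb]
    · intro n hn hn'
      rw [Function.update_of_ne (by omega), Function.update_of_ne (by omega),
        Function.update_of_ne (by omega), Function.update_of_ne (by omega)]
    · simp
    · simp
    · simp
    · rw [Function.update_of_ne (by omega), Function.update_of_ne (by omega),
        Function.update_of_ne (by omega), Function.update_of_ne (by omega), hgb]
  rintro k2 f2 g2 M2 ⟨hk2, rfl, rfl, hg2, h22, h23, h24, h2b⟩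
  have hk2 : k2 ≤ 4 := hk2
  refine Runs.seq ((runs_scanProg hkey hF hb m (by omega) (by rw [hlen]; omega)
    (by rw [hlen]; exact hj) h22 h23 h24 h2b).mono ?_)
  rintro k3 f3 g3 M3 ⟨hk3, rfl, rfl, hg3, e', j', he', h32, h3b, hj', hblk, hent⟩
  rw [hent] at ho
  have hidx : j' / 2 ^ e' < σ (aBl τ (2 ^ e') k) :=
    (Nat.div_lt_iff_lt_mul (Nat.two_pow_pos e')).2 hj'
  set i := σ (aBk τ (2 ^ e') (j' / 2 ^ e') k) with hi
  have hw := hwt e' _ hidx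
  rw [← hi] at hw
  have his : G.Is i c.root := he.wt_is i (by rw [hw]; positivity)
  have hik : key (sep p c) (G.row i) = key (sep p c) f3 :=
    ((he.buckets.mem _ _ _ hidx).2.2.1).trans hkey.symm
  rw [List.getElem?_map] at ho
  obtain ⟨o₃, ho₃, rfl⟩ := Option.map_eq_some_iff.1 ho
  have hmul' := Nat.div_mul_le_self j' (2 ^ e')
  have hmod' : j' - j' / 2 ^ e' * 2 ^ e' = j' % 2 ^ e' := by
    have := Nat.div_add_mod j' (2 ^ e')
    rw [Nat.mul_comm] at this
    omega
  have hdiv' := Nat.div_le_self j' (2 ^ e')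
  have hmod := Nat.mod_le j' (2 ^ e')
  refine ((wp.runs_of_pure (Q := fun f' g' M' => M' = enc σ G.row ∧
    (∀ n, n < b → 20 ≤ n → g' n = g3 n) ∧ g' b = .num (j' % 2 ^ e') ∧
    (∀ x ∈ att c.root, f' x = G.row i x) ∧ ∀ x, x ∉ att c.root → f' x = f3 x)
    (by simp [Prog.Pure, pickProg, pure_loadRow]) ?_).mono ?_)
  · simp only [wp, pickProg, ev, List.map_cons, map_oKey, hkey]
    simp only [Arith.eval]
    refine ⟨j', 2 ^ e', h3b, h32, by omega, j' / 2 ^ e', 2 ^ e', by simp, ?_, by omega, j',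
      j' / 2 ^ e' * 2 ^ e', ?_, by simp, by omega, ?_⟩
    · rw [Function.update_of_ne (by omega), Function.update_of_ne (by omega), h32]
    · rw [Function.update_of_ne (by omega), Function.update_of_ne (by omega),
        Function.update_of_ne (by omega), h3b]
    · rw [enc_num _ _ (by omega)]
      refine wp_loadRow (i := i) _ ?_ fun f' hf' hf'' => ⟨rfl, fun n hn hn' => ?_, ?_,
        fun x hx => hf' x (by simpa using hx), fun x hx => hf'' x (by simpa using hx)⟩
      · rw [Function.update_of_ne (by omega), Function.update_of_ne (by omega),
          Function.update_self, Function.update_self, Function.update_of_ne (by omega), h32, hi]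
      · rw [Function.update_of_ne (by omega), Function.update_of_ne (by omega),
          Function.update_of_ne (by omega), Function.update_of_ne (by omega)]
      · rw [Function.update_self, hmod']
  rintro k4 f4 g4 M4 ⟨hk4, rfl, hg4, h4b, hf4, hf4'⟩
  simp only [pickProg, Prog.cost, cost_loadRow, Finset.length_toList] at hk4
  refine ⟨?_, rfl, fun n hn hn' => ?_, i, _, o₃, his, hik.trans hkey, ?_, h4b, hf4, hf4', ho₃, rfl⟩
  · omega
  · rw [hg4 n hn hn', hg3 n hn hn', hg2 n hn hn']
  · omega

/-- Register `b` keeps the remainder while `p` is accessed with the quotient in register `b + 1`;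
the recursion preserves registers from `20` up to its own, so their number is bounded by the tree.
One scan of at most `m` buckets per edge gives the factor `m + 1`. -/
theorem runs_accessProg (hm : 1 ≤ m) (hL : m ≤ L.bits) {T : JT V} (hT : Clean G σ m T)
    (hv : T.Valid) {b : ℕ} (hb : 20 ≤ b) {f : V → Word A} {g : ℕ → Word A} {j : ℕ}
    (hj : j < 2 ^ L.bits) (hg : g b = .num j) {o : Option (List ℕ)}
    (ho : (arr σ G.row m T f)[j]? = some o) :
    Runs L (accessProg T b) f g (enc σ G.row) fun k f' g' M' => k ≤ accessCost T * (m + 1) ∧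
      M' = enc σ G.row ∧ (∀ n, n < b → 20 ≤ n → g' n = g n) ∧ Accessed G T f f' g' o := by
  have hm2 : 2 ^ m ≤ 2 ^ L.bits := Nat.pow_le_pow_right (by omega) hL
  have h12 : 1 < 2 ^ L.bits := (Nat.one_lt_two_pow (by omega)).trans_le hm2
  induction T generalizing b f g j o with
  | leaf a =>
    have : o = some [] := by
      rw [arr, List.getElem?_singleton] at ho
      split_ifs at ho
      exact (Option.some.inj ho).symm
    subst this
    refine Runs.move h12 ⟨?_, rfl, fun n _ hn => ?_, ?_⟩
    · rw [accessCost]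
      omega
    · rw [Function.update_of_ne (by omega)]
    · exact ⟨by simp [ev], by simp, by simp, by simp⟩
  | join τ p c ihp ihc =>
    have hlen := length_inner hT (key (sep p c) f)
    have hT' := hT
    obtain ⟨hp, he, hmw, hmc, hc⟩ := hT
    set k := key (sep p c) f with hk
    set cp := σ (aCap τ k) with hcp
    set inner := (group σ τ 0 m k).flatMap fun i =>
      (arr σ G.row m c (G.row i)).map (Option.map (i :: ·)) with hinner
    have hcap : σ (aCnt τ k) ≤ cp := (he.cap k).le
    have hplen : (pad cp inner).length = cp := length_pad (by rw [hlen]; exact hcap)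
    have hcp0 : 0 < cp := by
      by_contra h0
      have : arr σ G.row m (.join τ p c) f = [] := by
        apply List.eq_nil_of_length_eq_zero
        rw [arr, length_prod, hplen]
        simp only [Nat.eq_zero_of_not_pos h0, Nat.mul_zero]
      simp [this] at ho
    have hcpb : cp < 2 ^ L.bits := (hmc k).trans_le hm2
    rw [arr, getElem?_prod (by rw [hplen]; exact hcp0), hplen] at ho
    obtain ⟨o₁, ho₁, ho'⟩ := Option.bind_eq_some_iff.1 ho
    obtain ⟨o₂, ho₂, ho⟩ := Option.map_eq_some_iff.1 ho'
    clear ho'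
    have hdm := Nat.div_add_mod j cp
    have hdj := Nat.div_le_self j cp
    have hmj := Nat.mod_lt j hcp0
    have hsub : j - j / cp * cp = j % cp := by rw [Nat.mul_comm]; omega
    have hmul := Nat.div_mul_le_self j cp
    rw [accessProg]
    refine Runs.seq ((wp.runs_of_pure (Q := fun f' g' M' => f' = f ∧ M' = enc σ G.row ∧
      (∀ n, n < b → 20 ≤ n → g' n = g n) ∧ g' b = .num (j % cp) ∧ g' (b + 1) = .num (j / cp))
      (by simp [Prog.Pure, splitProg]) ?_).mono ?_)
    · simp only [wp, splitProg, ev, List.map_cons, map_oKey]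
      rw [enc_num _ _ (by omega)]
      simp only [Arith.eval]
      refine ⟨j, cp, ?_, by simp [hcp, hk], by omega, j / cp, cp, by simp, ?_, by omega, j,
        j / cp * cp, ?_, by simp, by omega, trivial, trivial, ?_, ?_, ?_⟩
      · rw [Function.update_of_ne (by omega), hg]
      · rw [Function.update_of_ne (by omega), Function.update_self]
      · rw [Function.update_of_ne (by omega), Function.update_of_ne (by omega),
          Function.update_of_ne (by omega), hg]
      · intro n hn hn'
        rw [Function.update_of_ne (by omega), Function.update_of_ne (by omega),
          Function.update_of_ne (by omega), Function.update_of_ne (by omega)]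
      · rw [Function.update_self, hsub]
      · rw [Function.update_of_ne (by omega), Function.update_of_ne (by omega),
          Function.update_self]
    rintro k0 f0 g0 M0 ⟨hk0, rfl, rfl, hg0, hg0b, hg0b'⟩
    have hk0 : k0 ≤ 4 := hk0
    refine Runs.seq ((ihp hp hv.1 (by omega) (by omega) hg0b' ho₁).mono ?_)
    rintro k1 f1 g1 M1 ⟨hk1, rfl, hg1, h₁⟩
    have hg1b : g1 b = .num (j % cp) := (hg1 b (by omega) (by omega)).trans hg0b
    -- A dummy in the first factor makes the entry of the product a dummy, and `c` need not be
    -- visited.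
    rcases o₁ with - | l₁
    · have h10 : g1 0 = .num 0 := h₁
      refine Runs.cond_eq (fun h => ?_) (fun _ => ?_)
      · simp [ev, h10] at h
      refine ⟨1, f1, g1, _, .skip _, ?_, rfl, fun n hn hn' => ?_, ?_⟩
      · rw [accessCost]
        nlinarith
      · rw [hg1 n (by omega) hn', hg0 n hn hn']
      · subst ho
        exact h10
    have h10 : g1 0 = .num 1 := h₁.1
    have hkey : key (sep p c) f1 = k :=
      key_eq_iff.2 fun x hx => h₁.2.2.1 x (mem_sep.1 hx).1
    refine Runs.cond_eq (fun _ => ?_) (fun h => (h (by simp [ev, h10])).elim)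
    refine Runs.seq (Runs.load ?_)
    simp only [oEdge, List.map_cons, map_oKey, ev, hkey]
    rw [enc_num _ _ (by omega)]
    -- Positions from the total weight up to the capacity are padding.
    refine Runs.cond_lt (j % cp) (σ (aCnt τ k)) ?_ (by simp [ev]) (fun hlt => ?_) (fun hlt => ?_)
    · simp only [ev]
      rw [Function.update_of_ne (by omega), hg1b]
    · rw [pad, List.getElem?_append_left (by rw [hlen]; exact hlt)] at ho₂
      refine Runs.seq ((runs_locateProg hm hL hT' (f := f1) (by rw [hkey]; exact hlt) hb
        (by rw [Function.update_of_ne (by omega), hg1b]) (by rw [hkey]; exact ho₂)).mono ?_)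
      rintro k4 f4 g4 M4 ⟨hk4, rfl, hg4, i, j', o₃, his, hik, hj', h4b, hf4, hf4', ho₃, rfl⟩
      refine (ihc hc hv.2.1 hb (by omega) h4b (by
        rw [arr_congr (f' := G.row i) hf4]
        exact ho₃)).mono ?_
      rintro k5 f5 g5 M5 ⟨hk5, rfl, hg5, h₅⟩
      refine ⟨?_, rfl, fun n hn hn' => ?_, ?_⟩
      · have e : accessCost (.join τ p c) * (m + 1) = accessCost p * (m + 1) +
            accessCost c * (m + 1) + (att c.root).card * (m + 1) + 30 * (m + 1) := by
          rw [accessCost]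
          ring
        have := Nat.le_mul_of_pos_right (att c.root).card (show 0 < m + 1 by omega)
        omega
      · rw [hg5 n hn hn', hg4 n hn hn', Function.update_of_ne (by omega), hg1 n (by omega) hn',
          hg0 n hn hn']
      · have hsel := (mem_arr hp _ _).1 (List.reduceOption_mem_iff.2 (List.mem_of_getElem? ho₁))
        have := Accessed.join (τ := τ) hv hsel h₁ his hik hf4 hf4' h₅
        rw [← ho, Option.bind_some, Option.map_map]
        exact this
    · rw [pad, List.getElem?_append_right (by rw [hlen]; omega), List.getElem?_replicate] at ho₂
      split_ifs at ho₂
      obtain rfl := Option.some.inj ho₂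
      have : o = none := by rw [← ho]; rfl
      subst this
      refine Runs.move (Nat.two_pow_pos _) ⟨?_, rfl, fun n hn hn' => ?_, ?_⟩
      · rw [accessCost]
        nlinarith
      · rw [Function.update_of_ne (by omega), Function.update_of_ne (by omega),
          hg1 n (by omega) hn', hg0 n hn hn']
      · exact Function.update_self ..

end Access

/-! ## The join results represented by an array -/

section Semantics

variable {V : Type u} {A : Type v} {G : Ghost V A}

theorem Sel.is {T : JT V} {f : V → Word A} {l : List ℕ} (h : Sel G T f l) {i : ℕ} (hi : i ∈ l) :
    G.Is i (G.rel i) := by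
  induction T generalizing f l with
  | leaf =>
    rw [Sel] at h
    simp [h] at hi
  | join τ p c ihp ihc =>
    obtain ⟨l₁, j, l₂, rfl, h1, h2, -, h3⟩ := h
    rw [List.mem_append, List.mem_cons] at hi
    rcases hi with hi | rfl | hi
    · exact ihp h1 hi
    · exact ⟨h2.1, h2.2.1, rfl⟩
    · exact ihc h3 hi

/-- Tuples that match along the edges have a common extension: the assignments for `p` and `c` are
glued, and they can overlap only in the key. `Accessed.join` is reused as a statement about
assignments, with a constant register function. -/
theorem Sel.exists_accessed {T : JT V} (hv : T.Valid) {f : V → Word A} {l : List ℕ}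
    (h : Sel G T f l) : ∃ f', Accessed G T f f' (fun _ => .num 1) (some l) := by
  classical
  induction T generalizing f l with
  | leaf =>
    rw [Sel] at h
    subst h
    exact ⟨f, rfl, by simp, by simp, by simp⟩
  | join τ p c ihp ihc =>
    obtain ⟨l₁, i, l₂, rfl, h1, h2, hk, h3⟩ := h
    obtain ⟨f₁, hf₁⟩ := ihp hv.1 h1
    obtain ⟨f₃, hf₃⟩ := ihc hv.2.1 h3
    have hk' : key (sep p c) (G.row i) = key (sep p c) f₁ := by
      rw [hk]
      exact key_eq_iff.2 fun x hx => (hf₁.2.2.1 x (mem_sep.1 hx).1).symm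
    refine ⟨fun x => if c.Has x then f₃ x else f₁ x, ?_⟩
    refine Accessed.join hv (f₂ := fun x => if x ∈ att c.root then G.row i x else f₁ x) h1 hf₁ h2
      hk' (fun x hx => if_pos hx) (fun x hx => if_neg hx) (o := some l₂) ⟨rfl, ?_, ?_, ?_⟩
    · intro j hj x hx
      beta_reduce
      rw [if_pos (h3.has hj hx)]
      exact hf₃.2.1 j hj x hx
    · intro x hx
      beta_reduce
      rw [if_pos (show c.Has x from .inl hx), if_pos hx]
      exact hf₃.2.2.1 x hx
    · intro x hx
      beta_reduce
      rw [if_neg hx, if_neg fun h => hx (.inl h)]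

/-- The assignment `q` extends the tuple `f` at the root of `T` and the tuples in `l`. -/
def Extends (G : Ghost V A) (T : JT V) (f : V → Word A) (l : List ℕ) (q : V → Word A) : Prop :=
  (∀ x ∈ att T.root, f x = q x) ∧ ∀ i ∈ l, ∀ x ∈ att (G.rel i), G.row i x = q x

theorem Sel.exists_of_extends {T : JT V} {f q : V → Word A} (hf : ∀ x ∈ att T.root, f x = q x)
    (h : ∀ a ∈ T.labs, ∃ i, G.Is i a ∧ ∀ x ∈ att a, G.row i x = q x) :
    ∃ l, Sel G T f l ∧ Extends G T f l q := by
  induction T generalizing f with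
  | leaf => exact ⟨[], rfl, hf, by simp⟩
  | join τ p c ihp ihc =>
    simp only [JT.labs, List.mem_append, List.mem_cons] at h
    obtain ⟨l₁, h1, h1'⟩ := ihp hf fun a ha => h a (.inl ha)
    obtain ⟨i, hi, hi'⟩ := h c.root (.inr (.inl rfl))
    obtain ⟨l₂, h2, h2'⟩ := ihc hi' fun a ha => h a (.inr (.inr ha))
    refine ⟨l₁ ++ i :: l₂, ⟨l₁, i, l₂, rfl, h1, hi, ?_, h2⟩, hf, ?_⟩
    · refine key_eq_iff.2 fun x hx => ?_
      rw [mem_sep] at hx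
      rw [hi' x hx.2, hf x hx.1]
    · intro j hj x hx
      rw [List.mem_append, List.mem_cons] at hj
      rcases hj with hj | rfl | hj
      · exact h1'.2 j hj x hx
      · rw [hi.2.2] at hx
        exact hi' x hx
      · exact h2'.2 j hj x hx

/-- A join result determines its tuple in every relation, and by `hG` equal tuples have equal
numbers. Thus no join result occurs twice in the array. -/
theorem Sel.eq_of_extends (hG : ∀ i j a, G.Is i a → G.Is j a →
    (∀ x ∈ att a, G.row i x = G.row j x) → i = j) {T : JT V} {f q : V → Word A} {l l' : List ℕ}
    (h : Sel G T f l) (h' : Sel G T f l') (hq : ∀ i ∈ l, ∀ x ∈ att (G.rel i), G.row i x = q x)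
    (hq' : ∀ i ∈ l', ∀ x ∈ att (G.rel i), G.row i x = q x) : l = l' := by
  induction T generalizing f l l' with
  | leaf => exact Eq.trans h (Eq.symm h')
  | join τ p c ihp ihc =>
    obtain ⟨l₁, i, l₂, rfl, h1, h2, -, h3⟩ := h
    obtain ⟨l₁', i', l₂', rfl, h1', h2', -, h3'⟩ := h'
    simp only [List.mem_append, List.mem_cons] at hq hq'
    have e1 := ihp h1 h1' (fun i hi => hq i (.inl hi)) fun i hi => hq' i (.inl hi)
    have e2 : i = i' := by
      refine hG i i' c.root h2 h2' fun x hx => ?_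
      rw [hq i (.inr (.inl rfl)) x (by rwa [h2.2.2]), hq' i' (.inr (.inl rfl)) x (by rwa [h2'.2.2])]
    subst e2
    rw [e1, ihc h3 h3' (fun i hi => hq i (.inr (.inr hi))) fun i hi => hq' i (.inr (.inr hi))]

end Semantics

/-! ### From arrays of tuple numbers to arrays of join results -/

section Represents

variable {V : Type u} [Encodable V]

/-- Returns the size of the array for the tree `T` and the tuple in the attribute registers. -/
noncomputable def sizeProg (T : JT V) : Prog (Reg V) :=
  .seq (weightProg T) (.move (.inr 0) (rg 1))

/-- Returns an entry of the array for the tree `T` and the tuple in the attribute registers. -/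
noncomputable def entryProg (T : JT V) : Prog (Reg V) :=
  .seq (.move (.inr 20) (rg 0)) (accessProg T 20)

omit [Encodable V] in
theorem pure_weightProg (T : JT V) : (weightProg T).Pure := by
  induction T with
  | leaf => trivial
  | join τ p c ihp _ => exact ⟨ihp, trivial, trivial⟩

variable {dom : V → Type v}

/-- The words for the values of `q`. -/
def word (q : ∀ x, dom x) (x : V) : Word (Value dom) := .atom ⟨x, q x⟩

omit [Encodable V] in
theorem word_injective : Function.Injective (word : (∀ x, dom x) → V → Word (Value dom)) := by
  intro q q' h
  funext x
  have := congrFun h x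
  simpa [word] using this

/-- The join results that extend the tuple `f` at the root of `T`. -/
def joins (G : Ghost V (Value dom)) (T : JT V) (f : V → Word (Value dom)) : Set (∀ x, dom x) :=
  {q | (∀ x ∈ att T.root, f x = word q x) ∧
    ∀ a ∈ T.labs, ∃ i, G.Is i a ∧ ∀ x ∈ att a, G.row i x = word q x}

open Classical in
/-- The join result that consists of the tuples in `l`. -/
noncomputable def result (G : Ghost V (Value dom)) (T : JT V) (f : V → Word (Value dom))
    (l : List ℕ) : Option (∀ x, dom x) :=
  if h : Sel G T f l ∧ ∃ q, Extends G T f l (word q) then some h.2.choose else none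

variable {G : Ghost V (Value dom)} {T : JT V} {f : V → Word (Value dom)} {l : List ℕ}
  {q : ∀ x, dom x}

omit [Encodable V] in
-- Every attribute occurs at some node of the tree, so the tuples of a selection fix all values.
theorem Extends.eq (hcov : ∀ x, T.Has x) (hl : Sel G T f l) {q q' : V → Word (Value dom)}
    (h : Extends G T f l q) (h' : Extends G T f l q') : q = q' := by
  funext x
  rcases hcov x with hx | ⟨a, ha, hx⟩
  · rw [← h.1 x hx, ← h'.1 x hx]
  · rw [← hl.map_rel] at ha
    obtain ⟨i, hi, rfl⟩ := List.mem_map.1 ha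
    rw [← h.2 i hi x hx, ← h'.2 i hi x hx]

omit [Encodable V] in
theorem result_eq_some_iff (hcov : ∀ x, T.Has x) :
    result G T f l = some q ↔ Sel G T f l ∧ Extends G T f l (word q) := by
  unfold result
  split_ifs with h
  · rw [Option.some.injEq]
    constructor
    · rintro rfl
      exact ⟨h.1, h.2.choose_spec⟩
    · rintro ⟨h1, h2⟩
      exact word_injective (Extends.eq hcov h1 h.2.choose_spec h2)
  · simp only [false_iff]
    exact fun h' => h ⟨h'.1, q, h'.2⟩

omit [Encodable V] in
theorem exists_extends (hcov : ∀ x, T.Has x) (hv : T.Valid)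
    (hf : ∀ x ∈ att T.root, ∃ v, f x = .atom ⟨x, v⟩)
    (hrow : ∀ i a, G.Is i a → ∀ x ∈ att a, ∃ v, G.row i x = .atom ⟨x, v⟩) (hl : Sel G T f l) :
    ∃ q, Extends G T f l (word q) := by
  obtain ⟨f', -, h1, h2, -⟩ := hl.exists_accessed hv
  have : ∀ x, ∃ v : dom x, f' x = .atom ⟨x, v⟩ := by
    intro x
    rcases hcov x with hx | ⟨a, ha, hx⟩
    · rw [h2 x hx]
      exact hf x hx
    · rw [← hl.map_rel] at ha
      obtain ⟨i, hi, rfl⟩ := List.mem_map.1 ha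
      rw [h1 i hi x hx]
      exact hrow i _ (hl.is hi) x hx
  choose q hq using this
  exact ⟨q, fun x hx => by rw [word, ← hq, h2 x hx],
    fun i hi x hx => by rw [word, ← hq, h1 i hi x hx]⟩

omit [Encodable V] in
theorem result_isSome (hcov : ∀ x, T.Has x) (hv : T.Valid)
    (hf : ∀ x ∈ att T.root, ∃ v, f x = .atom ⟨x, v⟩)
    (hrow : ∀ i a, G.Is i a → ∀ x ∈ att a, ∃ v, G.row i x = .atom ⟨x, v⟩) (hl : Sel G T f l) :
    ∃ q, result G T f l = some q := by
  obtain ⟨q, hq⟩ := exists_extends hcov hv hf hrow hl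
  exact ⟨q, (result_eq_some_iff hcov).2 ⟨hl, hq⟩⟩

theorem represents {L : Limits} {σ : Key (Value dom) → ℕ} {m N : ℕ} (hm : 1 ≤ m) (hL : m ≤ L.bits)
    (hT : Clean G σ m T) {us : List (Edge V)} (hus : ∀ e ∈ T.paths us, ∃ D, EInv G σ e.1 D)
    (hN : G.n ≤ N) (hb : (2 * N + 2) ^ T.size < 2 ^ L.bits) (hcov : ∀ x, T.Has x) (hv : T.Valid)
    (hf : ∀ x ∈ att T.root, ∃ v, f x = .atom ⟨x, v⟩)
    (hrow : ∀ i a, G.Is i a → ∀ x ∈ att a, ∃ v, G.row i x = .atom ⟨x, v⟩)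
    (hG : ∀ i j a, G.Is i a → G.Is j a → (∀ x ∈ att a, G.row i x = G.row j x) → i = j)
    {φ : ℝ} (hφ : φ ≤ T.density) {a b : ℕ} (ha : (sizeProg T).cost ≤ a)
    (hb' : accessCost T * (m + 1) + 1 ≤ b) :
    Represents L (enc σ G.row) (sizeProg T) (entryProg T) (Sum.elim f fun _ => .num 0)
      (joins G T f) φ a b := by
  have hmem : ∀ l, some l ∈ arr σ G.row m T f → Sel G T f l := fun l hl =>
    (mem_arr hT f l).1 (List.reduceOption_mem_iff.2 hl)
  have hlen := length_arr hT f
  have hWb : W σ T f < 2 ^ L.bits := by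
    have := (weight_bound (X := 2 * N + 2) (by omega) T us hus).1 f
    exact ((Nat.le_mul_of_pos_right _ (by omega)).trans this).trans_lt hb
  -- Every real entry is a selection with a join result, so this map creates no further dummies and
  -- the density carries over.
  refine ⟨(arr σ G.row m T f).map fun o => o.bind (result G T f), fun q => ?_, ?_, ?_, ?_, ?_⟩
  · rw [List.reduceOption_mem_iff, List.mem_map]
    constructor
    · rintro ⟨o, -, ho⟩
      obtain ⟨l, -, hl⟩ := Option.bind_eq_some_iff.1 ho
      obtain ⟨h1, h2⟩ := (result_eq_some_iff hcov).1 hl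
      refine ⟨h2.1, fun a ha => ?_⟩
      rw [← h1.map_rel] at ha
      obtain ⟨i, hi, rfl⟩ := List.mem_map.1 ha
      exact ⟨i, h1.is hi, h2.2 i hi⟩
    · rintro ⟨h1, h2⟩
      obtain ⟨l, hl, hq⟩ := Sel.exists_of_extends h1 h2
      exact ⟨some l, List.reduceOption_mem_iff.1 ((mem_arr hT f l).2 hl),
        (result_eq_some_iff hcov).2 ⟨hl, hq⟩⟩
  · have : ((arr σ G.row m T f).map fun o => o.bind (result G T f)).reduceOption =
        (arr σ G.row m T f).reduceOption.filterMap (result G T f) := by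
      rw [List.reduceOption, List.reduceOption, List.filterMap_map, List.filterMap_filterMap]
      rfl
    rw [this]
    refine (nodup_arr hT f).filterMap fun l l' q hq hq' => ?_
    obtain ⟨h1, h2⟩ := (result_eq_some_iff hcov).1 hq
    obtain ⟨h1', h2'⟩ := (result_eq_some_iff hcov).1 hq'
    exact Sel.eq_of_extends hG h1 h1' h2.2 h2'.2
  · refine ((dense_arr hT f).map fun o ho => ?_).mono hφ
    rcases o with - | l
    · rfl
    · obtain ⟨q, hq⟩ := result_isSome hcov hv hf hrow (hmem l ho)
      simp [hq]
  · obtain ⟨k, f', g', M', he, hk, h0, rfl⟩ := wp.runs_of_pure (L := L) (c := sizeProg T)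
      (Q := fun f' g' M' => g' 0 = .num (W σ T f) ∧ M' = enc σ G.row) ⟨pure_weightProg T, trivial⟩
      (wp_weightProg (X := 2 * N + 2) (by omega) T us hus hb (by omega)
        (g := fun _ => .num 0) (f := f) fun g' _ h1 => by
          simp only [wp, ev, h1]
          exact ⟨hWb, by simp, trivial⟩)
    exact ⟨k, hk.trans ha, _, he, by rw [List.length_map, hlen]; exact h0⟩
  · intro j hj
    rw [List.length_map] at hj
    have hs : withPosition (Sum.elim f fun _ => .num 0) j =
        Sum.elim f (Function.update (fun _ => .num 0) 0 (.num j)) := by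
      funext r
      rcases r with x | n
      · simp [withPosition]
      · by_cases hn : n = 0 <;> simp [withPosition, hn]
    have hjb : j < 2 ^ L.bits := by omega
    rw [hs]
    have hr : Runs L (entryProg T) f (Function.update (fun _ => .num 0) 0 (.num j)) (enc σ G.row)
        fun k f' g' M' => k ≤ accessCost T * (m + 1) + 1 ∧ M' = enc σ G.row ∧
          Accessed G T f f' g' (arr σ G.row m T f)[j] := by
      refine Runs.seq (Runs.move ?_ ?_)
      · exact hjb
      · refine (runs_accessProg hm hL hT hv le_rfl hjb (by simp [ev])
          (List.getElem?_eq_getElem hj)).mono ?_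
        rintro k f' g' M' ⟨h1, h2, -, h3⟩
        exact ⟨by omega, h2, h3⟩
    obtain ⟨k, f', g', M', he, hk, rfl, h⟩ := hr
    refine ⟨k, hk.trans hb', _, he, ?_⟩
    rw [List.getElem_map]
    have hj' := List.getElem_mem hj
    rcases ho : (arr σ G.row m T f)[j] with - | l
    · rw [ho] at h
      exact h
    · rw [ho] at h hj'
      have hl := hmem l hj'
      obtain ⟨q, hq⟩ := result_isSome hcov hv hf hrow hl
      rw [Option.bind_some, hq]
      refine ⟨h.1, fun x => ?_⟩
      have := Extends.eq hcov hl (q := f') ⟨fun x hx => (h.2.2.1 x hx).symm,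
        fun i hi x hx => (h.2.1 i hi x hx).symm⟩ ((result_eq_some_iff hcov).1 hq).2
      exact congrFun this x

end Represents

/-! ## Join trees of acyclic joins -/

section JoinTrees

open SimpleGraph

/-- A walk inside `X` either avoids the edge or traverses it, and then both ends of the edge lie in
`X`. -/
theorem reachable_of_induce {ι : Type*} {T : SimpleGraph ι} {X : Set ι} {r w : ι} {a b : X}
    (h : (T.induce X).Reachable a b) :
    (T.deleteEdges {s(r, w)}).Reachable a b ∨ (r ∈ X ∧ w ∈ X) := by
  obtain ⟨p⟩ := h
  induction p with
  | nil => exact .inl (Reachable.refl _)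
  | @cons a b c h p ih =>
    rcases ih with ih | ih
    · by_cases he : s((a : ι), (b : ι)) = s(r, w)
      · right
        rcases Sym2.eq_iff.1 he with ⟨rfl, rfl⟩ | ⟨rfl, rfl⟩
        · exact ⟨a.2, b.2⟩
        · exact ⟨b.2, a.2⟩
      · left
        refine Reachable.trans (Adj.reachable ?_) ih
        rw [deleteEdges_adj]
        exact ⟨h, he⟩
    · exact .inr ih

theorem reachable_deleteEdges {ι : Type*} {H : SimpleGraph ι} {r w a : ι}
    (h : H.Reachable r a) : (H.deleteEdges {s(r, w)}).Reachable r a ∨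
      (H.deleteEdges {s(r, w)}).Reachable w a := by
  obtain ⟨p⟩ := h.symm
  clear h
  induction p with
  | nil => exact .inl (Reachable.refl _)
  | @cons a b c h p ih =>
    by_cases he : s(a, b) = s(c, w)
    · rcases Sym2.eq_iff.1 he with ⟨rfl, rfl⟩ | ⟨rfl, rfl⟩
      · exact .inl (Reachable.refl _)
      · exact .inr (Reachable.refl _)
    · have hab : (H.deleteEdges {s(c, w)}).Reachable b a := by
        refine Adj.reachable (Adj.symm ?_)
        rw [deleteEdges_adj]
        exact ⟨h, he⟩
      rcases ih with ih | ih
      · exact .inl (ih.trans hab)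
      · exact .inr (ih.trans hab)

variable {V : Type u}

/-- Induction on the number of edges: remove an edge from `r` to `w`, build trees rooted at `r` and
at `w` in the same remaining graph, and join them. The removed edge is a bridge of `T`, so for an
attribute on both sides a connecting walk must cross it, and both `r` and `w` contain the attribute.
The interval from `n` to `n'` supplies fresh tags. -/
theorem JoinQuery.exists_joinTree {Q : JoinQuery V} {T : SimpleGraph {e // e ∈ Q.rels}}
    (hT : T.IsTree) (hx : ∀ x : V, (T.induce {e | x ∈ e.1}).Preconnected) (k : ℕ)
    (H : SimpleGraph {e // e ∈ Q.rels}) (hk : H.edgeSet.ncard = k) (hH : H ≤ T)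
    (r : {e // e ∈ Q.rels}) (n : ℕ) :
    ∃ (J : JT V) (n' : ℕ), n ≤ n' ∧ J.tags.Nodup ∧ (∀ t ∈ J.tags, n ≤ t ∧ t < n') ∧
      J.root = some r.1 ∧ J.Valid ∧
      (∀ e : {e // e ∈ Q.rels}, H.Reachable r e → e = r ∨ some e.1 ∈ J.labs) ∧
      ∀ a ∈ J.labs, ∃ e : {e // e ∈ Q.rels}, a = some e.1 ∧ H.Reachable r e ∧ e ≠ r := by
  classical
  induction k using Nat.strong_induction_on generalizing H r n with
  | _ k ih =>
  by_cases hw : ∃ w, H.Adj r w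
  · obtain ⟨w, hw⟩ := hw
    set H' := H.deleteEdges {s(r, w)} with hH'
    have hle : H' ≤ H := deleteEdges_le _
    have hcard : H'.edgeSet.ncard < k := by
      rw [hH', edgeSet_deleteEdges, ← hk]
      exact Set.ncard_sdiff_singleton_lt_of_mem hw (Set.toFinite _)
    obtain ⟨p, n₁, hn₁, hp1, hp2, hp3, hp4, hp5, hp6⟩ :=
      ih _ hcard H' rfl (hle.trans hH) r (n + 1)
    obtain ⟨c, n₂, hn₂, hc1, hc2, hc3, hc4, hc5, hc6⟩ := ih _ hcard H' rfl (hle.trans hH) w n₁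
    have hbr : ¬(T.deleteEdges {s(r, w)}).Reachable r w :=
      isBridge_iff.1 ((isAcyclic_iff_forall_adj_isBridge.1 hT.2) (hH hw))
    have hmono : H' ≤ T.deleteEdges {s(r, w)} := deleteEdges_mono hH
    have hrw : ¬H'.Reachable w r := fun h => hbr ((h.mono hmono).symm)
    have hpx : ∀ x, p.Has x → ∃ a : {e // e ∈ Q.rels}, x ∈ a.1 ∧ H'.Reachable r a := by
      rintro x (hx | ⟨_, ha, hx⟩)
      · rw [hp3] at hx
        exact ⟨r, hx, Reachable.refl _⟩
      · obtain ⟨e, rfl, he, -⟩ := hp6 _ ha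
        exact ⟨e, hx, he⟩
    have hcx : ∀ x, c.Has x → ∃ a : {e // e ∈ Q.rels}, x ∈ a.1 ∧ H'.Reachable w a := by
      rintro x (hx | ⟨_, ha, hx⟩)
      · rw [hc3] at hx
        exact ⟨w, hx, Reachable.refl _⟩
      · obtain ⟨e, rfl, he, -⟩ := hc6 _ ha
        exact ⟨e, hx, he⟩
    refine ⟨.join n p c, n₂, by omega, ?_, ?_, hp3, ⟨hp4, hc4, ?_⟩, ?_, ?_⟩
    · rw [JT.tags, List.nodup_cons, List.nodup_append, List.mem_append, not_or]
      refine ⟨⟨fun h => ?_, fun h => ?_⟩, hp1, hc1, fun t ht t' ht' htt => ?_⟩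
      · have := hp2 _ h
        omega
      · have := hc2 _ h
        omega
      · have := hp2 _ ht
        have := hc2 _ ht'
        omega
    · intro t ht
      rw [JT.tags, List.mem_cons, List.mem_append] at ht
      rcases ht with rfl | ht | ht
      · omega
      · have := hp2 _ ht
        omega
      · have := hc2 _ ht
        omega
    · intro x hxp hxc
      obtain ⟨a, ha, hra⟩ := hpx x hxp
      obtain ⟨b, hb, hwb⟩ := hcx x hxc
      rw [hp3, hc3]
      rcases reachable_of_induce (r := r) (w := w) (hx x ⟨a, ha⟩ ⟨b, hb⟩) with h | h
      · exact (hbr (((hra.mono hmono).trans h).trans (hwb.mono hmono).symm)).elim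
      · exact h
    · intro e he
      simp only [JT.labs, List.mem_append, List.mem_cons]
      rcases reachable_deleteEdges (w := w) he with h | h
      · rcases hp5 e h with h | h
        · exact .inl h
        · exact .inr (.inl h)
      · rcases hc5 e h with rfl | h
        · exact .inr (.inr (.inl hc3.symm))
        · exact .inr (.inr (.inr h))
    · intro a ha
      simp only [JT.labs, List.mem_append, List.mem_cons] at ha
      rcases ha with ha | rfl | ha
      · obtain ⟨e, h1, h2, h3⟩ := hp6 a ha
        exact ⟨e, h1, h2.mono hle, h3⟩
      · exact ⟨w, hc3, hw.reachable, hw.ne'⟩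
      · obtain ⟨e, h1, h2, -⟩ := hc6 a ha
        refine ⟨e, h1, hw.reachable.trans (h2.mono hle), ?_⟩
        rintro rfl
        exact hrw h2
  · refine ⟨.leaf (some r.1), n, le_rfl, List.nodup_nil, by simp [JT.tags], rfl, trivial, ?_, ?_⟩
    · rintro e ⟨p⟩
      cases p with
      | nil => exact .inl rfl
      | cons h _ => exact (hw ⟨_, h⟩).elim
    · simp [JT.labs]

/-- `J` is a join tree of the query with root `r`. -/
structure JoinQuery.IsJoinTree (Q : JoinQuery V) (J : JT V) (r : Finset V) : Prop where
  root : J.root = some r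
  valid : J.Valid
  mem_labs : ∀ a, a ∈ J.labs ↔ ∃ e ∈ Q.rels, e ≠ r ∧ a = some e

/-- All rooted join trees of the query can be assembled below an additional root. -/
theorem JoinQuery.Acyclic.exists_joinTrees {Q : JoinQuery V} (hQ : Q.Acyclic) :
    ∃ S : JT V, S.root = none ∧ S.tags.Nodup ∧ ∀ r ∈ Q.rels, ∃ e ∈ S.paths [],
      e.1.par = none ∧ Q.IsJoinTree e.1.c r := by
  classical
  obtain ⟨T, hT, hx⟩ := hQ
  suffices h : ∀ R : Finset (Finset V), R ⊆ Q.rels → ∃ (S : JT V) (n : ℕ), S.root = none ∧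
      S.tags.Nodup ∧ (∀ t ∈ S.tags, t < n) ∧ ∀ r ∈ R, ∃ e ∈ S.paths [],
        e.1.par = none ∧ Q.IsJoinTree e.1.c r by
    obtain ⟨S, -, h1, h2, -, h3⟩ := h Q.rels subset_rfl
    exact ⟨S, h1, h2, h3⟩
  intro R
  induction R using Finset.induction_on with
  | empty => exact fun _ => ⟨.leaf none, 0, rfl, List.nodup_nil, by simp [JT.tags], by simp⟩
  | insert r R _ ih =>
    intro hR
    obtain ⟨S, n, h1, h2, h3, h4⟩ := ih ((Finset.subset_insert r R).trans hR)
    have hr : r ∈ Q.rels := hR (Finset.mem_insert_self r R)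
    obtain ⟨J, n', hn, hJ1, hJ2, hJ3, hJ4, hJ5, hJ6⟩ :=
      exists_joinTree hT hx _ T rfl le_rfl ⟨r, hr⟩ (n + 1)
    refine ⟨.join n S J, n', h1, ?_, ?_, ?_⟩
    · rw [JT.tags, List.nodup_cons, List.nodup_append, List.mem_append, not_or]
      refine ⟨⟨fun h => ?_, fun h => ?_⟩, h2, hJ1, fun t ht t' ht' htt => ?_⟩
      · exact (h3 _ h).false
      · have := hJ2 _ h
        omega
      · have := h3 _ ht
        have := hJ2 _ ht'
        omega
    · intro t ht
      rw [JT.tags, List.mem_cons, List.mem_append] at ht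
      rcases ht with rfl | ht | ht
      · omega
      · have := h3 _ ht
        omega
      · exact (hJ2 _ ht).2
    · intro r' hr'
      rcases Finset.mem_insert.1 hr' with rfl | hr'
      · refine ⟨_, List.mem_cons_self, h1, hJ3, hJ4, fun a => ⟨fun ha => ?_, ?_⟩⟩
        · obtain ⟨e, rfl, -, he⟩ := hJ6 a ha
          exact ⟨e.1, e.2, fun h => he (Subtype.ext h), rfl⟩
        · rintro ⟨e, he, her, rfl⟩
          rcases hJ5 ⟨e, he⟩ (hT.1.preconnected _ _) with h | h
          · exact (her (congrArg Subtype.val h)).elim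
          · exact h
      · obtain ⟨e, he, h⟩ := h4 r' hr'
        exact ⟨e, List.mem_cons_of_mem _ (List.mem_append_left _ he), h⟩

end JoinTrees

/-! ## The index for a stream -/

section Stream

variable {V : Type u} [Encodable V] {Q : JoinQuery V} {dom : V → Type v}

/-- The tuple number `i` is the tuple `t`. -/
def Holds (G : Ghost V (Value dom)) (i : ℕ) (t : Q.Fact dom) : Prop :=
  G.Is i (some t.1.1) ∧ ∀ x (h : x ∈ t.1.1), G.row i x = .atom ⟨x, t.2 ⟨x, h⟩⟩

/-- The tuples of `G` are the tuples of the stream `D`. -/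
structure Reflects (G : Ghost V (Value dom)) (D : List (Q.Fact dom)) : Prop where
  le : G.n ≤ D.length
  mem : ∀ t ∈ D, ∃ i, Holds G i t
  holds : ∀ i, 1 ≤ i → i ≤ G.n → ∃ t ∈ D, Holds G i t

omit [Encodable V] in
theorem Holds.eq {G : Ghost V (Value dom)} {i : ℕ} {t t' : Q.Fact dom} (h : Holds G i t)
    (h' : Holds G i t') : t = t' := by
  obtain ⟨⟨e, he⟩, t⟩ := t
  obtain ⟨⟨e', he'⟩, t'⟩ := t'
  obtain rfl : e = e' := Option.some.inj (h.1.2.2.symm.trans h'.1.2.2)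
  congr 1
  funext ⟨x, hx⟩
  have := (h.2 x hx).symm.trans (h'.2 x hx)
  simpa using this

omit [Encodable V] in
theorem Reflects.mem_iff {G : Ghost V (Value dom)} {D : List (Q.Fact dom)} (h : Reflects G D)
    {t : Q.Fact dom} : t ∈ D ↔ ∃ i, Holds G i t := by
  refine ⟨h.mem t, ?_⟩
  rintro ⟨i, hi⟩
  obtain ⟨t', ht', hi'⟩ := h.holds i hi.1.1 hi.1.2.1
  exact hi.eq hi' ▸ ht'

omit [Encodable V] in
theorem Reflects.atom {G : Ghost V (Value dom)} {D : List (Q.Fact dom)} (h : Reflects G D) (i : ℕ)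
    (a : Lab V) (hi : G.Is i a) (x : V) (hx : x ∈ att a) : ∃ v, G.row i x = .atom ⟨x, v⟩ := by
  obtain ⟨t, -, ht⟩ := h.holds i hi.1 hi.2.1
  obtain rfl := hi.2.2.symm.trans ht.1.2.2
  exact ⟨_, ht.2 x hx⟩

/-- The attribute registers for a tuple. -/
noncomputable def tupleWords {e : Finset V} (t : Tuple dom e) (x : V) : Word (Value dom) :=
  tupleInput t (.inl x)

omit [Encodable V] in
theorem tupleWords_of_mem {e : Finset V} (t : Tuple dom e) {x : V} (hx : x ∈ e) :
    tupleWords t x = .atom ⟨x, t ⟨x, hx⟩⟩ :=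
  dif_pos hx

omit [Encodable V] in
theorem tupleInput_eq {e : Finset V} (t : Tuple dom e) :
    tupleInput t = Sum.elim (tupleWords t) fun _ => .num 0 := by
  funext r
  rcases r with x | n <;> rfl

omit [Encodable V] in
theorem Reflects.insert {G : Ghost V (Value dom)} {D : List (Q.Fact dom)} (h : Reflects G D)
    (t : Q.Fact dom) : Reflects (G.insert (some t.1.1) (tupleWords t.2)) (D ++ [t]) := by
  unfold Ghost.insert
  split_ifs with hd
  · obtain ⟨i, hi, hk⟩ := hd
    refine ⟨by have := h.le; simp; omega, fun t' ht' => ?_, fun i h1 h2 => ?_⟩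
    · rcases List.mem_append.1 ht' with ht' | ht'
      · exact h.mem t' ht'
      · obtain rfl := List.mem_singleton.1 ht'
        exact ⟨i, hi, fun x hx => (key_eq_iff.1 hk x hx).trans (tupleWords_of_mem _ hx)⟩
    · obtain ⟨t', ht', hi'⟩ := h.holds i h1 h2
      exact ⟨t', List.mem_append_left _ ht', hi'⟩
  · have hold : ∀ i (t' : Q.Fact dom), Holds G i t' →
        Holds (G.add (some t.1.1) (tupleWords t.2)) i t' := fun i t' hi =>
      ⟨Ghost.add_is.2 (.inl hi.1), by rw [Ghost.add_row hi.1.ne]; exact hi.2⟩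
    have hnew : Holds (G.add (some t.1.1) (tupleWords t.2)) (G.n + 1) t :=
      ⟨Ghost.add_is.2 (.inr ⟨rfl, rfl⟩),
        fun x hx => (Ghost.add_row_new hx).trans (tupleWords_of_mem _ hx)⟩
    refine ⟨by have := h.le; simp [Ghost.add]; omega, fun t' ht' => ?_, fun i h1 h2 => ?_⟩
    · rcases List.mem_append.1 ht' with ht' | ht'
      · obtain ⟨i, hi⟩ := h.mem t' ht'
        exact ⟨i, hold i t' hi⟩
      · obtain rfl := List.mem_singleton.1 ht'
        exact ⟨_, hnew⟩
    · by_cases hi : i = G.n + 1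
      · exact ⟨t, by simp, hi ▸ hnew⟩
      · have h2 : i ≤ G.n + 1 := h2
        obtain ⟨t', ht', hi'⟩ := h.holds i h1 (by omega)
        exact ⟨t', List.mem_append_left _ ht', hold i t' hi'⟩

theorem Inv.empty (S : JT V) :
    Inv S (⟨0, fun _ => none, fun _ _ => .num 0⟩ : Ghost V (Value dom)) (fun _ => 0)
      fun _ => ∅ := by
  have hno : ∀ i a, ¬(⟨0, fun _ => none, fun _ _ => .num 0⟩ : Ghost V (Value dom)).Is i a := by
    rintro i a ⟨h1, h2, -⟩
    simp only at h2
    omega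
  refine ⟨fun e _ => ?_, rfl, fun i a h => (hno i a h).elim, fun _ _ _ => rfl,
    fun _ _ h => (h rfl).elim, fun i a h => (hno i a h).elim, fun _ h => (h rfl).elim⟩
  constructor
  · exact fun _ h => (h rfl).elim
  · exact fun _ h => (h rfl).elim
  · exact fun _ h => (h rfl).elim
  · exact fun _ => .inl rfl
  · exact ⟨fun _ _ _ h => by simp at h, fun _ h => (h rfl).elim, fun _ _ _ _ => rfl⟩
  · simp
  · exact fun _ => ⟨le_rfl, .inl rfl⟩
  · exact fun i h => (hno i _ h).elim
  · exact fun i h => (hno i _ h).elim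
  · exact fun _ => ⟨[], List.nodup_nil, .nil, fun i => by simp [hno]⟩

/-- The amortized bounds telescope along the stream; growth of the potential passes from one
insertion to the next. -/
theorem builds [Fintype V] {I : Index Q} {S : JT V} (hS : S.tags.Nodup) (hroot : S.root = none)
    (hI : ∀ e, I.ins e = insertProg S (some e.1)) {L : Limits} {N : ℕ} (hL : Enough S L N)
    (hc : ∀ e ∈ Q.rels, 1 + N * (Fintype.card V + 1 + 8 * (S.paths []).length) +
      (prepareProg S (some e)).cost ≤ L.cells) {c : ℕ}
    (hcost : ∀ e ∈ Q.rels, insertCost S (some e) ≤ c) (D : List (Q.Fact dom))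
    (hD : D.length ≤ N) :
    ∃ G σ T, I.Builds L D (enc σ G.row) T ∧ Inv S G σ (fun _ => ∅) ∧ Reflects G D ∧
      T ≤ c * D.length + c * potential S G σ := by
  induction D using List.reverseRecOn with
  | nil =>
    refine ⟨_, _, 0, ?_, Inv.empty S, ⟨le_rfl, by simp, fun i h1 h2 => ?_⟩, Nat.zero_le _⟩
    · have : enc (fun _ => 0) (fun _ (_ : V) => .num 0) = (Mem.empty : Mem (Value dom)) := by
        funext a
        unfold enc rowCell Mem.empty
        split_ifs
        · split
          · rename_i y hy
            cases Encodable.decode₂ V y <;> rfl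
          · rfl
        · rfl
      rw [this]
      exact .nil
    · simp only at h2
      omega
  | append_singleton D t ih =>
    rw [List.length_append, List.length_singleton] at hD
    obtain ⟨G, σ, T, hB, hInv, hR, hT⟩ := ih (by omega)
    obtain ⟨k, f', g', M', he, σ', rfl, hInv', hp, hk⟩ :=
      runs_insertProg hS hroot hL (by have := hR.le; omega) (hc _ t.1.2)
        (Option.some_ne_none t.1.1) hInv (f := tupleWords t.2)
        (fun x hx => by rw [tupleWords_of_mem t.2 hx]; trivial) (fun _ => .num 0)
    rw [← tupleInput_eq] at he
    refine ⟨_, σ', T + k, .snoc D t _ T k _ hB (by rw [hI]; exact he), hInv', hR.insert t, ?_⟩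
    rw [List.length_append, List.length_singleton]
    obtain ⟨d, hd⟩ := Nat.exists_eq_add_of_le hp
    rw [hd] at hk ⊢
    -- In terms of the increase `d` of the potential, the factor of the relation can be replaced by
    -- the uniform `c`.
    have hk' : k ≤ insertCost S (some t.1.1) * (d + 1) := by
      have e : insertCost S (some t.1.1) * (potential S G σ + d) =
        insertCost S (some t.1.1) * potential S G σ + insertCost S (some t.1.1) * d := by ring
      rw [Nat.mul_succ]
      omega
    have := hk'.trans (Nat.mul_le_mul_right (d + 1) (hcost _ t.1.2))
    nlinarith

omit [Encodable V] in
theorem mem_results {R : Q.Database dom} {q : ∀ x, dom x} :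
    q ∈ Q.results R ↔ ∀ e : {e // e ∈ Q.rels}, (⟨e, project e.1 q⟩ : Q.Fact dom) ∈ R := by
  simp [JoinQuery.results]

omit [Encodable V] in
-- A new result must project to `t`, since otherwise all its projections would already be in `R`;
-- conversely a result that projects to `t` is new because `t ∉ R`.
theorem mem_delta {R : Q.Database dom} {t : Q.Fact dom} (ht : t ∉ R) {q : ∀ x, dom x} :
    q ∈ Q.delta R t ↔ project t.1.1 q = t.2 ∧ ∀ e : {e // e ∈ Q.rels}, e ≠ t.1 →
      (⟨e, project e.1 q⟩ : Q.Fact dom) ∈ R := by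
  obtain ⟨e₀, t⟩ := t
  rw [JoinQuery.delta, Set.mem_sdiff, mem_results, mem_results]
  constructor
  · rintro ⟨h1, h2⟩
    have h3 : ∀ e : {e // e ∈ Q.rels}, e ≠ e₀ → (⟨e, project e.1 q⟩ : Q.Fact dom) ∈ R := by
      intro e he
      rcases h1 e with h | h
      · exact (he (congrArg Sigma.fst h)).elim
      · exact h
    refine ⟨?_, h3⟩
    rcases h1 e₀ with h | h
    · simpa using h
    · refine (h2 fun e => ?_).elim
      by_cases he : e = e₀
      · exact he ▸ h
      · exact h3 e he
  · rintro ⟨h1, h2⟩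
    simp only at h1
    refine ⟨fun e => ?_, fun h => ht ?_⟩
    · by_cases he : e = e₀
      · subst he
        exact .inl (by rw [h1])
      · exact .inr (h2 e he)
    · rw [← h1]
      exact h e₀

omit [Encodable V] in
theorem Reflects.exists_iff {G : Ghost V (Value dom)} {D : List (Q.Fact dom)} (h : Reflects G D)
    (e : {e // e ∈ Q.rels}) (q : ∀ x, dom x) :
    (∃ i, G.Is i (some e.1) ∧ ∀ x ∈ att (some e.1), G.row i x = word q x) ↔
      (⟨e, project e.1 q⟩ : Q.Fact dom) ∈ Q.ofStream D :=
  (h.mem_iff (t := ⟨e, project e.1 q⟩)).symm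

omit [Encodable V] in
theorem joins_eq_delta {G : Ghost V (Value dom)} {D : List (Q.Fact dom)} (h : Reflects G D)
    {t : Q.Fact dom} (ht : t ∉ Q.ofStream D) {J : JT V} (hJ : Q.IsJoinTree J t.1.1) :
    joins G J (tupleWords t.2) = Q.delta (Q.ofStream D) t := by
  ext q
  rw [mem_delta ht, joins, Set.mem_ofPred_eq, hJ.root]
  refine and_congr ?_ ?_
  · constructor
    · intro h1
      funext ⟨x, hx⟩
      have := h1 x hx
      rw [tupleWords_of_mem _ hx] at this
      simpa [word, eq_comm, project] using this
    · intro h1 x hx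
      have hx : x ∈ t.1.1 := hx
      rw [tupleWords_of_mem _ hx, ← h1]
      rfl
  · constructor
    · intro h1 e he
      rw [← h.exists_iff]
      exact h1 _ ((hJ.mem_labs _).2 ⟨e.1, e.2, fun hc => he (Subtype.ext hc), rfl⟩)
    · intro h1 a ha
      obtain ⟨e, he, het, rfl⟩ := (hJ.mem_labs a).1 ha
      rw [h.exists_iff ⟨e, he⟩]
      exact h1 _ fun hc => het (congrArg Subtype.val hc)

omit [Encodable V] in
-- The additional root has no attributes, so `f` is irrelevant and every tuple of `r` belongs to the
-- single group with the empty key.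
theorem joins_eq_results {G : Ghost V (Value dom)} {D : List (Q.Fact dom)} (h : Reflects G D)
    {r : Finset V} (hr : r ∈ Q.rels) {J : JT V} (hJ : Q.IsJoinTree J r) (τ : ℕ)
    (f : V → Word (Value dom)) :
    joins G (.join τ (.leaf none) J) f = Q.results (Q.ofStream D) := by
  ext q
  rw [mem_results, joins, Set.mem_ofPred_eq]
  simp only [JT.labs, List.nil_append, List.mem_cons, hJ.root, hJ.mem_labs]
  constructor
  · rintro ⟨-, h1⟩ e
    rw [← h.exists_iff]
    by_cases he : e.1 = r
    · exact h1 _ (.inl (by rw [he]))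
    · exact h1 _ (.inr ⟨e.1, e.2, he, rfl⟩)
  · intro h1
    refine ⟨fun x hx => ?_, fun a ha => ?_⟩
    · simp [JT.root, att] at hx
    · have : ∃ e : {e // e ∈ Q.rels}, a = some e.1 := by
        rcases ha with rfl | ⟨e, he, -, rfl⟩
        · exact ⟨⟨r, hr⟩, rfl⟩
        · exact ⟨⟨e, he⟩, rfl⟩
      obtain ⟨e, rfl⟩ := this
      rw [h.exists_iff]
      exact h1 e

omit [Encodable V] in
theorem JoinQuery.IsJoinTree.has {J : JT V} {r : Finset V} (hJ : Q.IsJoinTree J r) (x : V) :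
    J.Has x := by
  obtain ⟨e, he, hx⟩ := Q.covers x
  by_cases her : e = r
  · exact .inl (by rw [hJ.root, ← her]; exact hx)
  · exact .inr ⟨some e, (hJ.mem_labs _).2 ⟨e, he, her, rfl⟩, hx⟩

end Stream

/-! ## The index -/

section Main

variable {V : Type u}

theorem exists_bound {X : Type*} (l : List X) (F : X → ℕ) : ∃ B, ∀ x ∈ l, F x ≤ B := by
  induction l with
  | nil => exact ⟨0, by simp⟩
  | cons x l ih =>
    obtain ⟨B, hB⟩ := ih
    refine ⟨max (F x) B, fun y hy => ?_⟩
    rcases List.mem_cons.1 hy with rfl | hy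
    · exact le_max_left _ _
    · exact (hB y hy).trans (le_max_right _ _)

theorem exists_density (l : List (JT V)) : ∃ φ : ℝ, 0 < φ ∧ φ ≤ 1 ∧ ∀ T ∈ l, φ ≤ T.density := by
  induction l with
  | nil => exact ⟨1, one_pos, le_rfl, by simp⟩
  | cons T l ih =>
    obtain ⟨φ, h1, h2, h3⟩ := ih
    refine ⟨min T.density φ, lt_min T.density_pos h1, (min_le_right _ _).trans h2, fun T' hT' => ?_⟩
    rcases List.mem_cons.1 hT' with rfl | hT'
    · exact min_le_left _ _
    · exact (min_le_right _ _).trans (h3 T' hT')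

variable {A : Type v}

theorem clean_of_edges {G : Ghost V A} {σ : Key A → ℕ} {m : ℕ} {T : JT V} {us : List (Edge V)}
    (h : ∀ e ∈ T.paths us, EInv G σ e.1 ∅ ∧ (∀ i, σ (aWt e.1.tag i) < 2 ^ m) ∧
      ∀ k, σ (aCap e.1.tag k) < 2 ^ m) : Clean G σ m T := by
  induction T generalizing us with
  | leaf => trivial
  | join τ p c ihp ihc =>
    obtain ⟨h1, h2, h3⟩ := h _ List.mem_cons_self
    exact ⟨ihp fun e he => h e (List.mem_cons_of_mem _ (List.mem_append_left _ he)), h1, h2, h3,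
      ihc fun e he => h e (List.mem_cons_of_mem _ (List.mem_append_right _ he))⟩

theorem JT.exists_mem_paths (T : JT V) (us us' : List (Edge V)) :
    ∀ e ∈ T.paths us, ∃ e' ∈ T.paths us', e'.1 = e.1 := by
  induction T generalizing us us' with
  | leaf => simp [paths]
  | join τ p c ihp ihc =>
    intro e he
    simp only [paths, List.mem_cons, List.mem_append] at he ⊢
    rcases he with rfl | he | he
    · exact ⟨_, .inl rfl, rfl⟩
    · obtain ⟨e', he', h⟩ := ihp us us' e he
      exact ⟨e', .inr (.inl he'), h⟩
    · obtain ⟨e', he', h⟩ := ihc _ (⟨τ, p.root, sep p c, c⟩ :: us') e he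
      exact ⟨e', .inr (.inr he'), h⟩

/-- The edges of `T` are edges of `S`. -/
def JT.Below (S T : JT V) : Prop :=
  T.size ≤ S.size + 1 ∧ ∃ us, ∀ e ∈ T.paths us, ∃ e' ∈ S.paths [], e'.1 = e.1

theorem JT.below_of_mem_paths {S : JT V} {e : Edge V × List (Edge V)} (he : e ∈ S.paths []) :
    S.Below e.1.c := by
  obtain ⟨⟨us, h⟩, h', -⟩ := JT.paths_sub S [] e he
  exact ⟨by omega, us, fun d hd => ⟨d, h d hd, rfl⟩⟩

/-- The edge above a rooted join tree in `S` already has a parent labelled `none`, so its data serve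
the full query unchanged. -/
theorem JT.below_join {S : JT V} {e : Edge V × List (Edge V)} (he : e ∈ S.paths [])
    (hp : e.1.par = none) : S.Below (.join e.1.tag (.leaf none) e.1.c) := by
  obtain ⟨⟨us, h⟩, h', hK⟩ := JT.paths_sub S [] e he
  refine ⟨by simp only [size]; omega, [], fun d hd => ?_⟩
  simp only [paths, List.nil_append, List.mem_cons] at hd
  rcases hd with rfl | hd
  · refine ⟨e, he, ?_⟩
    obtain ⟨⟨τ, par, K, c⟩, us'⟩ := e
    simp only at hp hK
    subst hp
    simp only [hK]
    rfl
  · obtain ⟨d', hd', hdd⟩ := JT.exists_mem_paths _ _ us d hd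
    exact ⟨d', h d' hd', hdd⟩

variable [Encodable V]

theorem Inv.weights_lt {S : JT V} {G : Ghost V A} {σ : Key A → ℕ} (hI : Inv S G σ fun _ => ∅)
    {N m : ℕ} (hN : G.n ≤ N) (hm : (2 * N + 2) ^ S.size < 2 ^ m) {e : Edge V × List (Edge V)}
    (he : e ∈ S.paths []) :
    (∀ i, σ (aWt e.1.tag i) < 2 ^ m) ∧ ∀ k, σ (aCap e.1.tag k) < 2 ^ m := by
  obtain ⟨h1, h2, -⟩ := (weight_bound (X := 2 * N + 2) (by omega) S []
    fun e he => ⟨_, hI.edges e he⟩).2 e he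
  exact ⟨fun i => (h1 i).trans_lt hm, fun k => (h2 k).trans_lt hm⟩

theorem Inv.clean {S : JT V} {G : Ghost V A} {σ : Key A → ℕ} (hI : Inv S G σ fun _ => ∅)
    {N m : ℕ} (hN : G.n ≤ N) (hm : (2 * N + 2) ^ S.size < 2 ^ m) {T : JT V} (hT : S.Below T) :
    Clean G σ m T := by
  obtain ⟨-, us, h⟩ := hT
  refine clean_of_edges (us := us) fun e he => ?_
  obtain ⟨e', he', hee⟩ := h e he
  rw [← hee]
  exact ⟨hI.edges e' he', hI.weights_lt hN hm he'⟩

/-- Capacities below `2 ^ m` have at most `m` bits, and each tuple has at most two summands per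
edge. -/
theorem potential_le {S : JT V} {G : Ghost V A} {σ : Key A → ℕ} (hI : Inv S G σ fun _ => ∅)
    {N m : ℕ} (hN : G.n ≤ N) (hm : (2 * N + 2) ^ S.size < 2 ^ m) :
    potential S G σ ≤ (S.paths []).length * (N * (2 * m)) := by
  classical
  unfold potential
  refine (List.sum_le_card_nsmul _ (N * (2 * m)) ?_).trans (by simp)
  intro x hx
  obtain ⟨e, he, rfl⟩ := List.mem_map.1 hx
  have h := fun k => Nat.size_le.2 ((hI.weights_lt hN hm he).2 k)
  unfold pot
  refine (Finset.sum_le_card_nsmul _ _ (2 * m) fun i _ => ?_).trans ?_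
  · have := h (key e.1.K (G.row i))
    split_ifs <;> omega
  · simpa using Nat.mul_le_mul_right (2 * m) hN

theorem Inv.inj {S : JT V} {G : Ghost V A} {σ : Key A → ℕ} {D : ℕ → Set ℕ} (hI : Inv S G σ D)
    (i j : ℕ) (a : Lab V) (hi : G.Is i a) (hj : G.Is j a)
    (h : ∀ x ∈ att a, G.row i x = G.row j x) : i = j := by
  rw [← hI.is_id i a hi, ← hI.is_id j a hj, key_eq_iff.2 h]

end Main

/-! ### Choice of the programs and constants -/

section Main

variable {V : Type u}

/-- `N + 1` and `2` are both at most `2 ^ (Nat.log 2 N + 1)`, so `2 * N + 2` is at most its square.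
The final `+ 1` in the exponent makes the inequality strict. -/
theorem pow_lt_two_pow {N B s : ℕ} (hs : s ≤ B) :
    (2 * N + 2) ^ s < 2 ^ (2 * B * (Nat.log 2 N + 1) + 1) := by
  have h1 : N < 2 ^ (Nat.log 2 N + 1) := Nat.lt_pow_succ_log_self one_lt_two N
  have h2 : 2 ≤ 2 ^ (Nat.log 2 N + 1) :=
    le_self_pow (M := ℕ) one_le_two (Nat.succ_ne_zero _)
  have h3 : 2 * N + 2 ≤ 2 ^ (2 * (Nat.log 2 N + 1)) := by
    rw [two_mul (Nat.log 2 N + 1), pow_add]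
    nlinarith
  calc (2 * N + 2) ^ s ≤ (2 ^ (2 * (Nat.log 2 N + 1))) ^ B :=
        (Nat.pow_le_pow_right (by omega) hs).trans (Nat.pow_le_pow_left h3 B)
    _ = 2 ^ (2 * B * (Nat.log 2 N + 1)) := by rw [← pow_mul]; congr 1; ring
    _ < _ := Nat.pow_lt_pow_right one_lt_two (Nat.lt_succ_self _)

variable {Q : JoinQuery V}

theorem JoinQuery.IsJoinTree.joined {J : JT V} {r : Finset V} (h : Q.IsJoinTree J r) (τ : ℕ) :
    (∀ x, (JT.join τ (.leaf none) J).Has x) ∧ (JT.join τ (.leaf none) J).Valid := by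
  refine ⟨fun x => JT.has_join.2 (.inr (h.has x)), trivial, h.valid, ?_⟩
  rintro x (hx | ⟨a, ha, -⟩)
  · simp [JT.root, att] at hx
  · simp [JT.labs] at ha

variable [Encodable V]

/-- The programs for the tree `S` of all rooted join trees `J e` of the query. -/
noncomputable def indexOf (Q : JoinQuery V) (S T : JT V) (J : {e // e ∈ Q.rels} → JT V) :
    Index Q where
  ins e := insertProg S (some e.1)
  size := sizeProg T
  access := entryProg T
  deltaSize e := sizeProg (J e)
  deltaAccess e := entryProg (J e)

theorem represents_below {dom : V → Type v} {D : List (Q.Fact dom)} {S T : JT V}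
    {G : Ghost V (Value dom)} {σ : Key (Value dom) → ℕ} (hI : Inv S G σ fun _ => ∅)
    (hR : Reflects G D) (hT : S.Below T) (hcov : ∀ x, T.Has x) (hv : T.Valid)
    {f : V → Word (Value dom)} (hf : ∀ x ∈ att T.root, ∃ v, f x = .atom ⟨x, v⟩) {L : Limits} {m : ℕ}
    (hm : m = 2 * (S.size + 1) * (Nat.log 2 D.length + 1) + 1) (hL : m ≤ L.bits) {φ : ℝ}
    (hφ : φ ≤ T.density) {a b : ℕ} (ha : (sizeProg T).cost ≤ a)
    (hb : accessCost T * (m + 1) + 1 ≤ b) :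
    Represents L (enc σ G.row) (sizeProg T) (entryProg T) (Sum.elim f fun _ => .num 0)
      (joins G T f) φ a b := by
  have hS : (2 * D.length + 2) ^ S.size < 2 ^ m := hm ▸ pow_lt_two_pow (Nat.le_succ _)
  have hT' : (2 * D.length + 2) ^ T.size < 2 ^ m := hm ▸ pow_lt_two_pow hT.1
  obtain ⟨us, h⟩ := hT.2
  refine represents (by omega) hL (hI.clean hR.le hS hT) (us := us) (fun e he => ?_) hR.le
    (hT'.trans_le (Nat.pow_le_pow_right two_pos hL)) hcov hv hf hR.atom hI.inj hφ ha hb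
  obtain ⟨e', he', hee⟩ := h e he
  exact ⟨_, hee ▸ hI.edges e' he'⟩

end Main

end JoinIndex

open JoinIndex

theorem mainTheorem2 {V : Type*} [Finite V] (Q : JoinIndex.JoinQuery V) (hQ : Q.Acyclic) :
    ∃ (I : JoinIndex.Index Q) (C : ℕ) (φ : ℝ), 0 < φ ∧ φ ≤ 1 ∧
      ∀ (dom : V → Type*) (D : List (Q.Fact dom)) (N lg : ℕ) (L : JoinIndex.Limits),
        N = D.length → lg = Nat.log 2 N + 1 → L = ⟨C * lg, C * (N + 1)⟩ →
        ∃ (M : JoinIndex.Mem (JoinIndex.Value dom)) (T : ℕ),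
          I.Builds L D M T ∧ T ≤ C * N * lg ∧
          JoinIndex.Represents L M I.size I.access (JoinIndex.noInput dom)
            (Q.results (Q.ofStream D)) φ C (C * lg) ∧
          ∀ t : Q.Fact dom, t ∉ Q.ofStream D →
            JoinIndex.Represents L M (I.deltaSize t.1) (I.deltaAccess t.1)
              (JoinIndex.tupleInput t.2) (Q.delta (Q.ofStream D) t) φ C (C * lg) := by
  classical
  let _ : Fintype V := Fintype.ofFinite V
  let _ : Encodable V := Fintype.toEncodable V
  obtain ⟨S, hroot, htags, hS⟩ := hQ.exists_joinTrees
  have hr : Nonempty {e // e ∈ Q.rels} := by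
    obtain ⟨T, hT, -⟩ := hQ
    exact hT.1.nonempty
  obtain ⟨r⟩ := hr
  choose E hE hpar hJ using fun e : {e // e ∈ Q.rels} => hS e.1 e.2
  set J : {e // e ∈ Q.rels} → JT V := fun e => (E e).1.c with hJdef
  -- Any relation `r` may be chosen for the full query; one exists because a tree has a node.
  set F : JT V := .join (E r).1.tag (.leaf none) (J r) with hF
  obtain ⟨φ, h0, h1, hφ⟩ := exists_density (F :: Q.rels.attach.toList.map J)
  obtain ⟨c₁, hc₁⟩ := exists_bound (S.paths []) fun e => (updateProg e.1 0).cost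
  obtain ⟨c₂, hc₂⟩ := exists_bound Q.rels.toList fun e => (prepareProg S (some e)).cost
  obtain ⟨c₃, hc₃⟩ := exists_bound Q.rels.toList fun e => insertCost S (some e)
  obtain ⟨c₄, hc₄⟩ := exists_bound (F :: Q.rels.attach.toList.map J) fun T => (sizeProg T).cost
  obtain ⟨c₅, hc₅⟩ := exists_bound (F :: Q.rels.attach.toList.map J) accessCost
  have hmem : ∀ e, J e ∈ F :: Q.rels.attach.toList.map J := fun e =>
    List.mem_cons_of_mem _ (List.mem_map_of_mem (by simp))
  set B := S.size + 1 with hB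
  set u := Fintype.card V + 1 + 8 * (S.paths []).length with hu
  -- The summands cover, in this order, the word length, the cells (with those written during an
  -- insertion), the total time of the insertions, the time for a size, and the time for an access.
  obtain ⟨C, hC⟩ : ∃ C, C = (2 * B + 4) + (u + c₁ + c₂ + 6) +
      (c₃ + c₃ * ((S.paths []).length * (2 * (2 * B + 1)))) + c₄ + (c₅ * (2 * B + 2) + 1) :=
    ⟨_, rfl⟩
  refine ⟨indexOf Q S F J, C, φ, h0, h1, ?_⟩
  rintro dom D N lg L rfl rfl rfl
  set lg := Nat.log 2 D.length + 1 with hlg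
  obtain ⟨m, hm⟩ : ∃ m, m = 2 * B * lg + 1 := ⟨_, rfl⟩
  have hmlg : m ≤ (2 * B + 1) * lg := by rw [hm, add_mul]; omega
  have hbits : m + 2 ≤ C * lg := by
    calc m + 2 ≤ (2 * B + 1) * lg + 2 * lg := by omega
      _ = (2 * B + 3) * lg := by ring
      _ ≤ C * lg := Nat.mul_le_mul_right _ (by omega)
  have hpow : (2 * D.length + 2) ^ S.size < 2 ^ m := hm ▸ pow_lt_two_pow (Nat.le_succ _)
  have hcells : u * D.length + (c₁ + c₂ + 6) ≤ C * (D.length + 1) := by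
    calc u * D.length + (c₁ + c₂ + 6) ≤ C * D.length + C :=
          Nat.add_le_add (Nat.mul_le_mul_right _ (by omega)) (by omega)
      _ = C * (D.length + 1) := by ring
  have hEn : Enough S ⟨C * lg, C * (D.length + 1)⟩ D.length := by
    refine ⟨?_, fun e he => ?_⟩
    · calc 4 * (2 * D.length + 2) ^ S.size < 4 * 2 ^ m := by omega
        _ = 2 ^ (m + 2) := by ring
        _ ≤ 2 ^ (C * lg) := Nat.pow_le_pow_right two_pos hbits
    · have := hc₁ e he
      have := mul_comm u D.length
      change 1 + D.length * u + _ + 5 ≤ C * (D.length + 1)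
      omega
  obtain ⟨G, σ, T, hT, hI, hR, hTle⟩ := builds (I := indexOf Q S F J) htags hroot (fun _ => rfl) hEn
    (fun e he => by
      have := hc₂ e (by simpa using he)
      have := mul_comm u D.length
      change 1 + D.length * u + _ ≤ C * (D.length + 1)
      omega) (fun e he => hc₃ e (by simpa using he)) D le_rfl
  have hacc : ∀ T ∈ F :: Q.rels.attach.toList.map J, accessCost T * (m + 1) + 1 ≤ C * lg :=
    fun T hT => by
      calc accessCost T * (m + 1) + 1 ≤ c₅ * ((2 * B + 2) * lg) + 1 * lg :=
            Nat.add_le_add (Nat.mul_le_mul (hc₅ T hT) (by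
              calc m + 1 ≤ (2 * B + 1) * lg + lg := by omega
                _ = _ := by ring)) (by omega)
        _ = (c₅ * (2 * B + 2) + 1) * lg := by ring
        _ ≤ C * lg := Nat.mul_le_mul_right _ (by omega)
  refine ⟨_, T, hT, ?_, ?_, fun t ht => ?_⟩
  · have hp := potential_le hI hR.le hpow
    calc T ≤ c₃ * D.length + c₃ * potential S G σ := hTle
      _ ≤ c₃ * (D.length * lg) + c₃ * ((S.paths []).length * (D.length * (2 *
          ((2 * B + 1) * lg)))) := by
        refine Nat.add_le_add (Nat.mul_le_mul_left _ (Nat.le_mul_of_pos_right _ (by omega)))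
          (Nat.mul_le_mul_left _ (hp.trans ?_))
        gcongr
      _ = (c₃ + c₃ * ((S.paths []).length * (2 * (2 * B + 1)))) * (D.length * lg) := by ring
      _ ≤ C * (D.length * lg) := Nat.mul_le_mul_right _ (by omega)
      _ = _ := (mul_assoc _ _ _).symm
  · have hn : noInput dom = Sum.elim (fun _ => .num 0) fun _ => .num 0 := by
      funext x
      rcases x with x | x <;> rfl
    rw [← joins_eq_results hR r.2 (hJ r) (E r).1.tag fun _ => .num 0, hn]
    exact represents_below hI hR (JT.below_join (hE r) (hpar r)) ((hJ r).joined _).1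
      ((hJ r).joined _).2 (fun x hx => by simp [JT.root, att] at hx) hm (by simp only; omega)
      (hφ F List.mem_cons_self) ((hc₄ F List.mem_cons_self).trans (by omega))
      (hacc F List.mem_cons_self)
  · rw [← joins_eq_delta hR ht (hJ t.1), tupleInput_eq]
    refine represents_below hI hR (JT.below_of_mem_paths (hE t.1)) (fun x => (hJ t.1).has x)
      (hJ t.1).valid (fun x hx => ?_) hm (by simp only; omega) (hφ _ (hmem t.1))
      ((hc₄ _ (hmem t.1)).trans (by omega)) (hacc _ (hmem t.1))
    rw [(hJ t.1).root] at hx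
    exact ⟨_, tupleWords_of_mem t.2 hx⟩
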